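/- **Theorem.** Let $d\ge 0$ and let $(P_s)_{s\ge 0}$ be a (conservative) Markov transition function on $\mathbf R^d\times\mathbf R$. Suppose the following. 1. *Generator $L+A$.* The first coordinate is by itself Markov: $P_s((y,v),B\times\mathbf R)=Q_s(y,B)$ for all $v$. Let $L$ be the generator of $(Q_s)$. For a jump density $\nu(v,w;p)$ put $$A_p\phi(v)=\int_0^\infty(\phi(v+w)-\phi(v))\,\nu(v,w;p)\,dw .$$ For all $h$ in the domain of $L$ and $\phi\in C_c^\infty(\mathbf R)$ the function $h(y)\phi(v)$ lies in the domain of the generator of $(P_s)$, and its image is $(Lh)(y)\phi(v)+h(y)(A_y\phi)(v)$. Here the generator of a transition function $(P_s)$ is its full generator, i.e. the set of pairs $(f,g)$ of bounded measurable functions with $P_sf-f=\int_0^sP_rg\,dr$ for all $s\ge0$; accordingly, "$h$ in the domain of $L$ with image $Lh$" refers to any pair $(h,Lh)$ in the full generator of $(Q_s)$. 2. *Jump density.* $\nu$ is measurable, $\nu(v,w;p)>0$ for $w>0$, $\sup_{v,p}\int_0^\infty\min(1,w)\,\nu(v,w;p)\,dw<\infty$, and $A_p\phi$ is continuous for every $p$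 and every $\phi\in C_c^\infty(\mathbf R)$. 3. *Density.* For $s>0$, $P_s((y_0,v_0),\cdot)$ has a density $G(s;y_0,v_0;y,v)\ge 0$ with respect to Lebesgue measure which, for each $(y_0,v_0)$, is continuous in $(s,y,v)$, $s>0$. Let $(Y_s,V_s)_{s\ge0}$ be a Markov process with transition function $(P_s)$, started at $(y_0,v_0)$, with almost surely right-continuous paths. Let $t>v_0$ and $$Z_t=\inf\{u\ge 0: V_u>t\}\in[0,\infty].$$ Let $K>0$ and let $F$ be a bounded continuous function on $\mathbf R^d$. (The integrals over $[1/K,K]$ are over this set, which is empty if $K<1$.) (i) Suppose that the adjoint image $A^*_{(v;y)}G$ exists as a function in the following sense: $A^*_{(\cdot;y)}G(s;y_0,v_0;y,\cdot)$ is a function of $v$ which, for almost every $(y,s)\in\mathbf R^d\times[1/K,K]$, is locally integrable on $\mathbf R$, integrable on $(t,\infty)$ and satisfies $$\int_{\mathbf R}\phi(v)\,A^*_{(v;y)}G(s;y_0,v_0;y,v)\,dv=\int_{\mathbf R}(A_y\phi)(v)\,G(s;y_0,v_0;y,v)\,dv\qquad\text{for all }\phi\in C_c^\infty(\mathbf R).$$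 Then the function $(y,s)\mapsto\int_t^\infty A^*_{(v;y)}G(s;y_0,v_0;y,v)F(y)\,dv$ is integrable on $\mathbf R^d\times[1/K,K]$, and $$\mathbf E\big[F(Y_{Z_t})\mathbf 1(Z_t\in[1/K,K])\big]=\int_{\mathbf R^d} dy\int_{1/K}^K ds\int_t^\infty dv\;A^*_{(v;y)}G(s;y_0,v_0;y,v)\,F(y).$$ (ii) Without any such assumption on $A^*G$, $$\mathbf E\big[F(Y_{Z_t})\mathbf 1(Z_t\in[1/K,K])\big]=\int_{\mathbf R^d} dy\int_{1/K}^K ds\int_{v_0}^t dv\;(A_y\theta_{\ge t})(v)\,G(s;y_0,v_0;y,v)\,F(y)$$ $$=\int_{\mathbf R^d} dy\int_{1/K}^K ds\int_{v_0}^t dv\int_{t-v}^\infty \nu(v,w;y)\,dw\;G(s;y_0,v_0;y,v)\,F(y),$$ where $\theta_{\ge t}$ is the indicator function of $[t,\infty)$, and the function $(y,s,v)\mapsto\int_{t-v}^\infty\nu(v,w;y)\,dw\;G(s;y_0,v_0;y,v)F(y)$ is integrable on $\mathbf R^d\times[1/K,K]\times(v_0,t]$. -/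

import Mathlib

open MeasureTheory ProbabilityTheory Set Filter Topology
open scoped NNReal ENNReal BoundedContinuousFunction

noncomputable section

namespace MonotoneSubordination

/-- A (conservative, time-homogeneous) Markov transition function: a family of probability kernels
satisfying the Chapman-Kolmogorov equations. -/
structure IsTransitionFunction {S : Type*} [MeasurableSpace S] (P : ℝ≥0 → Kernel S S) : Prop where
  markov : ∀ t, IsMarkovKernel (P t)
  zero : P 0 = Kernel.id
  add : ∀ s t, P (s + t) = (P t).comp (P s)

/-- `X` is a Markov process on `(Ω, μ)` with transition function `P`, started at `x₀`. The Markov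
property says that, for every event `C` of the past `σ(X r : r ≤ s)`,
`μ (C ∩ {X (s + t) ∈ B}) = ∫_C P t (X s, B) dμ`. -/
structure IsMarkovProcess {S Ω : Type*} [MeasurableSpace S] [MeasurableSpace Ω]
    (P : ℝ≥0 → Kernel S S) (x₀ : S) (X : ℝ≥0 → Ω → S) (μ : Measure Ω) : Prop where
  measurable : ∀ s, Measurable (X s)
  initial : ∀ᵐ ω ∂μ, X 0 ω = x₀
  markov : ∀ (s t : ℝ≥0) (C : Set Ω) (B : Set S),
    MeasurableSet[⨆ r ∈ Iic s, MeasurableSpace.comap (X r) inferInstance] C → MeasurableSet B →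
      μ (C ∩ X (s + t) ⁻¹' B) = ∫⁻ ω in C, P t (X s ω) B ∂μ

/-- The (full) generator of a transition function, as a set of pairs `(f, g)`, "`g` is the generator
applied to `f`": `f` and `g` are bounded measurable functions with
`P_t f - f = ∫_0^t P_s g ds` for all `t` and all starting points. -/
def generator {S : Type*} [MeasurableSpace S] (P : ℝ≥0 → Kernel S S) :
    Set ((S → ℝ) × (S → ℝ)) :=
  {p | (Measurable p.1 ∧ ∃ C, ∀ x, |p.1 x| ≤ C) ∧ (Measurable p.2 ∧ ∃ C, ∀ x, |p.2 x| ≤ C) ∧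
    ∀ (t : ℝ≥0) (x : S), (∫ z, p.1 z ∂(P t x)) - p.1 x =
      ∫ s in (0 : ℝ)..t, ∫ z, p.2 z ∂(P s.toNNReal x)}

/-- The smooth compactly supported functions on the line. -/
def IsTestFunction (φ : ℝ → ℝ) : Prop := ContDiff ℝ (⊤ : ℕ∞) φ ∧ HasCompactSupport φ

/-- The operator `(A_p φ)(v) = ∫_0^∞ (φ (v + w) - φ v) ν(v, w; p) dw`. -/
def jumpOp {E : Type*} (ν : ℝ → ℝ → E → ℝ) (p : E) (φ : ℝ → ℝ) (v : ℝ) : ℝ :=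
  ∫ w in Ioi (0 : ℝ), (φ (v + w) - φ v) * ν v w p

/-- Standing assumptions on the jump density `ν(v, w; p)`. By the last one each `A_p` maps test
functions to continuous functions. -/
structure IsJumpDensity {E : Type*} [MeasurableSpace E] (ν : ℝ → ℝ → E → ℝ) : Prop where
  measurable : Measurable fun x : ℝ × ℝ × E => ν x.1 x.2.1 x.2.2
  pos : ∀ v w p, 0 < w → 0 < ν v w p
  bound : ∃ C : ℝ≥0, ∀ v p,
    ∫⁻ w in Ioi (0 : ℝ), ENNReal.ofReal (min 1 w * ν v w p) ≤ C
  continuous : ∀ (φ : ℝ → ℝ) (p : E), IsTestFunction φ → Continuous (jumpOp ν p φ)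

/-- The transition function `P` on `E × ℝ` has generator `L + A`, where `L` is the generator of the
transition function `Q` on `E`, acting on the first variable only, and `A = jumpOp ν` acts on the
second variable with coefficients that may depend on the first: the first coordinate is by itself
Markov with transition function `Q`, and `(L + A)(h ⊗ φ) = (L h) ⊗ φ + h · A φ` for `h` in the domain
of `L` and test functions `φ`. -/
structure HasGeneratorSum {E : Type*} [MeasurableSpace E] (P : ℝ≥0 → Kernel (E × ℝ) (E × ℝ))
    (Q : ℝ≥0 → Kernel E E) (ν : ℝ → ℝ → E → ℝ) : Prop where
  marginal : ∀ (t : ℝ≥0) (y : E) (v : ℝ), (P t (y, v)).map Prod.fst = Q t y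
  product : ∀ h k : E → ℝ, (h, k) ∈ generator Q → ∀ φ : ℝ → ℝ, IsTestFunction φ →
    ((fun z : E × ℝ => h z.1 * φ z.2), fun z : E × ℝ => k z.1 * φ z.2 + h z.1 * jumpOp ν z.1 φ z.2)
      ∈ generator P

/-- `G s y₀ v₀ y v` is a transition density of `P` (with respect to Lebesgue measure, for `s > 0`),
continuous in `(s, y, v)`, `s > 0`. -/
structure IsContinuousTransitionDensity {E : Type*} [MeasureSpace E] [TopologicalSpace E]
    (P : ℝ≥0 → Kernel (E × ℝ) (E × ℝ)) (G : ℝ → E → ℝ → E → ℝ → ℝ) : Prop where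
  nonneg : ∀ s y₀ v₀ y v, 0 < s → 0 ≤ G s y₀ v₀ y v
  density : ∀ (s : ℝ≥0) (y₀ : E) (v₀ : ℝ), 0 < s → P s (y₀, v₀) =
    (volume : Measure (E × ℝ)).withDensity fun z => ENNReal.ofReal (G s y₀ v₀ z.1 z.2)
  continuous : ∀ (y₀ : E) (v₀ : ℝ),
    ContinuousOn (fun x : ℝ × E × ℝ => G x.1 y₀ v₀ x.2.1 x.2.2) (Ioi 0 ×ˢ univ)

/-- `h = A_p^* g`, where `A_p^*` is the adjoint of `A_p`: `∫ φ h dv = ∫ (A_p φ) g dv` for all test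
functions `φ`. -/
structure IsAdjointImage {E : Type*} (ν : ℝ → ℝ → E → ℝ) (p : E) (g h : ℝ → ℝ) : Prop where
  locallyIntegrable : LocallyIntegrable h
  pairing : ∀ φ : ℝ → ℝ, IsTestFunction φ → ∫ v, φ v * h v = ∫ v, jumpOp ν p φ v * g v

/-- The hitting-time inverse `Z_t = inf {u ≥ 0 : V_u > t}`, which is `∞` if there is no such `u`. -/
def inverseTime {Ω : Type*} (V : ℝ≥0 → Ω → ℝ) (t : ℝ) (ω : Ω) : ℝ≥0∞ :=
  ⨅ (u : ℝ≥0) (_ : t < V u ω), (u : ℝ≥0∞)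

/-- `E [F(Y_{Z_t}) 1(Z_t ∈ [1/K, K])]`. -/
def subordinatedExpectation {E Ω : Type*} [MeasurableSpace Ω] (μ : Measure Ω)
    (Y : ℝ≥0 → Ω → E) (V : ℝ≥0 → Ω → ℝ) (t K : ℝ) (F : E → ℝ) : ℝ :=
  ∫ ω, {ω | inverseTime V t ω ∈ Icc (ENNReal.ofReal (1 / K)) (ENNReal.ofReal K)}.indicator
    (fun ω => F (Y (inverseTime V t ω).toNNReal ω)) ω ∂μ

end MonotoneSubordination

end

/-! The mass `E[h(Y_s); V_s ≤ t]` below the level changes for two reasons only. The motion of the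
first coordinate contributes `E[(Lh)(Y_s); V_s ≤ t]`, and the jumps of `V` over `t` remove mass at
the rate `E[h(Y_s) ∫_{t - V_s}^∞ ν(V_s, w; Y_s) dw; V_s < t]`. This is `IsRegularProcess.balance`.
It comes from testing the generator with `h ⊗ (1 - step m t)` and letting `m → ∞`; that `1 - step`
is admissible although not compactly supported follows from the monotonicity of `V`
(`HasGeneratorSum.ae_le`).

The delicate point is the strip `t < V_s < t + 1/m`, where the jump operator applied to the step can
be of order `m`. That the strip contributes nothing in the limit
(`IsRegularProcess.tendsto_aboveRate`) means that `V` does not creep over `t`. While `Y` is bounded,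
the density `G` is bounded near the level, the strip has width `1/m`, and the continuity of `A_p φ`
makes the rate `o(m)`. For large `Y` there is no uniform bound on `G`. There the time integral `U`
of the rates has conditional mean at most one from every starting point, so `E U² ≤ 2 E U` and hence
`E U ≤ 2 P(U ≠ 0)`. If `U ≠ 0`, the path is far away just after it crosses `t`, and right-continuity
makes this improbable.

The balance needs `h` in the domain of `L`, and `F` need not be there. The average of `Q_r F` over
`0 ≤ r ≤ δ` is, with the difference quotient as image. By the Markov property the terms of the
balance become means of averages of `F(Y)` along the path, and path by path they telescope to the
average over `[Z_t, Z_t + δ]` (`path_balance`). Letting `δ → 0` gives the passage formula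
`IsRegularProcess.passage`.

Almost surely `Z_t ∈ [a, b]` exactly if `V_a ≤ t < V_b`. Writing the law of the process by means of
`G` then yields (ii). For (i), the same limit of steps is taken in the pairing that defines `A^* G`,
at almost every fixed `(y, s)` (`IsAdjointImage.integral_Ioi`). -/

noncomputable section

namespace MonotoneSubordination

/-! ### Smooth steps, and bounds for the jump operator applied to them. -/

section JumpOperator

/-- The smooth step `x ↦ σ (l (x - c))`, which vanishes left of `c` and is `1` right of
`c + 1 / l`. -/
def step (l c x : ℝ) : ℝ := Real.smoothTransition (l * (x - c))

lemma step_nonneg (l c x : ℝ) : 0 ≤ step l c x := Real.smoothTransition.nonneg _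

lemma step_le_one (l c x : ℝ) : step l c x ≤ 1 := Real.smoothTransition.le_one _

lemma step_eq_one {l c x : ℝ} (h : 1 ≤ l * (x - c)) : step l c x = 1 :=
  Real.smoothTransition.one_of_one_le h

lemma step_eq_zero {l c x : ℝ} (hl : 0 ≤ l) (h : x ≤ c) : step l c x = 0 :=
  Real.smoothTransition.zero_of_nonpos (mul_nonpos_of_nonneg_of_nonpos hl (by linarith))

lemma step_mono {l : ℝ} (hl : 0 ≤ l) (c : ℝ) : Monotone (step l c) := fun x y h =>
  Real.smoothTransition.monotone (by gcongr)

lemma contDiff_step (l c : ℝ) : ContDiff ℝ (⊤ : ℕ∞) (step l c) :=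
  Real.smoothTransition.contDiff.comp (contDiff_const.mul (contDiff_id.sub contDiff_const))

lemma continuous_step (l c : ℝ) : Continuous (step l c) := (contDiff_step l c).continuous

lemma tendsto_step_nat {t v : ℝ} (h : t < v) : ∀ᶠ m : ℕ in atTop, step m t v = 1 := by
  obtain ⟨n, hn⟩ := exists_nat_ge (1 / (v - t))
  filter_upwards [eventually_ge_atTop n] with m hm
  apply step_eq_one
  have : (1 : ℝ) / (v - t) ≤ m := hn.trans (by exact_mod_cast hm)
  rwa [div_le_iff₀ (by linarith)] at this

/-- The product of the transition with a reflected copy is smooth with compact support, hence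
Lipschitz; the transition itself is that product composed with the contraction `min x 1`. -/
lemma exists_lipschitz_smoothTransition :
    ∃ L : ℝ≥0, LipschitzWith L Real.smoothTransition := by
  set g : ℝ → ℝ := fun x => Real.smoothTransition x * Real.smoothTransition (3 - x) with hg
  have hgs : ContDiff ℝ (⊤ : ℕ∞) g :=
    Real.smoothTransition.contDiff.mul
      (Real.smoothTransition.contDiff.comp (contDiff_const.sub contDiff_id))
  have hgc : HasCompactSupport g := by
    refine HasCompactSupport.intro (isCompact_Icc (a := (0 : ℝ)) (b := 3)) fun x hx => ?_
    rw [mem_Icc, not_and_or, not_le, not_le] at hx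
    rcases hx with hx | hx
    · simp [hg, Real.smoothTransition.zero_of_nonpos hx.le]
    · simp [hg, Real.smoothTransition.zero_of_nonpos (show 3 - x ≤ 0 by linarith)]
  obtain ⟨L, hL⟩ : ∃ L, LipschitzWith L g :=
    ContDiff.lipschitzWith_of_hasCompactSupport hgc hgs (by simp)
  have : Real.smoothTransition = g ∘ fun x => min x 1 := by
    ext x
    simp only [hg, Function.comp]
    rw [Real.smoothTransition.one_of_one_le (x := 3 - min x 1) (by linarith [min_le_right x 1]),
      mul_one]
    rcases le_total x 1 with h | h
    · rw [min_eq_left h]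
    · rw [min_eq_right h, Real.smoothTransition.one_of_one_le h, Real.smoothTransition.one]
  refine ⟨L * 1, ?_⟩
  rw [this]
  exact hL.comp (LipschitzWith.id.min_const 1)

/-- The increments of the steps are controlled by `min 1 w`, with a constant proportional to the
slope. -/
lemma exists_step_sub_le : ∃ Λ : ℝ, 1 ≤ Λ ∧ ∀ l c x w : ℝ, 0 ≤ l → 0 ≤ w →
    step l c (x + w) - step l c x ≤ min 1 (Λ * l * w) := by
  obtain ⟨L, hL⟩ := exists_lipschitz_smoothTransition
  refine ⟨max 1 L, le_max_left _ _, fun l c x w hl hw => le_min ?_ ?_⟩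
  · linarith [step_le_one l c (x + w), step_nonneg l c x]
  · have h := hL.dist_le_mul (l * (x + w - c)) (l * (x - c))
    rw [Real.dist_eq, Real.dist_eq, show l * (x + w - c) - l * (x - c) = l * w by ring,
      abs_of_nonneg (mul_nonneg hl hw)] at h
    calc _ ≤ _ := le_abs_self _
      _ ≤ _ := h
      _ ≤ max 1 (L : ℝ) * (l * w) := by gcongr; exact le_max_right _ _
      _ = _ := by ring

lemma step_sub_nonneg {l : ℝ} (hl : 0 ≤ l) (c x : ℝ) {w : ℝ} (hw : 0 ≤ w) :
    0 ≤ step l c (x + w) - step l c x :=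
  sub_nonneg.2 (step_mono hl c (by linarith))

/-- A step has no compact support, but two steps agree far to the left and far to the right. In the
applications one of them carries the level, and the other is either moved away or constant where the
process lives. -/
lemma isTestFunction_step_sub {l₁ c₁ l₂ c₂ : ℝ} (h₁ : 0 < l₁) (h₂ : 0 < l₂) :
    IsTestFunction (fun x => step l₁ c₁ x - step l₂ c₂ x) := by
  refine ⟨(contDiff_step _ _).sub (contDiff_step _ _), ?_⟩
  refine HasCompactSupport.intro
    (isCompact_Icc (a := min c₁ c₂) (b := max (c₁ + 1 / l₁) (c₂ + 1 / l₂))) fun x hx => ?_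
  rw [mem_Icc, not_and_or, not_le, not_le] at hx
  rcases hx with hx | hx
  · rw [step_eq_zero h₁.le (hx.le.trans (min_le_left _ _)),
      step_eq_zero h₂.le (hx.le.trans (min_le_right _ _)), sub_zero]
  · have e₁ : 1 ≤ l₁ * (x - c₁) := by
      have := (le_max_left (c₁ + 1 / l₁) (c₂ + 1 / l₂)).trans hx.le
      rw [← div_le_iff₀' h₁]; linarith
    have e₂ : 1 ≤ l₂ * (x - c₂) := by
      have := (le_max_right (c₁ + 1 / l₁) (c₂ + 1 / l₂)).trans hx.le
      rw [← div_le_iff₀' h₂]; linarith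
    rw [step_eq_one e₁, step_eq_one e₂, sub_self]

lemma jumpOp_step_eq_zero {E : Type*} (ν : ℝ → ℝ → E → ℝ) (p : E) {l c v : ℝ} (hl : 0 ≤ l)
    (h : 1 ≤ l * (v - c)) : jumpOp ν p (step l c) v = 0 := by
  refine setIntegral_eq_zero_of_forall_eq_zero fun w hw => ?_
  have hw0 : (0 : ℝ) < w := hw
  rw [step_eq_one h, step_eq_one (h.trans (by gcongr; linarith)), sub_self, zero_mul]

lemma jumpOp_step_eq_cross {E : Type*} (ν : ℝ → ℝ → E → ℝ) (p : E) {t v l : ℝ} (hl : 0 ≤ l)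
    (h : v ≤ t) : jumpOp ν p (step l t) v = ∫ w in Ioi (t - v), step l t (v + w) * ν v w p := by
  rw [jumpOp, step_eq_zero hl h]
  refine (setIntegral_eq_of_subset_of_forall_sdiff_eq_zero measurableSet_Ioi
    (Ioi_subset_Ioi (by linarith)) fun w hw => ?_).trans
      (setIntegral_congr_fun measurableSet_Ioi fun w _ => by simp)
  have : w ≤ t - v := not_lt.1 hw.2
  rw [step_eq_zero hl (by linarith), sub_zero, zero_mul]

/-- The rate of jumps from `v` to a value above `t`. -/
def crossRate {E : Type*} (ν : ℝ → ℝ → E → ℝ) (t : ℝ) (z : E × ℝ) : ℝ :=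
  ∫ w in Ioi (t - z.2), ν z.2 w z.1

lemma IsTestFunction.exists_abs_le {φ : ℝ → ℝ} (hφ : IsTestFunction φ) : ∃ M, ∀ x, |φ x| ≤ M :=
  hφ.1.continuous.bounded_above_of_compact_support hφ.2

lemma IsTestFunction.exists_increment_le {φ : ℝ → ℝ} (hφ : IsTestFunction φ) :
    ∃ M, 0 ≤ M ∧ ∀ x w, 0 < w → |φ (x + w) - φ x| ≤ M * min 1 w := by
  obtain ⟨L, hL⟩ : ∃ L, LipschitzWith L φ :=
    ContDiff.lipschitzWith_of_hasCompactSupport hφ.2 hφ.1 (by simp)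
  obtain ⟨M, hM⟩ := hφ.exists_abs_le
  refine ⟨max L (2 * M), le_max_of_le_left L.coe_nonneg, fun x w hw => ?_⟩
  rw [mul_min_of_nonneg _ _ (le_max_of_le_left L.coe_nonneg), mul_one]
  refine le_min (le_max_of_le_right ?_) ?_
  · have h1 := abs_le.1 (hM (x + w))
    have h2 := abs_le.1 (hM x)
    exact abs_le.2 ⟨by linarith, by linarith⟩
  · have h := hL.dist_le_mul (x + w) x
    rw [Real.dist_eq, Real.dist_eq, add_sub_cancel_left, abs_of_pos hw] at h
    exact h.trans (by gcongr; exact le_max_left _ _)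

variable {E : Type*} [MeasurableSpace E] {ν : ℝ → ℝ → E → ℝ}

lemma IsJumpDensity.measurable_right (hν : IsJumpDensity ν) (v : ℝ) (p : E) :
    Measurable fun w => ν v w p :=
  hν.measurable.comp (f := fun w : ℝ => (v, w, p)) (by fun_prop)

lemma IsJumpDensity.exists_integral_le (hν : IsJumpDensity ν) : ∃ C : ℝ, 0 ≤ C ∧ ∀ v p,
    IntegrableOn (fun w => min 1 w * ν v w p) (Ioi 0) ∧
      ∫ w in Ioi (0 : ℝ), min 1 w * ν v w p ≤ C := by
  obtain ⟨C, hC⟩ := hν.bound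
  refine ⟨C, C.2, fun v p => ?_⟩
  have hm : AEStronglyMeasurable (fun w => min 1 w * ν v w p) (volume.restrict (Ioi 0)) := by
    have := hν.measurable_right v p
    exact Measurable.aestronglyMeasurable (by fun_prop)
  have hpos : 0 ≤ᵐ[volume.restrict (Ioi 0)] fun w => min 1 w * ν v w p := by
    filter_upwards [ae_restrict_mem measurableSet_Ioi] with w hw
    exact mul_nonneg (le_min zero_le_one (le_of_lt hw)) (hν.pos v w p hw).le
  constructor
  · refine ⟨hm, ?_⟩
    rw [hasFiniteIntegral_iff_ofReal hpos]
    exact (hC v p).trans_lt ENNReal.coe_lt_top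
  · rw [integral_eq_lintegral_of_nonneg_ae hpos hm]
    exact ENNReal.toReal_le_coe_of_le_coe (hC v p)

lemma IsJumpDensity.integrableOn_mul (hν : IsJumpDensity ν) (v : ℝ) (p : E) {f : ℝ → ℝ} {M : ℝ}
    (hf : Measurable f) (hM : ∀ w, 0 < w → |f w| ≤ M * min 1 w) :
    IntegrableOn (fun w => f w * ν v w p) (Ioi 0) := by
  obtain ⟨C, -, hC⟩ := hν.exists_integral_le
  refine ((hC v p).1.const_mul M).mono' ?_ ?_
  · have := hν.measurable_right v p
    exact Measurable.aestronglyMeasurable (by fun_prop)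
  · filter_upwards [ae_restrict_mem measurableSet_Ioi] with w hw
    rw [norm_mul, Real.norm_eq_abs, Real.norm_eq_abs, abs_of_pos (hν.pos v w p hw), ← mul_assoc]
    have := hν.pos v w p hw
    gcongr
    exact hM w hw

lemma step_increment_le : ∃ Λ : ℝ, 1 ≤ Λ ∧ ∀ l c x w : ℝ, 1 ≤ l → 0 < w →
    |step l c (x + w) - step l c x| ≤ Λ * l * min 1 w := by
  obtain ⟨Λ, hΛ, h⟩ := exists_step_sub_le
  refine ⟨Λ, hΛ, fun l c x w hl hw => ?_⟩
  have hl0 : 0 ≤ l := by linarith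
  rw [abs_of_nonneg (step_sub_nonneg hl0 c x hw.le)]
  refine (h l c x w hl0 hw.le).trans ?_
  rw [mul_min_of_nonneg _ _ (by positivity), mul_one]
  gcongr
  nlinarith

lemma IsJumpDensity.integrableOn_step (hν : IsJumpDensity ν) (v : ℝ) (p : E) {l : ℝ} (hl : 1 ≤ l)
    (c : ℝ) : IntegrableOn (fun w => (step l c (v + w) - step l c v) * ν v w p) (Ioi 0) := by
  obtain ⟨Λ, -, h⟩ := step_increment_le
  refine hν.integrableOn_mul v p (M := Λ * l) ?_ fun w hw => h l c v w hl hw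
  have := continuous_step l c
  fun_prop

lemma IsJumpDensity.jumpOp_step_nonneg (hν : IsJumpDensity ν) (v : ℝ) (p : E) {l : ℝ} (hl : 0 ≤ l)
    (c : ℝ) : 0 ≤ jumpOp ν p (step l c) v :=
  setIntegral_nonneg measurableSet_Ioi fun w hw =>
    mul_nonneg (step_sub_nonneg hl c v (le_of_lt hw)) (hν.pos v w p hw).le

/-- The factor `l` is the slope of the step. For `l = m` this bound does not suffice to neglect a
strip of width `1/m`; see `eventually_jumpOp_step_le`. -/
lemma IsJumpDensity.exists_jumpOp_step_le (hν : IsJumpDensity ν) : ∃ M : ℝ, 0 ≤ M ∧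
    ∀ l c v p, 1 ≤ l → jumpOp ν p (step l c) v ≤ M * l := by
  obtain ⟨Λ, hΛ, h⟩ := step_increment_le
  obtain ⟨C, hC0, hC⟩ := hν.exists_integral_le
  refine ⟨Λ * C, by positivity, fun l c v p hl => ?_⟩
  calc jumpOp ν p (step l c) v ≤ ∫ w in Ioi (0 : ℝ), Λ * l * (min 1 w * ν v w p) := by
        refine setIntegral_mono_on (hν.integrableOn_step v p hl c) ((hC v p).1.const_mul _)
          measurableSet_Ioi fun w hw => ?_
        rw [← mul_assoc]
        have := hν.pos v w p hw
        gcongr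
        exact (le_abs_self _).trans (h l c v w hl hw)
    _ = Λ * l * ∫ w in Ioi (0 : ℝ), min 1 w * ν v w p := integral_const_mul _ _
    _ ≤ Λ * l * C := by gcongr; exact (hC v p).2
    _ = _ := by ring

lemma IsJumpDensity.jumpOp_step_sub (hν : IsJumpDensity ν) (p : E) {l₁ l₂ : ℝ} (h₁ : 1 ≤ l₁)
    (h₂ : 1 ≤ l₂) (c₁ c₂ v : ℝ) : jumpOp ν p (fun x => step l₁ c₁ x - step l₂ c₂ x) v =
      jumpOp ν p (step l₁ c₁) v - jumpOp ν p (step l₂ c₂) v := by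
  simp only [jumpOp]
  rw [← integral_sub (hν.integrableOn_step v p h₁ c₁) (hν.integrableOn_step v p h₂ c₂)]
  congr 1
  ext w
  ring

lemma IsJumpDensity.measurable_jumpOp (hν : IsJumpDensity ν) {φ : ℝ → ℝ} (hφ : Measurable φ) :
    Measurable fun z : E × ℝ => jumpOp ν z.1 φ z.2 := by
  have hm : Measurable fun q : (E × ℝ) × ℝ => ν q.1.2 q.2 q.1.1 :=
    hν.measurable.comp (f := fun q : (E × ℝ) × ℝ => (q.1.2, q.2, q.1.1)) (by fun_prop)
  have : Measurable fun q : (E × ℝ) × ℝ => (φ (q.1.2 + q.2) - φ q.1.2) * ν q.1.2 q.2 q.1.1 :=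
    ((hφ.comp (by fun_prop)).sub (hφ.comp (by fun_prop))).mul hm
  exact (this.stronglyMeasurable.integral_prod_right' (ν := volume.restrict (Ioi 0))).measurable

/-- A crossing from `v < t` needs a jump of size at least `t - v`, and there `min 1 w` is bounded
below. From `v = t` the total rate may be infinite, so the inequality is strict. -/
lemma IsJumpDensity.integrableOn_cross (hν : IsJumpDensity ν) {t v : ℝ} (p : E) (h : v < t) :
    IntegrableOn (fun w => ν v w p) (Ioi (t - v)) := by
  have hm : 0 < min 1 (t - v) := lt_min one_pos (by linarith)
  have h0 := hν.integrableOn_mul v p (f := (Ioi (t - v)).indicator 1) (M := (min 1 (t - v))⁻¹)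
    (measurable_one.indicator measurableSet_Ioi) ?_
  · have h1 := h0.mono_set (s := Ioi (t - v)) (Ioi_subset_Ioi (by linarith))
    refine h1.congr_fun (fun w hw => ?_) measurableSet_Ioi
    simp [indicator_of_mem hw]
  · intro w hw
    by_cases hwt : w ∈ Ioi (t - v)
    · rw [indicator_of_mem hwt, Pi.one_apply, abs_one, inv_mul_eq_div, one_le_div hm]
      exact min_le_min le_rfl (le_of_lt hwt)
    · rw [indicator_of_notMem hwt, abs_zero]
      positivity

lemma IsJumpDensity.measurable_crossRate (hν : IsJumpDensity ν) (t : ℝ) :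
    Measurable (crossRate ν t) := by
  have hm : Measurable fun q : (E × ℝ) × ℝ => ν q.1.2 q.2 q.1.1 :=
    hν.measurable.comp (f := fun q : (E × ℝ) × ℝ => (q.1.2, q.2, q.1.1)) (by fun_prop)
  have hs : MeasurableSet {q : (E × ℝ) × ℝ | t - q.1.2 < q.2} :=
    measurableSet_lt (by fun_prop) (by fun_prop)
  have := ((hm.indicator hs).stronglyMeasurable.integral_prod_right' (ν := volume)).measurable
  convert this using 2 with z
  rw [crossRate, ← integral_indicator measurableSet_Ioi]
  rfl

lemma IsJumpDensity.crossRate_nonneg (hν : IsJumpDensity ν) {t : ℝ} {z : E × ℝ} (h : z.2 ≤ t) :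
    0 ≤ crossRate ν t z :=
  setIntegral_nonneg measurableSet_Ioi fun w hw =>
    (hν.pos _ _ _ (lt_of_le_of_lt (by linarith) hw)).le

lemma IsJumpDensity.jumpOp_step_le_crossRate (hν : IsJumpDensity ν) (p : E) {t v l : ℝ}
    (hl : 0 ≤ l) (h : v < t) : jumpOp ν p (step l t) v ≤ crossRate ν t (p, v) := by
  rw [jumpOp_step_eq_cross ν p hl h.le]
  have hi := hν.integrableOn_cross p h
  refine integral_mono_of_nonneg ?_ hi ?_
  · filter_upwards [ae_restrict_mem measurableSet_Ioi] with w hw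
    exact mul_nonneg (step_nonneg _ _ _) (hν.pos _ _ _ (lt_trans (by linarith) hw)).le
  · filter_upwards [ae_restrict_mem measurableSet_Ioi] with w hw
    exact mul_le_of_le_one_left (hν.pos _ _ _ (lt_trans (by linarith) hw)).le (step_le_one _ _ _)

lemma IsJumpDensity.tendsto_jumpOp_step (hν : IsJumpDensity ν) (p : E) {t v : ℝ} (h : v < t) :
    Tendsto (fun m : ℕ => jumpOp ν p (step m t) v) atTop (𝓝 (crossRate ν t (p, v))) := by
  simp_rw [fun m : ℕ => jumpOp_step_eq_cross ν p (Nat.cast_nonneg m) h.le]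
  have hm := hν.measurable_right v p
  refine tendsto_integral_of_dominated_convergence (fun w => ν v w p) (fun m => ?_)
    (hν.integrableOn_cross p h) (fun m => ?_) ?_
  · have := continuous_step m t
    exact Measurable.aestronglyMeasurable (by fun_prop)
  · filter_upwards [ae_restrict_mem measurableSet_Ioi] with w hw
    have := (hν.pos v w p (lt_trans (by linarith) hw)).le
    rw [Real.norm_of_nonneg (mul_nonneg (step_nonneg _ _ _) this)]
    exact mul_le_of_le_one_left this (step_le_one _ _ _)
  · filter_upwards [ae_restrict_mem measurableSet_Ioi] with w hw
    have : t < v + w := by linarith [mem_Ioi.1 hw]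
    refine tendsto_const_nhds.congr' ?_
    filter_upwards [tendsto_step_nat this] with m hm
    rw [hm, one_mul]

/-- Jumps over a distant threshold have vanishing rate. -/
lemma IsJumpDensity.tendsto_jumpOp_step_threshold (hν : IsJumpDensity ν) (p : E) (v : ℝ) :
    Tendsto (fun m : ℕ => jumpOp ν p (step 1 m) v) atTop (𝓝 0) := by
  obtain ⟨Λ, hΛ, h⟩ := step_increment_le
  obtain ⟨C, hC0, hC⟩ := hν.exists_integral_le
  have hm := hν.measurable_right v p
  rw [← integral_zero ℝ ℝ (μ := volume.restrict (Ioi 0))]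
  refine tendsto_integral_of_dominated_convergence (fun w => Λ * 1 * (min 1 w * ν v w p))
    (fun m => (hν.integrableOn_step v p le_rfl m).aestronglyMeasurable)
    ((hC v p).1.const_mul _) (fun m => ?_) ?_
  · filter_upwards [ae_restrict_mem measurableSet_Ioi] with w hw
    rw [norm_mul, Real.norm_eq_abs, Real.norm_eq_abs, abs_of_pos (hν.pos v w p hw), ← mul_assoc]
    have := hν.pos v w p hw
    gcongr
    exact h 1 m v w le_rfl hw
  · filter_upwards [ae_restrict_mem measurableSet_Ioi] with w hw
    obtain ⟨n, hn⟩ := exists_nat_ge (v + w)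
    refine tendsto_const_nhds.congr' ?_
    filter_upwards [eventually_ge_atTop n] with m hm
    have hmn : v + w ≤ m := hn.trans (by exact_mod_cast hm)
    rw [step_eq_zero zero_le_one hmn, step_eq_zero zero_le_one (by linarith [mem_Ioi.1 hw]),
      sub_zero, zero_mul]

/-- The two sides treat jumps landing exactly on `t` differently, but these form a null set of jump
sizes. -/
lemma jumpOp_indicator_Ici {E : Type*} (ν : ℝ → ℝ → E → ℝ) (p : E) {t v : ℝ} (h : v < t) :
    jumpOp ν p ((Ici t).indicator 1) v = crossRate ν t (p, v) := by
  rw [jumpOp, crossRate, ← integral_Ici_eq_integral_Ioi,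
    ← integral_Ici_eq_integral_Ioi (x := t - v)]
  rw [indicator_of_notMem (show v ∉ Ici t from not_le.2 h)]
  refine (setIntegral_eq_of_subset_of_forall_sdiff_eq_zero measurableSet_Ici
    (Ici_subset_Ici.2 (show (0 : ℝ) ≤ t - v by linarith)) fun w hw => ?_).trans
      (setIntegral_congr_fun measurableSet_Ici fun w hw => ?_)
  · have : v + w ∉ Ici t := fun h' => hw.2 (by simp only [mem_Ici] at h' ⊢; linarith)
    rw [indicator_of_notMem this, sub_zero, zero_mul]
  · have : v + w ∈ Ici t := by simp only [mem_Ici] at hw ⊢; linarith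
    simp [indicator_of_mem this]

/-- A function with slope one near zero which is constant to the right of `5`. -/
def ramp (x : ℝ) : ℝ := x * (1 - step 1 2 x) + 5 * step 1 2 x

lemma ramp_of_le {x : ℝ} (h : x ≤ 2) : ramp x = x := by
  rw [ramp, step_eq_zero zero_le_one h]; ring

lemma ramp_of_ge {x : ℝ} (h : 3 ≤ x) : ramp x = 5 := by
  rw [ramp, step_eq_one (by linarith)]; ring

lemma ramp_nonneg {x : ℝ} (h : 0 ≤ x) : 0 ≤ ramp x :=
  add_nonneg (mul_nonneg h (by linarith [step_le_one 1 2 x]))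
    (mul_nonneg (by norm_num) (step_nonneg _ _ _))

lemma ramp_le {x : ℝ} (h : x ≤ 5) : ramp x ≤ 5 := by
  rw [ramp]; nlinarith [step_le_one 1 2 x]

/-- The final value `5` lies beyond the transition zone `[2, 3]`, so for `x ≤ 5` the value `ramp x`,
a mean of `x` and `5`, does not fall behind `x`. -/
lemma min_le_ramp_sub {u w : ℝ} (hu : u ≤ 1) : min 1 w ≤ ramp (u + w) - ramp u := by
  rw [ramp_of_le (x := u) (by linarith)]
  rcases le_total (u + w) 2 with h | h
  · rw [ramp_of_le h]
    linarith [min_le_right 1 w]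
  rcases le_total (u + w) 5 with h' | h'
  · have : u + w ≤ ramp (u + w) := by
      rw [ramp]; nlinarith [step_nonneg 1 2 (u + w)]
    linarith [min_le_right 1 w]
  · rw [ramp_of_ge (by linarith)]
    linarith [min_le_left 1 w]

lemma ramp_le_min {w : ℝ} (hw : 0 ≤ w) : ramp w ≤ 5 * min 1 w := by
  rcases le_total w 1 with h | h
  · rw [ramp_of_le (by linarith), min_eq_right h]; linarith
  · rw [min_eq_left h]
    rcases le_total w 5 with h' | h'
    · linarith [ramp_le h']
    · rw [ramp_of_ge (by linarith)]; norm_num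

/-- Locally uniformly in the starting level, small jumps contribute little to the mean of the jumps:
this follows from the continuity of `A_p φ` for test functions. -/
lemma IsJumpDensity.exists_small_jumps (hν : IsJumpDensity ν) (p : E) (t : ℝ) {η : ℝ} (hη : 0 < η) :
    ∃ κ : ℝ, 0 < κ ∧ κ ≤ 1 ∧ ∀ v ∈ Icc t (t + κ), ∫ w in Ioi (0 : ℝ), min κ w * ν v w p ≤ η := by
  obtain ⟨C, hC0, hC⟩ := hν.exists_integral_le
  have hmin : ∀ κ : ℝ, 0 < κ → κ ≤ 1 → ∀ v, IntegrableOn (fun w => min κ w * ν v w p) (Ioi 0) := by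
    intro κ h0 h1 v
    refine hν.integrableOn_mul v p (M := 1) (by fun_prop) fun w hw => ?_
    rw [abs_of_pos (lt_min h0 hw), one_mul]
    exact min_le_min h1 le_rfl
  -- The errors at scale `κ = 1 / (n + 1)`: `2 κ C` pays for jumps that may leave the region where
  -- the cutoff is `1`, and the second term is the comparison at the level `t` itself.
  have hlim : Tendsto (fun n : ℕ => 2 * (1 / ((n : ℝ) + 1)) * C +
      5 * ∫ w in Ioi (0 : ℝ), min (1 / ((n : ℝ) + 1)) w * ν t w p) atTop (𝓝 0) := by
    have h0 := tendsto_one_div_add_atTop_nhds_zero_nat (𝕜 := ℝ)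
    have h1 : Tendsto (fun n : ℕ => ∫ w in Ioi (0 : ℝ), min (1 / ((n : ℝ) + 1)) w * ν t w p) atTop
        (𝓝 (∫ w in Ioi (0 : ℝ), min 0 w * ν t w p)) := by
      refine tendsto_integral_of_dominated_convergence (fun w => min 1 w * ν t w p) (fun n => ?_)
        (hC t p).1 (fun n => ?_)
        (Eventually.of_forall fun w => (h0.min tendsto_const_nhds).mul_const _)
      · refine (hmin _ (by positivity) ?_ t).aestronglyMeasurable
        exact div_le_one_of_le₀ (by linarith [n.cast_nonneg (α := ℝ)]) (by positivity)
      · filter_upwards [ae_restrict_mem measurableSet_Ioi] with w hw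
        have := hν.pos t w p hw
        have hw0 : (0 : ℝ) < w := hw
        rw [Real.norm_of_nonneg (by positivity)]
        gcongr
        exact div_le_one_of_le₀ (by linarith [n.cast_nonneg (α := ℝ)]) (by positivity)
    have h2 : ∫ w in Ioi (0 : ℝ), min 0 w * ν t w p = 0 :=
      setIntegral_eq_zero_of_forall_eq_zero fun w hw => by
        rw [min_eq_left (le_of_lt hw), zero_mul]
    rw [h2] at h1
    simpa using ((h0.const_mul 2).mul_const C).add (h1.const_mul 5)
  obtain ⟨n, hn⟩ := ((tendsto_order.1 hlim).2 (η / 2) (by positivity)).exists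
  set κ : ℝ := 1 / ((n : ℝ) + 1) with hκdef
  have hκ : 0 < κ := by positivity
  have hκ1 : κ ≤ 1 := div_le_one_of_le₀ (by linarith [n.cast_nonneg (α := ℝ)]) (by positivity)
  -- From `v ∈ [t, t + κ]` the increments of `ψ` dominate `min κ w` up to the cutoff, and from `t`
  -- they are at most `5 min κ w`. Continuity of `A_p ψ` at `t` carries the smallness from `t` to
  -- nearby levels.
  set ψ : ℝ → ℝ := fun x => κ * ramp ((x - t) / κ) * (step 1 (t - 2) x - step 1 (t + 3) x) with hψ
  have hψt : IsTestFunction ψ := by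
    obtain ⟨h1, h2⟩ := isTestFunction_step_sub (c₁ := t - 2) (c₂ := t + 3) one_pos one_pos
    refine ⟨ContDiff.mul ?_ h1, h2.mul_left⟩
    have hl : ContDiff ℝ (⊤ : ℕ∞) fun x : ℝ => (x - t) / κ :=
      (contDiff_id.sub contDiff_const).div_const _
    have hr : ContDiff ℝ (⊤ : ℕ∞) ramp :=
      (contDiff_id.mul (contDiff_const.sub (contDiff_step 1 2))).add
        (contDiff_const.mul (contDiff_step 1 2))
    exact contDiff_const.mul (hr.comp hl)
  have hcut : ∀ x, t - 1 ≤ x → x ≤ t + 3 → ψ x = κ * ramp ((x - t) / κ) := by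
    intro x h1 h2
    simp only [hψ]
    rw [step_eq_one (by linarith), step_eq_zero zero_le_one h2, sub_zero, mul_one]
  have hcut1 : ∀ x, step 1 (t - 2) x - step 1 (t + 3) x ∈ Icc 0 1 := fun x => by
    refine ⟨sub_nonneg.2 (Real.smoothTransition.monotone (by linarith)), ?_⟩
    linarith [step_le_one 1 (t - 2) x, step_nonneg 1 (t + 3) x]
  have hψ0 : ∀ x, t ≤ x → 0 ≤ ψ x := fun x hx =>
    mul_nonneg (mul_nonneg hκ.le (ramp_nonneg (div_nonneg (by linarith) hκ.le))) (hcut1 x).1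
  have hψi : ∀ v, IntegrableOn (fun w => (ψ (v + w) - ψ v) * ν v w p) (Ioi 0) := by
    intro v
    obtain ⟨M, -, hM⟩ := hψt.exists_increment_le
    have := hψt.1.continuous.measurable
    exact hν.integrableOn_mul v p (by fun_prop) fun w hw => hM v w hw
  have hlow : ∀ v ∈ Icc t (t + κ), ∫ w in Ioi (0 : ℝ), min κ w * ν v w p ≤
      jumpOp ν p ψ v + 2 * κ * C := by
    intro v hv
    have hv3 : ψ v = v - t := by
      rw [hcut v (by linarith [hv.1]) (by linarith [hv.2]), ramp_of_le]
      · field_simp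
      · rw [div_le_iff₀ hκ]; linarith [hv.2]
    calc ∫ w in Ioi (0 : ℝ), min κ w * ν v w p
        ≤ ∫ w in Ioi (0 : ℝ), ((ψ (v + w) - ψ v) * ν v w p + 2 * κ * (min 1 w * ν v w p)) := by
          refine setIntegral_mono_on (hmin κ hκ hκ1 v) ((hψi v).add ((hC v p).1.const_mul _))
            measurableSet_Ioi fun w hw => ?_
          have hw0 : (0 : ℝ) < w := hw
          rw [← mul_assoc, ← add_mul]
          have := hν.pos v w p hw
          gcongr
          -- For `w ≤ 1` the cutoff is not felt, as `v ≤ t + 1`. For larger `w` only `0 ≤ ψ (v + w)`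
          -- and `ψ v ≤ κ` are used, which costs the `2 κ`.
          rcases le_total w 1 with h1 | h1
          · rw [hcut (v + w) (by linarith [hv.1]) (by linarith [hv.2]),
              hcut v (by linarith [hv.1]) (by linarith [hv.2]), ← mul_sub]
            have h2 := min_le_ramp_sub (u := (v - t) / κ) (w := w / κ)
              (by rw [div_le_one hκ]; linarith [hv.2])
            rw [← add_div, show v - t + w = v + w - t by ring] at h2
            have h3 := mul_le_mul_of_nonneg_left h2 hκ.le
            rw [mul_min_of_nonneg _ _ hκ.le, mul_one, mul_div_cancel₀ _ hκ.ne'] at h3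
            have : 0 ≤ 2 * κ * min 1 w := by positivity
            linarith
          · rw [min_eq_left h1, hv3]
            linarith [hψ0 (v + w) (by linarith [hv.1]), hv.2, min_le_left κ w]
      _ = jumpOp ν p ψ v + 2 * κ * ∫ w in Ioi (0 : ℝ), min 1 w * ν v w p := by
          rw [integral_add (hψi v) ((hC v p).1.const_mul _), integral_const_mul, jumpOp]
      _ ≤ _ := by gcongr; exact (hC v p).2
  have hup : jumpOp ν p ψ t ≤ 5 * ∫ w in Ioi (0 : ℝ), min κ w * ν t w p := by
    rw [← integral_const_mul]
    refine setIntegral_mono_on (hψi t) ((hmin κ hκ hκ1 t).const_mul _) measurableSet_Ioi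
      fun w hw => ?_
    have hw0 : (0 : ℝ) < w := hw
    have := hν.pos t w p hw
    rw [← mul_assoc]
    gcongr
    have h0 : ψ t = 0 := by
      rw [hcut t (by linarith) (by linarith), ramp_of_le (by simp), sub_self, zero_div, mul_zero]
    rw [h0, sub_zero]
    simp only [hψ, add_sub_cancel_left]
    have h1 := ramp_nonneg (x := w / κ) (by positivity)
    have h2 := mul_le_mul_of_nonneg_left (ramp_le_min (w := w / κ) (by positivity)) hκ.le
    rw [mul_left_comm, mul_min_of_nonneg _ _ hκ.le, mul_one, mul_div_cancel₀ _ hκ.ne'] at h2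
    refine (mul_le_of_le_one_right (by positivity) (hcut1 _).2).trans h2
  obtain ⟨δ, hδ, hδc⟩ := Metric.continuousAt_iff.1 (hν.continuous ψ p hψt).continuousAt (η / 2)
    (by positivity)
  refine ⟨min κ (δ / 2), by positivity, (min_le_left _ _).trans hκ1, fun v hv => ?_⟩
  have hvκ : v ∈ Icc t (t + κ) := ⟨hv.1, hv.2.trans (by gcongr; exact min_le_left _ _)⟩
  have hvδ : dist v t < δ := by
    rw [Real.dist_eq, abs_of_nonneg (by linarith [hv.1])]
    linarith [hv.2, min_le_right κ (δ / 2)]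
  have h1 := (abs_lt.1 (Real.dist_eq _ _ ▸ hδc hvδ)).2
  calc _ ≤ ∫ w in Ioi (0 : ℝ), min κ w * ν v w p := by
        refine setIntegral_mono_on (hmin _ (by positivity) ((min_le_left _ _).trans hκ1) v)
          (hmin κ hκ hκ1 v) measurableSet_Ioi fun w hw => ?_
        have := hν.pos v w p hw
        gcongr
        exact min_le_left _ _
    _ ≤ _ := hlow v hvκ
    _ ≤ η := by linarith

/-- The increments of the step are at most `Λ m min κ w` once `m κ ≥ 1`, and `exists_small_jumps`
makes the mean of `min κ w` small. The threshold for `m` depends on `p`; uniformity in `p` is not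
available and not needed. -/
lemma IsJumpDensity.eventually_jumpOp_step_le (hν : IsJumpDensity ν) (p : E) (t : ℝ) {η : ℝ}
    (hη : 0 < η) : ∀ᶠ m : ℕ in atTop, ∀ v ∈ Icc t (t + 1 / m), jumpOp ν p (step m t) v ≤ η * m := by
  obtain ⟨Λ, hΛ, h⟩ := exists_step_sub_le
  obtain ⟨κ, hκ, hκ1, hle⟩ := hν.exists_small_jumps p t (div_pos hη (one_pos.trans_le hΛ))
  obtain ⟨n, hn⟩ := exists_nat_ge (1 / κ)
  filter_upwards [eventually_ge_atTop (max n 1)] with m hm v hv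
  have hmn : n ≤ m := (le_max_left _ _).trans hm
  have hm1 : (1 : ℝ) ≤ m := by exact_mod_cast (le_max_right n 1).trans hm
  have hmκ : 1 / (m : ℝ) ≤ κ := by
    rw [div_le_comm₀ (by positivity) hκ]
    exact hn.trans (by exact_mod_cast hmn)
  have hi : IntegrableOn (fun w => min κ w * ν v w p) (Ioi 0) := by
    refine hν.integrableOn_mul v p (M := 1) (by fun_prop) fun w hw => ?_
    rw [abs_of_pos (lt_min hκ hw), one_mul]
    exact min_le_min hκ1 le_rfl
  calc jumpOp ν p (step m t) v ≤ ∫ w in Ioi (0 : ℝ), Λ * m * (min κ w * ν v w p) := by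
        refine setIntegral_mono_on (hν.integrableOn_step v p hm1 t) (hi.const_mul _)
          measurableSet_Ioi fun w hw => ?_
        have hw0 : (0 : ℝ) < w := hw
        rw [← mul_assoc]
        have := hν.pos v w p hw
        gcongr
        refine (h m t v w (by positivity) hw0.le).trans ?_
        rw [mul_min_of_nonneg _ _ (by positivity)]
        refine min_le_min ?_ le_rfl
        have : 1 ≤ m * κ := by rwa [div_le_iff₀' (by positivity)] at hmκ
        nlinarith
    _ = Λ * m * ∫ w in Ioi (0 : ℝ), min κ w * ν v w p := integral_const_mul _ _
    _ ≤ Λ * m * (η / Λ) := by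
        gcongr
        exact hle v ⟨hv.1, hv.2.trans (by gcongr)⟩
    _ = η * m := by field_simp

end JumpOperator

/-! ### Continuity and measurability of the transition function in time. -/

section TimeRegularity

variable {E : Type*} [NormedAddCommGroup E] [MeasureSpace E]
  {P : ℝ≥0 → Kernel (E × ℝ) (E × ℝ)} {G : ℝ → E → ℝ → E → ℝ → ℝ}

/-- The exponential parametrises the positive times by the whole line, which turns continuity on `s
> 0` into plain continuity. -/
lemma IsContinuousTransitionDensity.continuous_exp (hG : IsContinuousTransitionDensity P G)
    (z x : E × ℝ) : Continuous fun u : ℝ => G (Real.exp u) z.1 z.2 x.1 x.2 :=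
  (hG.continuous z.1 z.2).comp_continuous (f := fun u : ℝ => (Real.exp u, x.1, x.2)) (by fun_prop)
    fun u => ⟨Real.exp_pos u, mem_univ _⟩

lemma IsContinuousTransitionDensity.apply (hG : IsContinuousTransitionDensity P G) {r : ℝ}
    (hr : 0 < r) (z : E × ℝ) : P r.toNNReal z =
      (volume : Measure (E × ℝ)).withDensity fun x => ENNReal.ofReal (G r z.1 z.2 x.1 x.2) := by
  rw [← Prod.mk.eta (p := z), hG.density r.toNNReal z.1 z.2 (by simpa using hr),
    Real.coe_toNNReal _ hr.le]

variable [BorelSpace E]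

lemma IsContinuousTransitionDensity.measurable (hG : IsContinuousTransitionDensity P G) (y₀ : E)
    (v₀ : ℝ) {s : ℝ} (hs : 0 < s) : Measurable fun z : E × ℝ => G s y₀ v₀ z.1 z.2 := by
  refine Continuous.measurable ?_
  exact (hG.continuous y₀ v₀).comp_continuous (f := fun z : E × ℝ => (s, z.1, z.2)) (by fun_prop)
    fun z => ⟨hs, mem_univ _⟩

lemma IsContinuousTransitionDensity.le_liminf (hG : IsContinuousTransitionDensity P G)
    (z : E × ℝ) (u : ℝ) {B : Set (E × ℝ)} (hB : MeasurableSet B) :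
    P (Real.exp u).toNNReal z B ≤ liminf (fun u : ℝ => P (Real.exp u).toNNReal z B) (𝓝 u) := by
  simp_rw [fun u => hG.apply (Real.exp_pos u) z, withDensity_apply _ hB]
  refine le_trans (le_of_eq ?_) (lintegral_liminf_le fun u =>
    (hG.measurable z.1 z.2 (Real.exp_pos u)).ennreal_ofReal)
  refine lintegral_congr fun x => ?_
  exact ((ENNReal.continuous_ofReal.comp (hG.continuous_exp z x)).tendsto u).liminf_eq.symm

/-- Scheffé's argument: by Fatou the masses of `B` and of its complement are both lower
semicontinuous, and their sum is constant. -/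
lemma IsContinuousTransitionDensity.continuous_apply (hP : IsTransitionFunction P)
    (hG : IsContinuousTransitionDensity P G) (z : E × ℝ) {B : Set (E × ℝ)} (hB : MeasurableSet B) :
    Continuous fun u : ℝ => P (Real.exp u).toNNReal z B := by
  have := hP.markov
  refine continuous_iff_continuousAt.2 fun u =>
    tendsto_of_le_liminf_of_limsup_le (hG.le_liminf z u hB) ?_
  have h : ∀ u : ℝ, P (Real.exp u).toNNReal z B = 1 - P (Real.exp u).toNNReal z Bᶜ := fun u => by
    conv_lhs => rw [← compl_compl B, prob_compl_eq_one_sub hB.compl]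
  simp_rw [h]
  rw [ENNReal.limsup_const_sub _ _ ENNReal.one_ne_top]
  exact tsub_le_tsub_left (hG.le_liminf z u hB.compl) 1

lemma IsContinuousTransitionDensity.continuousOn_apply (hP : IsTransitionFunction P)
    (hG : IsContinuousTransitionDensity P G) (z : E × ℝ) {B : Set (E × ℝ)} (hB : MeasurableSet B) :
    ContinuousOn (fun r : ℝ => P r.toNNReal z B) (Ioi 0) := by
  refine ((hG.continuous_apply hP z hB).comp_continuousOn
    (Real.continuousOn_log.mono fun r hr => ne_of_gt hr)).congr fun r hr => ?_
  simp [Real.exp_log (mem_Ioi.1 hr)]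

/-- A transition function with continuous density is jointly measurable in time and space. -/
lemma IsContinuousTransitionDensity.measurable_apply (hP : IsTransitionFunction P)
    (hG : IsContinuousTransitionDensity P G) :
    Measurable fun x : ℝ × (E × ℝ) => P x.1.toNNReal x.2 := by
  refine Measure.measurable_of_measurable_coe _ fun B hB => ?_
  -- Continuous in time and measurable in space, hence jointly measurable. Times `≤ 0` are read as
  -- time `0` by `Real.toNNReal` and are treated apart.
  have h1 : Measurable fun x : ℝ × (E × ℝ) => P (Real.exp x.1).toNNReal x.2 B :=
    measurable_uncurry_of_continuous_of_measurable
      (u := fun (u : ℝ) (z : E × ℝ) => P (Real.exp u).toNNReal z B)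
      (fun z => hG.continuous_apply hP z hB) fun u => (P _).measurable_coe hB
  have h2 : Measurable fun x : ℝ × (E × ℝ) => P (Real.exp (Real.log x.1)).toNNReal x.2 B :=
    h1.comp (f := fun x : ℝ × (E × ℝ) => (Real.log x.1, x.2)) (by fun_prop)
  have h3 : Measurable fun x : ℝ × (E × ℝ) => P 0 x.2 B :=
    ((P 0).measurable_coe hB).comp measurable_snd
  have h4 : Measurable fun x : ℝ × (E × ℝ) =>
      if 0 < x.1 then P (Real.exp (Real.log x.1)).toNNReal x.2 B else P 0 x.2 B :=
    Measurable.ite (measurableSet_lt measurable_const measurable_fst) h2 h3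
  convert h4 using 2 with x
  split_ifs with h
  · rw [Real.exp_log h]
  · rw [Real.toNNReal_of_nonpos (not_lt.1 h)]

end TimeRegularity

/-! ### Integrals against the transition function. -/

section Transition

variable {S : Type*} [MeasurableSpace S] {P : ℝ≥0 → Kernel S S}

/-- The transition function as a single kernel in time and space. -/
def timeKernel (hM : Measurable fun x : ℝ × S => P x.1.toNNReal x.2) : Kernel (ℝ × S) S := ⟨_, hM⟩

lemma measurable_lintegral_transition (hM : Measurable fun x : ℝ × S => P x.1.toNNReal x.2)
    {f : S → ℝ≥0∞} (hf : Measurable f) :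
    Measurable fun x : ℝ × S => ∫⁻ z, f z ∂P x.1.toNNReal x.2 :=
  hf.lintegral_kernel (κ := timeKernel hM)

lemma measurable_integral_transition (hM : Measurable fun x : ℝ × S => P x.1.toNNReal x.2)
    {f : S → ℝ} (hf : Measurable f) :
    Measurable fun x : ℝ × S => ∫ z, f z ∂P x.1.toNNReal x.2 :=
  (hf.stronglyMeasurable.integral_kernel (κ := timeKernel hM)).measurable

lemma integrable_of_abs_le {α : Type*} [MeasurableSpace α] {μ : Measure α} [IsFiniteMeasure μ]
    {f : α → ℝ} (hf : Measurable f) {C : ℝ} (hC : ∀ x, |f x| ≤ C) : Integrable f μ :=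
  Integrable.of_bound hf.aestronglyMeasurable C (Eventually.of_forall hC)

lemma intervalIntegrable_of_abs_le {f : ℝ → ℝ} (hf : Measurable f) {C : ℝ} (hC : ∀ x, |f x| ≤ C)
    (a b : ℝ) : IntervalIntegrable f volume a b :=
  ⟨integrable_of_abs_le hf hC, integrable_of_abs_le hf hC⟩

lemma abs_integral_le_of_abs_le {α : Type*} [MeasurableSpace α] {μ : Measure α}
    [IsProbabilityMeasure μ] {f : α → ℝ} {C : ℝ} (hC : ∀ x, |f x| ≤ C) : |∫ x, f x ∂μ| ≤ C := by
  simpa using norm_integral_le_of_norm_le_const (μ := μ) (f := f) (Eventually.of_forall hC)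

lemma abs_mul_le_of_abs_le_one {x y C : ℝ} (hx : |x| ≤ C) (hy : |y| ≤ 1) : |x * y| ≤ C := by
  rw [abs_mul]
  exact (mul_le_of_le_one_right (abs_nonneg x) hy).trans hx

/-- By conservativeness the constants are in the domain; taking `h = 1` in `HasGeneratorSum.product`
gives Kolmogorov's equation for functions of the second coordinate alone. -/
lemma one_zero_mem_generator (hP : ∀ t, IsMarkovKernel (P t)) :
    ((fun _ => 1, fun _ => 0) : (S → ℝ) × (S → ℝ)) ∈ generator P :=
  ⟨⟨measurable_const, 1, by simp⟩, ⟨measurable_const, 0, by simp⟩, fun t x => by simp⟩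

end Transition

/-! ### Monotonicity of the second coordinate, and Kolmogorov's equation for steps. -/

section Monotone

variable {E : Type*} [MeasurableSpace E] {P : ℝ≥0 → Kernel (E × ℝ) (E × ℝ)}
  {Q : ℝ≥0 → Kernel E E} {ν : ℝ → ℝ → E → ℝ}

lemma HasGeneratorSum.isMarkovKernel (hP : IsTransitionFunction P) (hgen : HasGeneratorSum P Q ν)
    (t : ℝ≥0) : IsMarkovKernel (Q t) := by
  have := hP.markov t
  refine ⟨fun y => ?_⟩
  rw [← hgen.marginal t y 0]
  exact Measure.isProbabilityMeasure_map measurable_fst.aemeasurable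

lemma HasGeneratorSum.integral_marginal (hgen : HasGeneratorSum P Q ν) (s : ℝ≥0) (z : E × ℝ)
    {f : E → ℝ} (hf : Measurable f) : ∫ x, f x.1 ∂P s z = ∫ y, f y ∂Q s z.1 := by
  rw [← hgen.marginal s z.1 z.2, Prod.mk.eta,
    integral_map measurable_fst.aemeasurable hf.aestronglyMeasurable]

lemma HasGeneratorSum.integral_step_sub (hP : IsTransitionFunction P) (hν : IsJumpDensity ν)
    (hgen : HasGeneratorSum P Q ν) {l₁ l₂ : ℝ} (h₁ : 1 ≤ l₁) (h₂ : 1 ≤ l₂) (c₁ c₂ : ℝ) (s : ℝ≥0)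
    (z : E × ℝ) : (∫ x, (step l₁ c₁ x.2 - step l₂ c₂ x.2) ∂P s z) -
        (step l₁ c₁ z.2 - step l₂ c₂ z.2) =
      ∫ r in (0 : ℝ)..s, ∫ x, (jumpOp ν x.1 (step l₁ c₁) x.2 - jumpOp ν x.1 (step l₂ c₂) x.2)
        ∂P r.toNNReal z := by
  have h := (hgen.product _ _ (one_zero_mem_generator (hgen.isMarkovKernel hP)) _
    (isTestFunction_step_sub (l₁ := l₁) (c₁ := c₁) (l₂ := l₂) (c₂ := c₂) (by linarith)
      (by linarith))).2.2 s z
  simp only [one_mul, zero_mul, zero_add, hν.jumpOp_step_sub _ h₁ h₂] at h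
  exact h

lemma tendsto_step_threshold (c x : ℝ) : ∀ᶠ m : ℕ in atTop, step 1 (c - m) x = 1 := by
  obtain ⟨n, hn⟩ := exists_nat_ge (1 + c - x)
  filter_upwards [eventually_ge_atTop n] with m hm
  have : (n : ℝ) ≤ m := by exact_mod_cast hm
  exact step_eq_one (by linarith)

/-- The second coordinate never decreases. -/
lemma HasGeneratorSum.ae_le (hP : IsTransitionFunction P) (hν : IsJumpDensity ν)
    (hgen : HasGeneratorSum P Q ν) (hM : Measurable fun x : ℝ × (E × ℝ) => P x.1.toNNReal x.2)
    (s : ℝ≥0) (z : E × ℝ) : ∀ᵐ x ∂P s z, z.2 ≤ x.2 := by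
  have := hP.markov
  obtain ⟨M, hM0, hM1⟩ := hν.exists_jumpOp_step_le
  -- The test function is the difference of steps with thresholds `z.2 - 1 - m` and `z.2 - 1`; both
  -- are `1` at the start. The lower step gains only from states in `B m`, and the upper one enters
  -- with a favourable sign, so the mean is at most `M` times the time spent in `B m`, which
  -- vanishes as `m → ∞`.
  set B : ℕ → Set (E × ℝ) := fun m => {x | x.2 < z.2 - m} with hB
  have hBm : ∀ m, MeasurableSet (B m) := fun m => measurableSet_lt measurable_snd measurable_const
  have hBr : ∀ m, Measurable fun r : ℝ => (P r.toNNReal z).real (B m) := fun m =>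
    (((Measure.measurable_coe (hBm m)).comp hM).comp
      (measurable_id.prodMk measurable_const)).ennreal_toReal
  have hB1 : ∀ m (r : ℝ), |(P r.toNNReal z).real (B m)| ≤ 1 := fun m r => by
    rw [abs_of_nonneg measureReal_nonneg]
    exact measureReal_le_one
  have key : ∀ m : ℕ, ∫ x, (step 1 (z.2 - 1 - m) x.2 - step 1 (z.2 - 1) x.2) ∂P s z ≤
      ∫ r in (0 : ℝ)..s, M * (P r.toNNReal z).real (B m) := by
    intro m
    have h := hgen.integral_step_sub hP hν le_rfl le_rfl (z.2 - 1 - m) (z.2 - 1) s z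
    have e1 : step 1 (z.2 - 1 - m) z.2 = 1 := step_eq_one (by
      have : (0 : ℝ) ≤ m := m.cast_nonneg
      linarith)
    have e2 : step 1 (z.2 - 1) z.2 = 1 := step_eq_one (by linarith)
    rw [e1, e2, sub_self, sub_zero] at h
    rw [h]
    have hj : ∀ c, Measurable fun x : E × ℝ => jumpOp ν x.1 (step 1 c) x.2 := fun c =>
      hν.measurable_jumpOp (continuous_step 1 c).measurable
    have hjb : ∀ c x, jumpOp ν (x : E × ℝ).1 (step 1 c) x.2 ∈ Icc 0 M := fun c x =>
      ⟨hν.jumpOp_step_nonneg _ _ zero_le_one c, by simpa using hM1 1 c x.2 x.1 le_rfl⟩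
    have hd : ∀ x : E × ℝ, |jumpOp ν x.1 (step 1 (z.2 - 1 - m)) x.2 -
        jumpOp ν x.1 (step 1 (z.2 - 1)) x.2| ≤ M := fun x =>
      abs_le.2 ⟨by linarith [(hjb (z.2 - 1 - m) x).1, (hjb (z.2 - 1) x).2],
        by linarith [(hjb (z.2 - 1 - m) x).2, (hjb (z.2 - 1) x).1]⟩
    refine intervalIntegral.integral_mono_on s.coe_nonneg ?_ ?_ fun r _ => ?_
    · exact intervalIntegrable_of_abs_le ((measurable_integral_transition hM
        ((hj _).sub (hj _))).comp (measurable_id.prodMk measurable_const))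
        (fun r => abs_integral_le_of_abs_le hd) _ _
    · exact (intervalIntegrable_of_abs_le (hBr m) (hB1 m) _ _).const_mul M
    · rw [← integral_indicator_one (hBm m), ← integral_const_mul]
      refine integral_mono (integrable_of_abs_le ((hj _).sub (hj _)) hd)
        (((integrable_const (1 : ℝ)).indicator (hBm m)).const_mul M) fun x => ?_
      dsimp only
      by_cases hx : x ∈ B m
      · rw [indicator_of_mem hx, Pi.one_apply, mul_one]
        linarith [(hjb (z.2 - 1 - m) x).2, (hjb (z.2 - 1) x).1]
      · have hx' : z.2 - m ≤ x.2 := not_lt.1 hx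
        rw [indicator_of_notMem hx, mul_zero, jumpOp_step_eq_zero ν x.1 zero_le_one (by linarith)]
        linarith [(hjb (z.2 - 1) x).1]
  have hlim1 : Tendsto (fun m : ℕ => ∫ x, (step 1 (z.2 - 1 - m) x.2 - step 1 (z.2 - 1) x.2) ∂P s z)
      atTop (𝓝 (∫ x, (1 - step 1 (z.2 - 1) x.2) ∂P s z)) := by
    refine tendsto_integral_of_dominated_convergence (fun _ => 1) (fun m => ?_)
      (integrable_const _) (fun m => Eventually.of_forall fun x => ?_)
      (Eventually.of_forall fun x => ?_)
    · have h1 := continuous_step 1 (z.2 - 1 - m)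
      have h2 := continuous_step 1 (z.2 - 1)
      exact Measurable.aestronglyMeasurable (by fun_prop)
    · exact abs_le.2 ⟨by linarith [step_nonneg 1 (z.2 - 1 - m) x.2, step_le_one 1 (z.2 - 1) x.2],
        by linarith [step_le_one 1 (z.2 - 1 - m) x.2, step_nonneg 1 (z.2 - 1) x.2]⟩
    · refine tendsto_const_nhds.congr' ?_
      filter_upwards [tendsto_step_threshold (z.2 - 1) x.2] with m hm
      rw [hm]
  have hlim2 : Tendsto (fun m : ℕ => ∫ r in (0 : ℝ)..s, M * (P r.toNNReal z).real (B m)) atTop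
      (𝓝 (∫ r in (0 : ℝ)..s, M * 0)) := by
    refine intervalIntegral.tendsto_integral_filter_of_dominated_convergence (fun _ => M * 1)
      (Eventually.of_forall fun m => ((hBr m).const_mul M).aestronglyMeasurable)
      (Eventually.of_forall fun m => Eventually.of_forall fun r _ => ?_) (by simp)
      (Eventually.of_forall fun r _ => Tendsto.const_mul M ?_)
    · rw [norm_mul, Real.norm_of_nonneg hM0]
      exact mul_le_mul_of_nonneg_left (hB1 m r) hM0
    · have h := tendsto_measure_iInter_atTop (μ := P r.toNNReal z) (s := B)
        (fun m => (hBm m).nullMeasurableSet) (fun m n hmn x hx => by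
          have h1 : (m : ℝ) ≤ n := by exact_mod_cast hmn
          have h2 : x.2 < z.2 - n := hx
          exact h2.trans_le (by linarith)) ⟨0, measure_ne_top _ _⟩
      have h0 : ⋂ n, B n = ∅ := by
        refine eq_empty_of_forall_notMem fun x hx => ?_
        obtain ⟨n, hn⟩ := exists_nat_ge (z.2 - x.2)
        have := mem_iInter.1 hx n
        have h1 : x.2 < z.2 - n := this
        linarith
      rw [h0, measure_empty] at h
      exact (ENNReal.tendsto_toReal ENNReal.zero_ne_top).comp h
  have hle := le_of_tendsto_of_tendsto' hlim1 hlim2 key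
  have hst := continuous_step 1 (z.2 - 1)
  have h0 : ∀ x : E × ℝ, 0 ≤ 1 - step 1 (z.2 - 1) x.2 := fun x => by
    linarith [step_le_one 1 (z.2 - 1) x.2]
  have heq : ∫ x, (1 - step 1 (z.2 - 1) x.2) ∂P s z = 0 :=
    le_antisymm (by simpa using hle) (integral_nonneg h0)
  rw [integral_eq_zero_iff_of_nonneg h0 (integrable_of_abs_le (C := 1) (by fun_prop) fun x => by
    rw [abs_of_nonneg (h0 x)]; linarith [step_nonneg 1 (z.2 - 1) x.2])] at heq
  filter_upwards [heq] with x hx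
  have : step 1 (z.2 - 1) x.2 = 1 := by simp only [Pi.zero_apply] at hx; linarith
  -- The transition reaches `1` no earlier than at `1`; with slope one and threshold `z.2 - 1` this
  -- is exactly the level `z.2`.
  rw [step, Real.smoothTransition.eq_one_iff_one_le] at this
  linarith

/-- Kolmogorov's equation for the function `h ⊗ (1 - step)`. -/
lemma HasGeneratorSum.integral_one_sub_step (hP : IsTransitionFunction P) (hν : IsJumpDensity ν)
    (hgen : HasGeneratorSum P Q ν) (hM : Measurable fun x : ℝ × (E × ℝ) => P x.1.toNNReal x.2)
    {h k : E → ℝ} (hhk : (h, k) ∈ generator Q) {m t : ℝ} (hm : 1 ≤ m) (s : ℝ≥0) (z : E × ℝ) :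
    (∫ x, h x.1 * (1 - step m t x.2) ∂P s z) - h z.1 * (1 - step m t z.2) =
      ∫ r in (0 : ℝ)..s, ∫ x, (k x.1 * (1 - step m t x.2) - h x.1 * jumpOp ν x.1 (step m t) x.2)
        ∂P r.toNNReal z := by
  have hae := hgen.ae_le hP hν hM
  -- This test function agrees with `1 - step m t` above the starting level, which carries all the
  -- mass. The auxiliary step is constant there, and jumps to the right do not change it.
  have hg := (hgen.product h k hhk _ (isTestFunction_step_sub (l₁ := 1) (c₁ := z.2 - 1) (l₂ := m)
    (c₂ := t) one_pos (by linarith))).2.2 s z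
  have e1 : ∀ x, z.2 ≤ x → step 1 (z.2 - 1) x = 1 := fun x hx => step_eq_one (by linarith)
  simp only [hν.jumpOp_step_sub _ le_rfl hm] at hg
  rw [e1 z.2 le_rfl] at hg
  convert hg using 1
  · congr 1
    refine integral_congr_ae ?_
    filter_upwards [hae s z] with x hx
    rw [e1 _ hx]
  · refine intervalIntegral.integral_congr fun r _ => integral_congr_ae ?_
    filter_upwards [hae r.toNNReal z] with x hx
    rw [e1 _ hx, jumpOp_step_eq_zero ν x.1 zero_le_one (c := z.2 - 1) (by linarith)]
    ring

/-- From any starting point, the expected total rate of the smoothed crossings of a level is at most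
one. -/
lemma HasGeneratorSum.lintegral_jumpOp_step_le (hP : IsTransitionFunction P)
    (hν : IsJumpDensity ν) (hgen : HasGeneratorSum P Q ν)
    (hM : Measurable fun x : ℝ × (E × ℝ) => P x.1.toNNReal x.2) {m t : ℝ} (hm : 1 ≤ m) {c : ℝ}
    (hc : 0 ≤ c) (z : E × ℝ) : ∫⁻ r in Ioc 0 c, ∫⁻ x, ENNReal.ofReal (jumpOp ν x.1 (step m t) x.2)
      ∂P r.toNNReal z ≤ 1 := by
  have := hP.markov
  obtain ⟨M, hM0, hM1⟩ := hν.exists_jumpOp_step_le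
  have hj : Measurable fun x : E × ℝ => jumpOp ν x.1 (step m t) x.2 :=
    hν.measurable_jumpOp (continuous_step m t).measurable
  have hj0 : ∀ x : E × ℝ, 0 ≤ jumpOp ν x.1 (step m t) x.2 := fun x =>
    hν.jumpOp_step_nonneg _ _ (by linarith) t
  have hjb : ∀ x : E × ℝ, |jumpOp ν x.1 (step m t) x.2| ≤ M * m := fun x => by
    rw [abs_of_nonneg (hj0 x)]; exact hM1 m t x.2 x.1 hm
  -- For `h = 1` the total rate is the loss in the mean of `1 - step`, which stays between `0` and
  -- `1`.
  have h := hgen.integral_one_sub_step hP hν hM (one_zero_mem_generator (hgen.isMarkovKernel hP))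
    (t := t) hm c.toNNReal z
  simp only [one_mul, zero_mul, zero_sub, integral_neg, intervalIntegral.integral_neg,
    Real.coe_toNNReal c hc] at h
  have h1 : ∫ r in (0 : ℝ)..c, ∫ x, jumpOp ν x.1 (step m t) x.2 ∂P r.toNNReal z ≤ 1 := by
    have : 0 ≤ ∫ x, (1 - step m t x.2) ∂P c.toNNReal z :=
      integral_nonneg fun x => sub_nonneg.2 (step_le_one m t x.2)
    linarith [step_nonneg m t z.2]
  rw [intervalIntegral.integral_of_le hc] at h1
  have h2 : ∀ r : ℝ, ∫⁻ x, ENNReal.ofReal (jumpOp ν x.1 (step m t) x.2) ∂P r.toNNReal z =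
      ENNReal.ofReal (∫ x, jumpOp ν x.1 (step m t) x.2 ∂P r.toNNReal z) := fun r =>
    (ofReal_integral_eq_lintegral_ofReal (integrable_of_abs_le hj hjb)
      (Eventually.of_forall hj0)).symm
  simp_rw [h2]
  rw [← ofReal_integral_eq_lintegral_ofReal]
  · exact ENNReal.ofReal_le_one.2 h1
  · exact integrable_of_abs_le ((measurable_integral_transition hM hj).comp
      (measurable_id.prodMk measurable_const)) fun r => abs_integral_le_of_abs_le hjb
  · exact Eventually.of_forall fun r => integral_nonneg hj0

end Monotone

/-! ### Time averages in the domain of `L`. -/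

section Smoothing

/-- Both sides are the integral over `[b, b + δ]` minus the integral over `[a, a + δ]`. The identity
serves twice: for the generator and for the telescoping along a path. -/
lemma intervalIntegral_shift_sub {f : ℝ → ℝ} (hf : ∀ a b, IntervalIntegrable f volume a b)
    (a b δ : ℝ) : (∫ r in (0 : ℝ)..δ, f (b + r)) - ∫ r in (0 : ℝ)..δ, f (a + r) =
      ∫ s in a..b, (f (s + δ) - f s) := by
  have h1 : IntervalIntegrable (fun s => f (s + δ)) volume a b := by
    simpa using (hf (a + δ) (b + δ)).comp_add_right δ
  rw [intervalIntegral.integral_sub h1 (hf a b), intervalIntegral.integral_comp_add_right,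
    intervalIntegral.integral_comp_add_left, intervalIntegral.integral_comp_add_left, add_zero,
    add_zero, intervalIntegral.integral_interval_sub_interval_comm (hf _ _) (hf _ _) (hf _ _),
    intervalIntegral.integral_symm b a, intervalIntegral.integral_symm (b + δ) (a + δ)]
  ring

variable {E : Type*} [MeasurableSpace E] {P : ℝ≥0 → Kernel (E × ℝ) (E × ℝ)}
  {Q : ℝ≥0 → Kernel E E} {ν : ℝ → ℝ → E → ℝ} {F : E → ℝ}

/-- The mean of `F` at time `r`, for the process started at `y`. -/
def evolve (Q : ℝ≥0 → Kernel E E) (F : E → ℝ) (r : ℝ) (y : E) : ℝ := ∫ x, F x ∂Q r.toNNReal y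

/-- The time average of the means of `F` over `[0, δ]`. -/
def evolveAverage (Q : ℝ≥0 → Kernel E E) (F : E → ℝ) (δ : ℝ) (y : E) : ℝ :=
  δ⁻¹ * ∫ r in (0 : ℝ)..δ, evolve Q F r y

/-- The difference quotient of the means of `F`. -/
def evolveQuotient (Q : ℝ≥0 → Kernel E E) (F : E → ℝ) (δ : ℝ) (y : E) : ℝ :=
  δ⁻¹ * (evolve Q F δ y - F y)

lemma HasGeneratorSum.measurable_evolve (hgen : HasGeneratorSum P Q ν)
    (hM : Measurable fun x : ℝ × (E × ℝ) => P x.1.toNNReal x.2) (hF : Measurable F) :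
    Measurable fun x : ℝ × E => evolve Q F x.1 x.2 := by
  have h := (measurable_integral_transition hM (hF.comp measurable_fst)).comp
    (g := fun x : ℝ × (E × ℝ) => ∫ z, (F ∘ Prod.fst) z ∂P x.1.toNNReal x.2)
    (f := fun x : ℝ × E => (x.1, (x.2, (0 : ℝ)))) (by fun_prop)
  convert h using 2 with x
  exact (hgen.integral_marginal _ (x.2, 0) hF).symm

lemma HasGeneratorSum.abs_evolve_le (hP : IsTransitionFunction P) (hgen : HasGeneratorSum P Q ν)
    {C : ℝ} (hC : ∀ y, |F y| ≤ C) (r : ℝ) (y : E) : |evolve Q F r y| ≤ C :=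
  have := hgen.isMarkovKernel hP r.toNNReal
  abs_integral_le_of_abs_le hC

/-- `Q` is not assumed to satisfy Chapman-Kolmogorov; it inherits this from `P` as its first
marginal. The level `0` is an arbitrary choice. -/
lemma HasGeneratorSum.integral_evolve (hP : IsTransitionFunction P) (hgen : HasGeneratorSum P Q ν)
    (hM : Measurable fun x : ℝ × (E × ℝ) => P x.1.toNNReal x.2) (hF : Measurable F) {C : ℝ}
    (hC : ∀ y, |F y| ≤ C) {s r : ℝ} (hs : 0 ≤ s) (hr : 0 ≤ r) (y : E) :
    ∫ x, evolve Q F r x ∂Q s.toNNReal y = evolve Q F (s + r) y := by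
  have := hP.markov
  have hm : Measurable fun x => evolve Q F r x :=
    (hgen.measurable_evolve hM hF).comp (measurable_const.prodMk measurable_id)
  rw [← hgen.integral_marginal s.toNNReal (y, 0) hm, evolve,
    ← hgen.integral_marginal (s + r).toNNReal (y, 0) hF, Real.toNNReal_add hs hr, hP.add,
    Kernel.integral_comp]
  · exact integral_congr_ae (Eventually.of_forall fun z =>
      (hgen.integral_marginal r.toNNReal z hF).symm)
  · have : IsMarkovKernel ((P r.toNNReal).comp (P s.toNNReal)) := inferInstance
    exact integrable_of_abs_le (hF.comp measurable_fst) fun z => hC z.1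

lemma HasGeneratorSum.measurable_evolveAverage (hgen : HasGeneratorSum P Q ν)
    (hM : Measurable fun x : ℝ × (E × ℝ) => P x.1.toNNReal x.2) (hF : Measurable F) {δ : ℝ}
    (hδ : 0 < δ) : Measurable (evolveAverage Q F δ) := by
  have h := ((hgen.measurable_evolve hM hF).stronglyMeasurable.integral_prod_left'
    (μ := volume.restrict (Ioc 0 δ))).measurable
  refine Measurable.const_mul ?_ _
  simpa only [intervalIntegral.integral_of_le hδ.le] using h

lemma HasGeneratorSum.intervalIntegrable_evolve (hP : IsTransitionFunction P)
    (hgen : HasGeneratorSum P Q ν) (hM : Measurable fun x : ℝ × (E × ℝ) => P x.1.toNNReal x.2)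
    (hF : Measurable F) {C : ℝ} (hC : ∀ y, |F y| ≤ C) (y : E) (a b : ℝ) :
    IntervalIntegrable (fun r => evolve Q F r y) volume a b :=
  intervalIntegrable_of_abs_le ((hgen.measurable_evolve hM hF).comp
    (measurable_id.prodMk measurable_const)) (fun r => hgen.abs_evolve_le hP hC r y) a b

/-- Time averages of the means of a bounded measurable function are in the domain of the
generator. -/
lemma HasGeneratorSum.evolveAverage_mem_generator (hP : IsTransitionFunction P)
    (hgen : HasGeneratorSum P Q ν) (hM : Measurable fun x : ℝ × (E × ℝ) => P x.1.toNNReal x.2)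
    (hF : Measurable F) {C : ℝ} (hC : ∀ y, |F y| ≤ C) {δ : ℝ} (hδ : 0 < δ) :
    (evolveAverage Q F δ, evolveQuotient Q F δ) ∈ generator Q := by
  have hQ := hgen.isMarkovKernel hP
  have hm := hgen.measurable_evolve hM hF
  have hmr : ∀ r, Measurable (evolve Q F r) := fun r =>
    hm.comp (measurable_const.prodMk measurable_id)
  have hb := fun r y => hgen.abs_evolve_le hP hC r y
  have hii := hgen.intervalIntegrable_evolve hP hM hF hC
  refine ⟨⟨hgen.measurable_evolveAverage hM hF hδ, C, fun y => ?_⟩,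
    ⟨((hmr δ).sub hF).const_mul _, δ⁻¹ * (C + C), fun y => ?_⟩, fun t y => ?_⟩
  · have h := intervalIntegral.norm_integral_le_of_norm_le_const (a := 0) (b := δ)
      (f := fun r => evolve Q F r y) (C := C) fun r _ => hb r y
    rw [sub_zero, abs_of_pos hδ, Real.norm_eq_abs] at h
    change |δ⁻¹ * _| ≤ C
    rw [abs_mul, abs_of_pos (inv_pos.2 hδ), inv_mul_le_iff₀ hδ]
    linarith
  · change |δ⁻¹ * _| ≤ _
    rw [abs_mul, abs_of_pos (inv_pos.2 hδ)]
    gcongr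
    exact (abs_sub _ _).trans (add_le_add (hb δ y) (hC y))
  · have h1 : ∫ z, evolveAverage Q F δ z ∂Q t y =
        δ⁻¹ * ∫ r in (0 : ℝ)..δ, evolve Q F (t + r) y := by
      simp only [evolveAverage]
      rw [integral_const_mul]
      congr 1
      simp only [intervalIntegral.integral_of_le hδ.le]
      rw [integral_integral_swap (f := fun z r => evolve Q F r z)
        (integrable_of_abs_le (C := C) (hm.comp measurable_swap) fun x => hb _ _)]
      refine setIntegral_congr_fun measurableSet_Ioc fun r hr => ?_
      have := hgen.integral_evolve hP hM hF hC t.coe_nonneg (le_of_lt hr.1) y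
      rwa [Real.toNNReal_coe] at this
    have h2 : ∫ s in (0 : ℝ)..t, ∫ z, evolveQuotient Q F δ z ∂Q s.toNNReal y =
        δ⁻¹ * ∫ s in (0 : ℝ)..t, (evolve Q F (s + δ) y - evolve Q F s y) := by
      rw [← intervalIntegral.integral_const_mul]
      refine intervalIntegral.integral_congr fun s hs => ?_
      rw [uIcc_of_le t.coe_nonneg] at hs
      simp only [evolveQuotient]
      rw [integral_const_mul, integral_sub (integrable_of_abs_le (hmr δ) (hb δ))
        (integrable_of_abs_le hF hC), hgen.integral_evolve hP hM hF hC hs.1 hδ.le y]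
      rfl
    change (∫ z, evolveAverage Q F δ z ∂Q t y) - δ⁻¹ * _ =
      ∫ s in (0 : ℝ)..t, ∫ z, evolveQuotient Q F δ z ∂Q s.toNNReal y
    rw [h1, h2, ← mul_sub, ← intervalIntegral_shift_sub (hii y) 0 t δ]
    simp

end Smoothing

/-! ### Regular versions of the process. -/

section RegularProcess

/-- A version of the process started at `z₀` all of whose paths are right-continuous with
nondecreasing second coordinate; of the Markov property only the two-time laws are recorded. -/
structure IsRegularProcess {E Ω : Type*} [MeasurableSpace E] [TopologicalSpace E]
    [MeasurableSpace Ω] (P : ℝ≥0 → Kernel (E × ℝ) (E × ℝ)) (z₀ : E × ℝ) (X : ℝ≥0 → Ω → E × ℝ)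
    (μ : Measure Ω) : Prop where
  measurable : ∀ s, Measurable (X s)
  initial : ∀ ω, X 0 ω = z₀
  law : ∀ s r, μ.map (fun ω => (X s ω, X (s + r) ω)) = (P s z₀).compProd (P r)
  right : ∀ ω s, ContinuousWithinAt (fun u => X u ω) (Ici s) s
  mono : ∀ ω, Monotone fun s => (X s ω).2

/-- Limits from the right along `D` first free the larger argument from `D`, then the smaller one.
-/
lemma monotone_of_dense {f : ℝ≥0 → ℝ} (hf : ∀ s, ContinuousWithinAt f (Ici s) s) {D : Set ℝ≥0}
    (hD : Dense D) (h : ∀ p ∈ D, ∀ q ∈ D, p ≤ q → f p ≤ f q) : Monotone f := by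
  have hne : ∀ (s : ℝ≥0) (O : Set ℝ≥0), IsOpen O → s ∈ closure (Ioi s ∩ O) →
      (𝓝[Ioi s ∩ O ∩ D] s).NeBot := fun s O hO hs =>
    mem_closure_iff_nhdsWithin_neBot.1
      (closure_minimal (hD.open_subset_closure_inter (isOpen_Ioi.inter hO)) isClosed_closure hs)
  have hle : ∀ (s : ℝ≥0) (O : Set ℝ≥0), Tendsto f (𝓝[Ioi s ∩ O ∩ D] s) (𝓝 (f s)) := fun s O =>
    (hf s).mono fun x hx => mem_Ici.2 (le_of_lt hx.1.1)
  have key : ∀ p ∈ D, ∀ u, p < u → f p ≤ f u := by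
    intro p hp u hpu
    have := hne u univ isOpen_univ (by rw [inter_univ, closure_Ioi]; exact self_mem_Ici)
    refine ge_of_tendsto (hle u univ) ?_
    filter_upwards [self_mem_nhdsWithin] with q hq
    exact h p hp q hq.2 (hpu.trans hq.1.1).le
  refine monotone_iff_forall_lt.2 fun s u hsu => ?_
  have := hne s (Iio u) isOpen_Iio (by
    rw [Ioi_inter_Iio, closure_Ioo hsu.ne]; exact left_mem_Icc.2 hsu.le)
  refine le_of_tendsto (hle s (Iio u)) ?_
  filter_upwards [self_mem_nhdsWithin] with q hq
  exact key q hq.2 u hq.1.2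

variable {E Ω : Type*} [MeasurableSpace Ω] {μ : Measure Ω} [IsProbabilityMeasure μ]

section Law

variable {S : Type*} [MeasurableSpace S] {P : ℝ≥0 → Kernel S S} {z₀ : S} {X : ℝ≥0 → Ω → S}

lemma IsMarkovProcess.map_eq (hX : IsMarkovProcess P z₀ X μ) (s : ℝ≥0) : μ.map (X s) = P s z₀ := by
  ext B hB
  have h := hX.markov 0 s univ B MeasurableSet.univ hB
  rw [univ_inter, zero_add, setLIntegral_univ] at h
  rw [Measure.map_apply (hX.measurable s) hB, h]
  calc ∫⁻ ω, P s (X 0 ω) B ∂μ = ∫⁻ _, P s z₀ B ∂μ := by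
        refine lintegral_congr_ae ?_
        filter_upwards [hX.initial] with ω hω
        rw [hω]
    _ = _ := by simp

lemma IsMarkovProcess.map_pair (hP : IsTransitionFunction P) (hX : IsMarkovProcess P z₀ X μ)
    (s r : ℝ≥0) : μ.map (fun ω => (X s ω, X (s + r) ω)) = (P s z₀).compProd (P r) := by
  have := hP.markov
  have hm := (hX.measurable s).prodMk (hX.measurable (s + r))
  have : IsProbabilityMeasure (μ.map fun ω => (X s ω, X (s + r) ω)) :=
    Measure.isProbabilityMeasure_map hm.aemeasurable
  refine Measure.ext_prod fun {A B} hA hB => ?_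
  rw [Measure.map_apply hm (hA.prod hB), Measure.compProd_apply_prod hA hB, ← hX.map_eq s,
    setLIntegral_map hA ((P r).measurable_coe hB) (hX.measurable s)]
  refine hX.markov s r (X s ⁻¹' A) B ?_ hB
  have h : MeasurableSpace.comap (X s) inferInstance ≤
      ⨆ r ∈ Iic s, MeasurableSpace.comap (X r) inferInstance :=
    le_iSup₂ (f := fun r (_ : r ∈ Iic s) => MeasurableSpace.comap (X r) inferInstance) s
      self_mem_Iic
  exact h _ ⟨A, hA, rfl⟩

end Law

variable [MeasurableSpace E] [TopologicalSpace E] {P : ℝ≥0 → Kernel (E × ℝ) (E × ℝ)} {z₀ : E × ℝ}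
  {X : ℝ≥0 → Ω → E × ℝ}

/-- Under `P`-almost sure monotonicity, a right-continuous Markov process has a regular version. -/
lemma IsMarkovProcess.exists_regular (hP : IsTransitionFunction P) (hX : IsMarkovProcess P z₀ X μ)
    (hle : ∀ s z, ∀ᵐ x ∂P s z, z.2 ≤ x.2)
    (hright : ∀ᵐ ω ∂μ, ∀ s, ContinuousWithinAt (fun u => X u ω) (Ici s) s) :
    ∃ X' : ℝ≥0 → Ω → E × ℝ, IsRegularProcess P z₀ X' μ ∧ ∀ᵐ ω ∂μ, ∀ s, X' s ω = X s ω := by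
  have := hP.markov
  obtain ⟨D, hDc, hD⟩ := TopologicalSpace.exists_countable_dense ℝ≥0
  have hpq : ∀ p q : ℝ≥0, p ≤ q → ∀ᵐ ω ∂μ, (X p ω).2 ≤ (X q ω).2 := by
    intro p q h
    obtain ⟨r, rfl⟩ := exists_add_of_le h
    have hm := (hX.measurable p).prodMk (hX.measurable (p + r))
    have hms : MeasurableSet {x : (E × ℝ) × (E × ℝ) | x.1.2 ≤ x.2.2} :=
      measurableSet_le (by fun_prop) (by fun_prop)
    have h1 : ∀ᵐ x ∂(P p z₀).compProd (P r), x.1.2 ≤ x.2.2 :=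
      (Measure.ae_compProd_iff hms).2 (Eventually.of_forall fun z => hle r z)
    rw [← hX.map_pair hP p r] at h1
    exact ae_of_ae_map hm.aemeasurable h1
  have hall : ∀ᵐ ω ∂μ, ∀ p ∈ D, ∀ q ∈ D, p ≤ q → (X p ω).2 ≤ (X q ω).2 := by
    rw [ae_ball_iff hDc]
    intro p _
    rw [ae_ball_iff hDc]
    intro q _
    by_cases h : p ≤ q
    · filter_upwards [hpq p q h] with ω hω _ using hω
    · exact Eventually.of_forall fun ω h' => absurd h' h
  have hgood : ∀ᵐ ω ∂μ, X 0 ω = z₀ ∧ (∀ s, ContinuousWithinAt (fun u => X u ω) (Ici s) s) ∧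
      Monotone fun s => (X s ω).2 := by
    filter_upwards [hX.initial, hright, hall] with ω h0 h1 h2
    exact ⟨h0, h1, monotone_of_dense (fun s => (h1 s).snd) hD h2⟩
  -- On a measurable null set containing the bad paths the process is frozen at `z₀`. This keeps all
  -- paths regular and does not affect the laws.
  obtain ⟨A, hAsub, hAm, hA0⟩ := exists_measurable_superset_of_null (ae_iff.1 hgood)
  have hA : ∀ ω ∉ A, X 0 ω = z₀ ∧ (∀ s, ContinuousWithinAt (fun u => X u ω) (Ici s) s) ∧
      Monotone fun s => (X s ω).2 := fun ω hω => by
    by_contra h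
    exact hω (hAsub h)
  classical
  have heq : ∀ᵐ ω ∂μ, ∀ s, (if ω ∈ A then z₀ else X s ω) = X s ω := by
    filter_upwards [measure_eq_zero_iff_ae_notMem.1 hA0] with ω hω s
    rw [if_neg hω]
  refine ⟨fun s ω => if ω ∈ A then z₀ else X s ω, ⟨fun s => ?_, fun ω => ?_, fun s r => ?_,
    fun ω s => ?_, fun ω => ?_⟩, heq⟩
  · exact Measurable.ite hAm measurable_const (hX.measurable s)
  · split_ifs with h
    · rfl
    · exact (hA ω h).1
  · rw [← hX.map_pair hP s r]
    refine Measure.map_congr ?_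
    filter_upwards [heq] with ω hω
    rw [hω, hω]
  · by_cases h : ω ∈ A
    · simp only [if_pos h]; exact continuousWithinAt_const
    · simp only [if_neg h]; exact (hA ω h).2.1 s
  · by_cases h : ω ∈ A
    · simp only [if_pos h]; exact monotone_const
    · simp only [if_neg h]; exact (hA ω h).2.2

end RegularProcess

/-! ### Two-time laws and joint measurability of a regular process. -/

section RegularProcessLaws

variable {E Ω : Type*} [NormedAddCommGroup E] [MeasurableSpace E] [MeasurableSpace Ω]
  {μ : Measure Ω} {P : ℝ≥0 → Kernel (E × ℝ) (E × ℝ)} {z₀ : E × ℝ} {X : ℝ≥0 → Ω → E × ℝ}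

lemma IsRegularProcess.map_eq (hP : IsTransitionFunction P) (hX : IsRegularProcess P z₀ X μ)
    (s : ℝ≥0) : μ.map (X s) = P s z₀ := by
  have := hP.markov
  have h := congrArg (Measure.map Prod.fst) (hX.law s 0)
  rw [Measure.map_map measurable_fst ((hX.measurable s).prodMk (hX.measurable _))] at h
  exact h.trans (Measure.fst_compProd _ _)

lemma IsRegularProcess.lintegral_pair (hP : IsTransitionFunction P)
    (hX : IsRegularProcess P z₀ X μ) (s r : ℝ≥0) {f g : E × ℝ → ℝ≥0∞} (hf : Measurable f)
    (hg : Measurable g) : ∫⁻ ω, f (X s ω) * g (X (s + r) ω) ∂μ =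
      ∫⁻ ω, f (X s ω) * ∫⁻ x, g x ∂P r (X s ω) ∂μ := by
  have := hP.markov
  have hm := (hX.measurable s).prodMk (hX.measurable (s + r))
  have hfg : Measurable fun x : (E × ℝ) × (E × ℝ) => f x.1 * g x.2 := by fun_prop
  rw [← lintegral_map (f := fun x : (E × ℝ) × (E × ℝ) => f x.1 * g x.2) hfg hm, hX.law,
    Measure.lintegral_compProd hfg, ← hX.map_eq hP s,
    lintegral_map hfg.lintegral_kernel_prod_right' (hX.measurable s)]
  exact lintegral_congr fun ω => by dsimp only; rw [lintegral_const_mul _ hg]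

lemma IsRegularProcess.integral_pair (hP : IsTransitionFunction P)
    (hX : IsRegularProcess P z₀ X μ) (s r : ℝ≥0) {f g : E × ℝ → ℝ} (hf : Measurable f)
    (hfi : Integrable (fun ω => f (X s ω)) μ) (hg : Measurable g) {D : ℝ} (hD : ∀ x, |g x| ≤ D) :
    ∫ ω, f (X s ω) * g (X (s + r) ω) ∂μ = ∫ ω, f (X s ω) * ∫ x, g x ∂P r (X s ω) ∂μ := by
  have := hP.markov
  have hm := (hX.measurable s).prodMk (hX.measurable (s + r))
  have hfg : Measurable fun x : (E × ℝ) × (E × ℝ) => f x.1 * g x.2 := by fun_prop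
  rw [← integral_map (f := fun x : (E × ℝ) × (E × ℝ) => f x.1 * g x.2) hm.aemeasurable
    hfg.aestronglyMeasurable, hX.law, Measure.integral_compProd, ← hX.map_eq hP s,
    integral_map (hX.measurable s).aemeasurable
      hfg.stronglyMeasurable.integral_kernel_prod_right'.aestronglyMeasurable]
  · simp only [integral_const_mul]
  · rw [← hX.law, integrable_map_measure hfg.aestronglyMeasurable hm.aemeasurable]
    exact hfi.mul_bdd (hg.comp (hX.measurable _)).aestronglyMeasurable
      (Eventually.of_forall fun ω => hD _)

/-- A right-continuous process is jointly measurable in time and chance. -/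
lemma IsRegularProcess.measurable_uncurry [BorelSpace E] (hX : IsRegularProcess P z₀ X μ) :
    Measurable fun p : ℝ × Ω => X p.1.toNNReal p.2 := by
  -- The time is replaced by a grid point strictly to its right at distance at most `1 / (n + 1)`;
  -- as the grid is countable, each approximation is jointly measurable.
  have h1 : ∀ n : ℕ, Measurable fun p : ℝ × Ω =>
      X ((⌊((n : ℝ≥0) + 1) * p.1.toNNReal⌋₊ + 1 : ℝ≥0) / ((n : ℝ≥0) + 1)) p.2 := by
    intro n
    have h2 : Measurable fun q : ℕ × Ω => X (((q.1 : ℝ≥0) + 1) / ((n : ℝ≥0) + 1)) q.2 :=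
      measurable_from_prod_countable_right fun k =>
        hX.measurable (((k : ℝ≥0) + 1) / ((n : ℝ≥0) + 1))
    refine h2.comp (f := fun p : ℝ × Ω => (⌊((n : ℝ≥0) + 1) * p.1.toNNReal⌋₊, p.2)) ?_
    refine Measurable.prodMk (Nat.measurable_floor.comp ?_) measurable_snd
    fun_prop
  refine measurable_of_tendsto_metrizable h1 (tendsto_pi_nhds.2 fun p => ?_)
  have h3 := hX.right p.2 p.1.toNNReal
  refine h3.tendsto.comp (tendsto_nhdsWithin_iff.2 ⟨?_, Eventually.of_forall fun n => ?_⟩)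
  · have h4 : Tendsto (fun n : ℕ => p.1.toNNReal + 1 / ((n : ℝ≥0) + 1)) atTop
        (𝓝 (p.1.toNNReal + 0)) :=
      tendsto_const_nhds.add (tendsto_one_div_add_atTop_nhds_zero_nat (𝕜 := ℝ≥0))
    rw [add_zero] at h4
    refine tendsto_of_tendsto_of_tendsto_of_le_of_le tendsto_const_nhds h4 (fun n => ?_) fun n => ?_
    · rw [le_div_iff₀ (by positivity), mul_comm]
      exact (Nat.lt_floor_add_one _).le
    · rw [div_le_iff₀ (by positivity), add_mul _ _ ((n : ℝ≥0) + 1),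
        div_mul_cancel₀ _ (by positivity : ((n : ℝ≥0) + 1) ≠ 0), mul_comm p.1.toNNReal]
      gcongr
      exact Nat.floor_le (by positivity)
  · rw [mem_Ici, le_div_iff₀ (by positivity), mul_comm]
    exact (Nat.lt_floor_add_one _).le

end RegularProcessLaws

/-! ### Second moments of additive functionals. -/

section SecondMoment

variable {E Ω : Type*} [NormedAddCommGroup E] [MeasurableSpace E] [BorelSpace E]
  [MeasurableSpace Ω] {μ : Measure Ω} [IsProbabilityMeasure μ]
  {P : ℝ≥0 → Kernel (E × ℝ) (E × ℝ)} {z₀ : E × ℝ} {X : ℝ≥0 → Ω → E × ℝ}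

/-- The square of the integral is an integral over a square, covered by two triangles that symmetry
exchanges. The diagonal is counted twice, hence an inequality. -/
lemma sq_lintegral_le {κ : Measure ℝ} [SFinite κ] {f : ℝ → ℝ≥0∞} (hf : Measurable f) :
    (∫⁻ s, f s ∂κ) * ∫⁻ s, f s ∂κ ≤
      2 * ∫⁻ s, ∫⁻ s', (if s ≤ s' then 1 else 0) * (f s * f s') ∂κ ∂κ := by
  have hm : Measurable fun p : ℝ × ℝ => (if p.1 ≤ p.2 then (1 : ℝ≥0∞) else 0) * (f p.1 * f p.2) :=
    (Measurable.ite (measurableSet_le measurable_fst measurable_snd) measurable_const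
      measurable_const).mul (by fun_prop)
  have h1 : ∫⁻ s, ∫⁻ s', (if s' ≤ s then 1 else 0) * (f s * f s') ∂κ ∂κ =
      ∫⁻ s, ∫⁻ s', (if s ≤ s' then 1 else 0) * (f s * f s') ∂κ ∂κ := by
    rw [lintegral_lintegral_swap]
    · simp_rw [mul_comm (f _) (f _)]
    · have hm' : Measurable fun p : ℝ × ℝ =>
          (if p.2 ≤ p.1 then (1 : ℝ≥0∞) else 0) * (f p.1 * f p.2) :=
        (Measurable.ite (measurableSet_le measurable_snd measurable_fst) measurable_const
          measurable_const).mul (by fun_prop)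
      exact hm'.aemeasurable
  rw [two_mul]
  nth_rw 1 [← h1]
  rw [← lintegral_mul_const _ hf, ← lintegral_add_right _ hm.lintegral_prod_right']
  refine lintegral_mono fun s => ?_
  dsimp only
  rw [← lintegral_const_mul _ hf, ← lintegral_add_right _ (show Measurable fun s' =>
    (if s ≤ s' then (1 : ℝ≥0∞) else 0) * (f s * f s') from
      hm.comp (f := fun s' => (s, s')) (by fun_prop))]
  refine lintegral_mono fun s' => ?_
  dsimp only
  rcases le_total s s' with h | h
  · rw [if_pos h, one_mul]; exact le_add_self
  · rw [if_pos h, one_mul]; exact le_self_add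

/-- If the expected total of `α` along the process is at most one from every starting point in the
support of `α`, then its second moment is controlled by its mean. -/
lemma IsRegularProcess.sq_lintegral_le (hP : IsTransitionFunction P)
    (hM : Measurable fun x : ℝ × (E × ℝ) => P x.1.toNNReal x.2)
    (hX : IsRegularProcess P z₀ X μ) {α : E × ℝ → ℝ≥0∞} (hα : Measurable α) {a b : ℝ} (ha : 0 ≤ a)
    (hle : ∀ z, α z ≠ 0 → ∫⁻ r in Ioc 0 (b - a), ∫⁻ x, α x ∂P r.toNNReal z ≤ 1) :
    ∫⁻ ω, (∫⁻ s in Ioc a b, α (X s.toNNReal ω)) * (∫⁻ s in Ioc a b, α (X s.toNNReal ω)) ∂μ ≤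
      2 * ∫⁻ ω, (∫⁻ s in Ioc a b, α (X s.toNNReal ω)) ∂μ := by
  have := hP.markov
  set κ : Measure ℝ := volume.restrict (Ioc a b) with hκ
  have hA : Measurable fun p : ℝ × Ω => α (X p.1.toNNReal p.2) := hα.comp hX.measurable_uncurry
  have hAω : ∀ ω, Measurable fun s : ℝ => α (X s.toNNReal ω) := fun ω =>
    hA.comp (measurable_id.prodMk measurable_const)
  have hH := measurable_lintegral_transition hM hα
  have hK : Measurable fun p : ℝ × ℝ => if p.1 ≤ p.2 then (1 : ℝ≥0∞) else 0 :=
    Measurable.ite (measurableSet_le measurable_fst measurable_snd) measurable_const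
      measurable_const
  have hm1 : Measurable fun p : (ℝ × ℝ) × Ω => (if p.1.1 ≤ p.1.2 then (1 : ℝ≥0∞) else 0) *
      (α (X p.1.1.toNNReal p.2) * α (X p.1.2.toNNReal p.2)) :=
    (hK.comp measurable_fst).mul ((hA.comp (f := fun p : (ℝ × ℝ) × Ω => (p.1.1, p.2))
      (by fun_prop)).mul (hA.comp (f := fun p : (ℝ × ℝ) × Ω => (p.1.2, p.2)) (by fun_prop)))
  have hm2 : Measurable fun p : (ℝ × ℝ) × Ω => (if p.1.1 ≤ p.1.2 then (1 : ℝ≥0∞) else 0) *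
      (α (X p.1.1.toNNReal p.2) *
        ∫⁻ x, α x ∂P (p.1.2 - p.1.1).toNNReal (X p.1.1.toNNReal p.2)) :=
    (hK.comp measurable_fst).mul ((hA.comp (f := fun p : (ℝ × ℝ) × Ω => (p.1.1, p.2))
      (by fun_prop)).mul (hH.comp (f := fun p : (ℝ × ℝ) × Ω =>
        (p.1.2 - p.1.1, X p.1.1.toNNReal p.2)) (Measurable.prodMk (by fun_prop)
          (hX.measurable_uncurry.comp (f := fun p : (ℝ × ℝ) × Ω => (p.1.1, p.2)) (by fun_prop)))))
  calc _ ≤ ∫⁻ ω, 2 * ∫⁻ s, ∫⁻ s', (if s ≤ s' then 1 else 0) *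
        (α (X s.toNNReal ω) * α (X s'.toNNReal ω)) ∂κ ∂κ ∂μ :=
        lintegral_mono fun ω => MonotoneSubordination.sq_lintegral_le (hAω ω)
    _ = 2 * ∫⁻ ω, ∫⁻ s, ∫⁻ s', (if s ≤ s' then 1 else 0) *
        (α (X s.toNNReal ω) * α (X s'.toNNReal ω)) ∂κ ∂κ ∂μ :=
        lintegral_const_mul' _ _ ENNReal.ofNat_ne_top
    _ = 2 * ∫⁻ s, ∫⁻ s', ∫⁻ ω, (if s ≤ s' then 1 else 0) *
        (α (X s.toNNReal ω) * α (X s'.toNNReal ω)) ∂μ ∂κ ∂κ := by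
        rw [lintegral_lintegral_swap]
        · congr 1
          refine lintegral_congr fun s => ?_
          rw [lintegral_lintegral_swap]
          exact (hm1.comp (f := fun p : Ω × ℝ => ((s, p.2), p.1)) (by fun_prop)).aemeasurable
        · exact ((hm1.comp (f := fun p : (Ω × ℝ) × ℝ => ((p.1.2, p.2), p.1.1))
            (by fun_prop)).lintegral_prod_right').aemeasurable
    -- The Markov property at the earlier time `s`. After this the integral over `s'` is an expected
    -- total from the state at time `s` over a duration of at most `b - a`, to which `hle` applies.
    _ = 2 * ∫⁻ s, ∫⁻ s', ∫⁻ ω, (if s ≤ s' then 1 else 0) *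
        (α (X s.toNNReal ω) * ∫⁻ x, α x ∂P (s' - s).toNNReal (X s.toNNReal ω)) ∂μ ∂κ ∂κ := by
        congr 1
        refine setLIntegral_congr_fun measurableSet_Ioc fun s hs => ?_
        refine lintegral_congr fun s' => ?_
        by_cases h : s ≤ s'
        · simp only [if_pos h, one_mul]
          rw [← hX.lintegral_pair hP _ _ hα hα,
            ← Real.toNNReal_add (ha.trans hs.1.le) (sub_nonneg.2 h), add_sub_cancel]
        · simp only [if_neg h, zero_mul]
    _ = 2 * ∫⁻ s, ∫⁻ ω, α (X s.toNNReal ω) * ∫⁻ s', (if s ≤ s' then 1 else 0) *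
        ∫⁻ x, α x ∂P (s' - s).toNNReal (X s.toNNReal ω) ∂κ ∂μ ∂κ := by
        congr 1
        refine lintegral_congr fun s => ?_
        rw [lintegral_lintegral_swap]
        swap
        · exact (hm2.comp (f := fun p : ℝ × Ω => ((s, p.1), p.2)) (by fun_prop)).aemeasurable
        refine lintegral_congr fun ω => ?_
        simp only [mul_left_comm _ (α (X s.toNNReal ω))]
        refine lintegral_const_mul _ ?_
        exact (hK.comp (f := fun s' : ℝ => (s, s')) (by fun_prop)).mul
          (hH.comp (f := fun s' : ℝ => (s' - s, X s.toNNReal ω)) (by fun_prop))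
    _ ≤ 2 * ∫⁻ s, ∫⁻ ω, α (X s.toNNReal ω) ∂μ ∂κ := by
        gcongr 2 * ?_
        refine setLIntegral_mono' measurableSet_Ioc fun s hs => lintegral_mono fun ω => ?_
        by_cases hz : α (X s.toNNReal ω) = 0
        · simp [hz]
        refine mul_le_of_le_one_right' (le_trans ?_ (hle _ hz))
        set z := X s.toNNReal ω
        set H : ℝ → ℝ≥0∞ := fun r => ∫⁻ x, α x ∂P r.toNNReal z with hHdef
        calc ∫⁻ s', (if s ≤ s' then 1 else 0) * H (s' - s) ∂κ
            ≤ ∫⁻ s', (Icc 0 (b - a)).indicator H (s' - s) := by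
              rw [hκ, ← lintegral_indicator measurableSet_Ioc]
              refine lintegral_mono fun s' => ?_
              by_cases hs' : s' ∈ Ioc a b
              swap
              · rw [indicator_of_notMem hs']; exact zero_le
              rw [indicator_of_mem hs']
              by_cases h : s ≤ s'
              · rw [if_pos h, one_mul, indicator_of_mem]
                exact ⟨by linarith, by linarith [hs'.2, hs.1]⟩
              · simp [if_neg h]
          _ = ∫⁻ r, (Icc 0 (b - a)).indicator H r :=
              lintegral_sub_right_eq_self _ s
          _ = ∫⁻ r in Ioc 0 (b - a), H r := by
              rw [lintegral_indicator measurableSet_Icc, restrict_Ioc_eq_restrict_Icc]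
    _ = _ := by
        rw [lintegral_lintegral_swap hA.aemeasurable]

/-- A set of paths outside which `U` vanishes controls the mean of `U`, if the second moment of `U`
is at most twice its mean. -/
lemma lintegral_le_of_sq_le {U : Ω → ℝ≥0∞} (hU : Measurable U) {B : Set Ω} (hB : MeasurableSet B)
    (hUB : ∀ ω ∉ B, U ω = 0) (hfin : ∫⁻ ω, U ω ∂μ ≠ ∞)
    (hsq : ∫⁻ ω, U ω * U ω ∂μ ≤ 2 * ∫⁻ ω, U ω ∂μ) : ∫⁻ ω, U ω ∂μ ≤ 2 * μ B := by
  -- On `B` this is `(U - 2)² ≥ 0`. Integrated, it reads `4 E U ≤ 2 E U + 4 μ B`, and the finite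
  -- mean can be absorbed.
  have h1 : ∀ ω, 4 * U ω ≤ U ω * U ω + B.indicator (fun _ => 4) ω := by
    intro ω
    by_cases hω : ω ∈ B
    · rw [indicator_of_mem hω]
      rcases eq_or_ne (U ω) ∞ with h | h
      · simp [h]
      · lift U ω to ℝ≥0 using h with u
        norm_cast
        rw [← NNReal.coe_le_coe]
        push_cast
        nlinarith [sq_nonneg ((u : ℝ) - 2)]
    · simp [hUB ω hω]
  have h2 : 4 * ∫⁻ ω, U ω ∂μ ≤ 2 * ∫⁻ ω, U ω ∂μ + 4 * μ B := by
    rw [← lintegral_const_mul _ hU]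
    refine (lintegral_mono h1).trans ?_
    rw [lintegral_add_left (f := fun ω => U ω * U ω) (hU.mul hU), lintegral_indicator_const hB]
    gcongr
  have h3 : μ B ≠ ∞ := measure_ne_top _ _
  lift ∫⁻ ω, U ω ∂μ to ℝ≥0 using hfin with u
  lift μ B to ℝ≥0 using h3 with p
  norm_cast at h2 ⊢
  rw [← NNReal.coe_le_coe] at h2 ⊢
  push_cast at h2 ⊢
  linarith

end SecondMoment

/-! ### Paths that are far away just after crossing the level. -/

section Explosion

variable {E Ω : Type*} [NormedAddCommGroup E] [MeasurableSpace E]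
  [MeasurableSpace Ω] {μ : Measure Ω} {P : ℝ≥0 → Kernel (E × ℝ) (E × ℝ)} {z₀ : E × ℝ}
  {X : ℝ≥0 → Ω → E × ℝ}

/-- States far away in the first coordinate, and just above `t` in the second. -/
def farStates (E : Type*) [NormedAddCommGroup E] (t : ℝ) (n : ℕ) : Set (E × ℝ) :=
  {z | (n : ℝ) < ‖z.1‖ ∧ t < z.2 ∧ z.2 < t + 1 / ((n : ℝ) + 1)}

lemma measurableSet_farStates [BorelSpace E] (t : ℝ) (n : ℕ) : MeasurableSet (farStates E t n) :=
  (measurableSet_lt measurable_const measurable_fst.norm).inter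
    ((measurableSet_lt measurable_const measurable_snd).inter
      (measurableSet_lt measurable_snd measurable_const))

lemma farStates_antitone {E : Type*} [NormedAddCommGroup E] (t : ℝ) : Antitone (farStates E t) := by
  intro n m h z hz
  have h' : (n : ℝ) ≤ m := by exact_mod_cast h
  refine ⟨h'.trans_lt hz.1, hz.2.1, hz.2.2.trans_le ?_⟩
  gcongr

/-- By right-continuity a path does not explode just after it crosses a level. -/
lemma IsRegularProcess.exists_notMem_farStates (hX : IsRegularProcess P z₀ X μ) (t : ℝ) (ω : Ω) :
    ∃ n, ∀ s, X s ω ∉ farStates E t n := by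
  rcases {u : ℝ≥0 | t < (X u ω).2}.eq_empty_or_nonempty with hS | hS
  · refine ⟨0, fun s hs => ?_⟩
    have : s ∈ {u : ℝ≥0 | t < (X u ω).2} := hs.2.1
    rw [hS] at this
    exact this
  set S : Set ℝ≥0 := {u : ℝ≥0 | t < (X u ω).2} with hSdef
  set Z := sInf S with hZ
  -- Just after `Z` the first coordinate is bounded by right-continuity, and from some `u₂` inside
  -- that time interval on the second exceeds `t` by a fixed amount. For large `n` a far state is
  -- compatible with neither.
  have h1 : ∀ᶠ u in 𝓝[≥] Z, ‖(X u ω).1‖ < ‖(X Z ω).1‖ + 1 :=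
    ((hX.right ω Z).fst.norm).eventually (gt_mem_nhds (lt_add_one _))
  obtain ⟨u₁, hu₁, hsub⟩ := (mem_nhdsGE_iff_exists_Ico_subset).1 h1
  obtain ⟨u₂, hu₂, hu₂'⟩ := exists_between (mem_Ioi.1 hu₁)
  have h2 : t < (X u₂ ω).2 := by
    obtain ⟨s, hs, hsu⟩ := exists_lt_of_csInf_lt hS hu₂
    exact lt_of_lt_of_le hs (hX.mono ω hsu.le)
  obtain ⟨n₁, hn₁⟩ := exists_nat_ge (‖(X Z ω).1‖ + 1)
  obtain ⟨n₂, hn₂⟩ := exists_nat_one_div_lt (sub_pos.2 h2)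
  refine ⟨max n₁ n₂, fun s hs => ?_⟩
  have hs1 := farStates_antitone t (le_max_left n₁ n₂) hs
  have hs2 := farStates_antitone t (le_max_right n₁ n₂) hs
  have hsu : s < u₂ := by
    by_contra h
    have := hX.mono ω (not_lt.1 h)
    dsimp only at this
    linarith [hs2.2.2]
  have hZs : Z ≤ s := csInf_le (OrderBot.bddBelow _) hs1.2.1
  have h3 : ‖(X s ω).1‖ < ‖(X Z ω).1‖ + 1 := hsub ⟨hZs, hsu.trans hu₂'⟩
  linarith [hs1.1]

variable [BorelSpace E]

/-- The paths that spend time in far states just above `t`. -/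
def explosionEvent (X : ℝ≥0 → Ω → E × ℝ) (t a b : ℝ) (n : ℕ) : Set Ω :=
  {ω | ∫⁻ s in Ioc a b, (farStates E t n).indicator 1 (X s.toNNReal ω) ≠ 0}

lemma IsRegularProcess.measurableSet_explosionEvent (hX : IsRegularProcess P z₀ X μ) (t a b : ℝ)
    (n : ℕ) : MeasurableSet (explosionEvent X t a b n) := by
  have h : Measurable fun p : ℝ × Ω =>
      (farStates E t n).indicator (1 : E × ℝ → ℝ≥0∞) (X p.1.toNNReal p.2) :=
    (measurable_one.indicator (measurableSet_farStates t n)).comp hX.measurable_uncurry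
  exact (h.lintegral_prod_left' (μ := volume.restrict (Ioc a b)))
    (measurableSet_singleton 0).compl

/-- The events decrease in `n`, and by `exists_notMem_farStates` no path belongs to all of them. -/
lemma IsRegularProcess.tendsto_explosionEvent [IsFiniteMeasure μ]
    (hX : IsRegularProcess P z₀ X μ) (t a b : ℝ) :
    Tendsto (fun n => μ (explosionEvent X t a b n)) atTop (𝓝 0) := by
  have h := tendsto_measure_iInter_atTop (μ := μ) (s := explosionEvent X t a b)
    (fun n => (hX.measurableSet_explosionEvent t a b n).nullMeasurableSet) (fun n m hnm ω hω => ?_)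
    ⟨0, measure_ne_top _ _⟩
  · have h0 : ⋂ n, explosionEvent X t a b n = ∅ := by
      refine eq_empty_of_forall_notMem fun ω hω => ?_
      obtain ⟨n, hn⟩ := hX.exists_notMem_farStates t ω
      refine mem_iInter.1 hω n ?_
      simp [indicator_of_notMem (hn _)]
    rwa [h0, measure_empty] at h
  · refine fun h0 => hω (le_antisymm (le_trans (lintegral_mono fun s => ?_) h0.le) zero_le)
    exact indicator_le_indicator_of_subset (farStates_antitone t hnm) (fun _ => zero_le) _

end Explosion

/-! ### Absence of creeping over the level. -/

section Creeping

variable {E : Type*} {ν : ℝ → ℝ → E → ℝ}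

/-- The smoothed rate of crossings of `t` from states that are already above `t`. -/
def aboveRate (ν : ℝ → ℝ → E → ℝ) (t : ℝ) (m : ℕ) : E × ℝ → ℝ≥0∞ :=
  {z | t < z.2}.indicator fun z => ENNReal.ofReal (jumpOp ν z.1 (step m t) z.2)

lemma aboveRate_le (ν : ℝ → ℝ → E → ℝ) (t : ℝ) (m : ℕ) (z : E × ℝ) :
    aboveRate ν t m z ≤ ENNReal.ofReal (jumpOp ν z.1 (step m t) z.2) :=
  indicator_le_self _ _ z

lemma aboveRate_eq_zero {t : ℝ} {m : ℕ} (hm : 1 ≤ m) {z : E × ℝ}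
    (h : z.2 ≤ t ∨ t + 1 / (m : ℝ) ≤ z.2) : aboveRate ν t m z = 0 := by
  rcases h with h | h
  · exact indicator_of_notMem (s := {z : E × ℝ | t < z.2}) (not_lt.2 h) _
  · refine le_antisymm ((aboveRate_le ν t m z).trans ?_) zero_le
    have hm0 : (0 : ℝ) < m := by exact_mod_cast hm
    rw [jumpOp_step_eq_zero ν z.1 hm0.le, ENNReal.ofReal_zero]
    rw [← div_le_iff₀' hm0]
    linarith

lemma IsJumpDensity.measurable_aboveRate [MeasurableSpace E] (hν : IsJumpDensity ν) (t : ℝ)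
    (m : ℕ) : Measurable (aboveRate ν t m) :=
  (hν.measurable_jumpOp (continuous_step m t).measurable).ennreal_ofReal.indicator
    (measurableSet_lt measurable_const measurable_snd)

variable [NormedAddCommGroup E] [MeasureSpace E] [ProperSpace E]
  [IsFiniteMeasureOnCompacts (volume : Measure E)] {P : ℝ≥0 → Kernel (E × ℝ) (E × ℝ)}
  {Q : ℝ≥0 → Kernel E E} {G : ℝ → E → ℝ → E → ℝ → ℝ}

/-- For fixed `y` a rate `o(m)` on a strip of width `1/m` integrates to `o(1)`. The crude bound `M
m` dominates the inner integral by `M` on a ball of finite volume, so pointwise convergence in `y`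
suffices. -/
lemma IsJumpDensity.tendsto_lintegral_strip (hν : IsJumpDensity ν) (t : ℝ) (n : ℕ) :
    Tendsto (fun m : ℕ => ∫⁻ y in Metric.closedBall (0 : E) n, ∫⁻ v in Ioc t (t + 1 / (m : ℝ)),
      ENNReal.ofReal (jumpOp ν y (step m t) v)) atTop (𝓝 0) := by
  obtain ⟨M, hM0, hM⟩ := hν.exists_jumpOp_step_le
  have hstrip : ∀ (m : ℕ) (C : ℝ), 1 ≤ m → 0 ≤ C → ∀ y : E,
      (∀ v ∈ Ioc t (t + 1 / (m : ℝ)), jumpOp ν y (step m t) v ≤ C * m) →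
      ∫⁻ v in Ioc t (t + 1 / (m : ℝ)), ENNReal.ofReal (jumpOp ν y (step m t) v) ≤
        ENNReal.ofReal C := by
    intro m C hm hC y h
    have hm0 : (0 : ℝ) < m := by exact_mod_cast hm
    calc _ ≤ ∫⁻ _ in Ioc t (t + 1 / (m : ℝ)), ENNReal.ofReal (C * m) :=
          setLIntegral_mono' measurableSet_Ioc fun v hv => ENNReal.ofReal_le_ofReal (h v hv)
      _ = ENNReal.ofReal C := by
          rw [setLIntegral_const, Real.volume_Ioc, add_sub_cancel_left,
            ← ENNReal.ofReal_mul (by positivity)]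
          congr 1
          field_simp
  rw [← lintegral_zero (μ := (volume : Measure E).restrict (Metric.closedBall 0 n))]
  refine tendsto_lintegral_filter_of_dominated_convergence (fun _ => ENNReal.ofReal M)
    (Eventually.of_forall fun m => ?_) ?_ ?_ (Eventually.of_forall fun y => ?_)
  · exact (hν.measurable_jumpOp
      (continuous_step m t).measurable).ennreal_ofReal.lintegral_prod_right'
  · filter_upwards [eventually_ge_atTop 1] with m hm
    refine Eventually.of_forall fun y => hstrip m M hm hM0 y fun v _ => hM m t v y ?_
    exact_mod_cast hm
  · rw [setLIntegral_const]
    exact ENNReal.mul_ne_top ENNReal.ofReal_ne_top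
      (isCompact_closedBall _ _).measure_lt_top.ne
  · rw [ENNReal.tendsto_nhds_zero]
    intro ε hε
    rcases eq_or_ne ε ∞ with rfl | hε'
    · exact Eventually.of_forall fun _ => le_top
    have hpos : 0 < ε.toReal := ENNReal.toReal_pos hε.ne' hε'
    filter_upwards [hν.eventually_jumpOp_step_le y t hpos, eventually_ge_atTop 1] with m h hm
    rw [← ENNReal.ofReal_toReal hε']
    exact hstrip m _ hm hpos.le y fun v hv => h v ⟨hv.1.le, hv.2⟩

variable [BorelSpace E] [SFinite (volume : Measure E)]

/-- While the first coordinate stays in a bounded set, the density of the process near the level is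
bounded, so that the smoothed rates of crossings from above the level are negligible. -/
lemma IsContinuousTransitionDensity.tendsto_aboveRate_bounded (hν : IsJumpDensity ν)
    (hG : IsContinuousTransitionDensity P G) (z₀ : E × ℝ) (t : ℝ) {a b : ℝ} (ha : 0 < a) (n : ℕ) :
    Tendsto (fun m : ℕ => ∫⁻ s in Ioc a b,
      ∫⁻ z, {z : E × ℝ | ‖z.1‖ ≤ n}.indicator (aboveRate ν t m) z ∂P s.toNNReal z₀)
      atTop (𝓝 0) := by
  -- `a > 0` keeps this compact set within the region `s > 0` where the density is continuous.
  obtain ⟨C, hC⟩ := ((isCompact_Icc (a := a) (b := b)).prod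
    ((isCompact_closedBall (0 : E) n).prod
      (isCompact_Icc (a := t) (b := t + 1)))).exists_bound_of_continuousOn
      ((hG.continuous z₀.1 z₀.2).mono fun x hx => ⟨ha.trans_le hx.1.1, mem_univ _⟩)
  have hlim := (ENNReal.Tendsto.const_mul (a := ENNReal.ofReal C * ENNReal.ofReal (b - a))
    (hν.tendsto_lintegral_strip (E := E) t n) (Or.inr (by finiteness)))
  rw [mul_zero] at hlim
  refine tendsto_of_tendsto_of_tendsto_of_le_of_le' tendsto_const_nhds hlim
    (Eventually.of_forall fun m => zero_le) ?_
  filter_upwards [eventually_ge_atTop 1] with m hm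
  have hm1 : (1 : ℝ) ≤ m := by exact_mod_cast hm
  have hn : MeasurableSet {z : E × ℝ | ‖z.1‖ ≤ n} :=
    measurableSet_le measurable_fst.norm measurable_const
  set I := ∫⁻ y in Metric.closedBall (0 : E) n, ∫⁻ v in Ioc t (t + 1 / (m : ℝ)),
      ENNReal.ofReal (jumpOp ν y (step m t) v) with hI
  have hj : Measurable fun z : E × ℝ => ENNReal.ofReal (jumpOp ν z.1 (step m t) z.2) :=
    (hν.measurable_jumpOp (continuous_step m t).measurable).ennreal_ofReal
  have hB : MeasurableSet (Metric.closedBall (0 : E) n ×ˢ Ioc t (t + 1 / (m : ℝ))) :=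
    Metric.isClosed_closedBall.measurableSet.prod measurableSet_Ioc
  have key : ∀ s ∈ Ioc a b,
      ∫⁻ z, {z : E × ℝ | ‖z.1‖ ≤ n}.indicator (aboveRate ν t m) z ∂P s.toNNReal z₀ ≤
        ENNReal.ofReal C * I := by
    intro s hs
    have hs0 : 0 < s := ha.trans hs.1
    rw [hG.apply hs0, lintegral_withDensity_eq_lintegral_mul _
      (hG.measurable _ _ hs0).ennreal_ofReal ((hν.measurable_aboveRate t m).indicator hn)]
    calc _ ≤ ∫⁻ z : E × ℝ, ENNReal.ofReal C *
          (Metric.closedBall (0 : E) n ×ˢ Ioc t (t + 1 / (m : ℝ))).indicator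
            (fun z => ENNReal.ofReal (jumpOp ν z.1 (step m t) z.2)) z := by
          refine lintegral_mono fun z => ?_
          rw [Pi.mul_apply]
          by_cases hz : z ∈ Metric.closedBall (0 : E) n ×ˢ Ioc t (t + 1 / (m : ℝ))
          · rw [indicator_of_mem hz]
            refine mul_le_mul' (ENNReal.ofReal_le_ofReal ((le_abs_self _).trans
              (hC (s, z) ⟨Ioc_subset_Icc_self hs, hz.1, hz.2.1.le, hz.2.2.trans ?_⟩))) ?_
            · gcongr
              exact div_le_one_of_le₀ hm1 (by positivity)
            · exact (indicator_le_self _ _ z).trans (aboveRate_le ν t m z)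
          · rw [indicator_of_notMem hz, mul_zero]
            by_cases hzn : z ∈ {z : E × ℝ | ‖z.1‖ ≤ n}
            · rw [indicator_of_mem hzn, aboveRate_eq_zero hm, mul_zero]
              by_contra! h
              exact hz ⟨mem_closedBall_zero_iff.2 hzn, h.1, h.2.le⟩
            · rw [indicator_of_notMem hzn, mul_zero]
      _ = ENNReal.ofReal C * I := by
          rw [lintegral_const_mul _ (hj.indicator hB), lintegral_indicator hB,
            Measure.volume_eq_prod, ← Measure.prod_restrict, lintegral_prod _ hj.aemeasurable]
  calc _ ≤ ∫⁻ _ in Ioc a b, ENNReal.ofReal C * I := setLIntegral_mono' measurableSet_Ioc key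
    _ = _ := by rw [setLIntegral_const, Real.volume_Ioc]; ring

variable {Ω : Type*} [MeasurableSpace Ω] {μ : Measure Ω} [IsProbabilityMeasure μ] {z₀ : E × ℝ}
  {X : ℝ≥0 → Ω → E × ℝ}

/-- The process does not creep over a level: the smoothed rates of crossings from above the
level are negligible. -/
lemma IsRegularProcess.tendsto_aboveRate (hP : IsTransitionFunction P) (hν : IsJumpDensity ν)
    (hgen : HasGeneratorSum P Q ν) (hG : IsContinuousTransitionDensity P G)
    (hX : IsRegularProcess P z₀ X μ) (t : ℝ) {a b : ℝ} (ha : 0 < a) (hab : a ≤ b) :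
    Tendsto (fun m : ℕ => ∫⁻ s in Ioc a b, ∫⁻ ω, aboveRate ν t m (X s.toNNReal ω) ∂μ)
      atTop (𝓝 0) := by
  have hM := hG.measurable_apply hP
  rw [ENNReal.tendsto_nhds_zero]
  intro ε hε
  have hε2 : 0 < ε / 2 := ENNReal.half_pos hε.ne'
  have hε4 : 0 < ε / 2 / 2 := ENNReal.half_pos hε2.ne'
  -- `n` is fixed first, by the probability of an explosion. Then `m ≥ n + 1` makes the strip of
  -- width `1/m` narrow enough for `farStates E t n`.
  obtain ⟨n, hn⟩ := (ENNReal.tendsto_nhds_zero.1 (hX.tendsto_explosionEvent t a b) _ hε4).exists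
  filter_upwards [ENNReal.tendsto_nhds_zero.1
    (hG.tendsto_aboveRate_bounded hν z₀ t (b := b) ha n) _ hε2,
    eventually_ge_atTop (n + 1)] with m hm hmn
  have hm1 : 1 ≤ m := by omega
  have hm1' : (1 : ℝ) ≤ m := by exact_mod_cast hm1
  have hnm : MeasurableSet {z : E × ℝ | ‖z.1‖ ≤ n} :=
    measurableSet_le measurable_fst.norm measurable_const
  set α₁ := {z : E × ℝ | ‖z.1‖ ≤ n}.indicator (aboveRate ν t m) with hα₁
  set α₂ := {z : E × ℝ | ‖z.1‖ ≤ n}ᶜ.indicator (aboveRate ν t m) with hα₂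
  have hα : Measurable (aboveRate ν t m) := hν.measurable_aboveRate t m
  have hα₁m : Measurable α₁ := hα.indicator hnm
  have hα₂m : Measurable α₂ := hα.indicator hnm.compl
  have hsum : ∀ z, aboveRate ν t m z = α₁ z + α₂ z := fun z => by
    rw [hα₁, hα₂, ← Pi.add_apply, indicator_self_add_compl]
  have hle : ∀ z, α₂ z ≤ ENNReal.ofReal (jumpOp ν z.1 (step m t) z.2) := fun z =>
    (indicator_le_self _ _ z).trans (aboveRate_le ν t m z)
  have hX₂ : Measurable fun p : ℝ × Ω => α₂ (X p.1.toNNReal p.2) :=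
    hα₂m.comp hX.measurable_uncurry
  have hswap : ∫⁻ s in Ioc a b, ∫⁻ ω, α₂ (X s.toNNReal ω) ∂μ =
      ∫⁻ ω, (∫⁻ s in Ioc a b, α₂ (X s.toNNReal ω)) ∂μ :=
    lintegral_lintegral_swap hX₂.aemeasurable
  -- Far out there is no uniform bound on the density. Instead the second moment of the time
  -- integral is at most twice its mean, and that integral vanishes off the explosion event.
  have h2 : ∫⁻ ω, (∫⁻ s in Ioc a b, α₂ (X s.toNNReal ω)) ∂μ ≤
      2 * μ (explosionEvent X t a b n) := by
    refine lintegral_le_of_sq_le hX₂.lintegral_prod_left'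
      (hX.measurableSet_explosionEvent t a b n) (fun ω hω => ?_) ?_ ?_
    · simp only [explosionEvent, mem_ofPred_eq, not_not] at hω
      rw [lintegral_eq_zero_iff' (Measurable.aemeasurable ?_)] at hω ⊢
      · filter_upwards [hω] with s hs
        by_contra h
        have hz : X s.toNNReal ω ∈ farStates E t n := by
          have h1 : X s.toNNReal ω ∈ {z : E × ℝ | ‖z.1‖ ≤ n}ᶜ := mem_of_indicator_ne_zero h
          have h2 : aboveRate ν t m (X s.toNNReal ω) ≠ 0 := by
            simp only [hα₂] at h
            rwa [indicator_of_mem h1] at h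
          have h3 := mt (aboveRate_eq_zero (ν := ν) (t := t) hm1) h2
          push Not at h3
          refine ⟨not_le.1 h1, h3.1, h3.2.trans_le ?_⟩
          have : ((n : ℝ) + 1) ≤ m := by exact_mod_cast hmn
          gcongr
        rw [indicator_of_mem hz] at hs
        exact one_ne_zero hs
      · exact hX₂.comp (measurable_id.prodMk measurable_const)
      · exact ((measurable_one.indicator (measurableSet_farStates t n)).comp
          hX.measurable_uncurry).comp (measurable_id.prodMk measurable_const)
    · obtain ⟨M, hM0, hM1⟩ := hν.exists_jumpOp_step_le
      refine ne_top_of_le_ne_top ?_ (lintegral_mono fun ω => lintegral_mono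
        (g := fun _ => ENNReal.ofReal (M * m)) fun s => (hle _).trans
          (ENNReal.ofReal_le_ofReal (hM1 m t _ _ hm1')))
      simp only [lintegral_const, Measure.restrict_apply MeasurableSet.univ, univ_inter,
        Real.volume_Ioc, measure_univ, mul_one]
      finiteness
    · refine hX.sq_lintegral_le hP hM hα₂m ha.le fun z _ => le_trans (lintegral_mono fun r =>
        lintegral_mono fun x => hle x)
        (hgen.lintegral_jumpOp_step_le hP hν hM hm1' (sub_nonneg.2 hab) z)
  have h1 : ∫⁻ s in Ioc a b, ∫⁻ ω, α₁ (X s.toNNReal ω) ∂μ ≤ ε / 2 := by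
    refine le_trans (le_of_eq (lintegral_congr fun s => ?_)) hm
    rw [← hX.map_eq hP, lintegral_map hα₁m (hX.measurable _)]
  have hX₁ : Measurable fun p : ℝ × Ω => α₁ (X p.1.toNNReal p.2) :=
    hα₁m.comp hX.measurable_uncurry
  calc ∫⁻ s in Ioc a b, ∫⁻ ω, aboveRate ν t m (X s.toNNReal ω) ∂μ
      = (∫⁻ s in Ioc a b, ∫⁻ ω, α₁ (X s.toNNReal ω) ∂μ) +
        ∫⁻ s in Ioc a b, ∫⁻ ω, α₂ (X s.toNNReal ω) ∂μ := by
        simp_rw [hsum]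
        rw [← lintegral_add_left hX₁.lintegral_prod_right']
        refine lintegral_congr fun s => ?_
        exact lintegral_add_left (hX₁.comp (measurable_const.prodMk measurable_id)) _
    _ ≤ ε / 2 + 2 * (ε / 2 / 2) := by
        rw [hswap]
        exact add_le_add h1 (h2.trans (by gcongr))
    _ = ε := by rw [ENNReal.mul_div_cancel (by simp) (by simp), ENNReal.add_halves]

end Creeping

/-! ### The balance of mass below the level. -/

section Balance

/-- The product of Lebesgue measure on `(a, b]` and the probability measure. -/
abbrev timeProd {Ω : Type*} [MeasurableSpace Ω] (μ : Measure Ω) (a b : ℝ) : Measure (ℝ × Ω) :=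
  (volume.restrict (Ioc a b)).prod μ

/-- The rate of crossings of `t` from states strictly below `t`. -/
def belowRate {E : Type*} (ν : ℝ → ℝ → E → ℝ) (t : ℝ) : E × ℝ → ℝ :=
  {z | z.2 < t}.indicator (crossRate ν t)

section

variable {E : Type*} [MeasurableSpace E] {ν : ℝ → ℝ → E → ℝ}

lemma IsJumpDensity.belowRate_nonneg (hν : IsJumpDensity ν) (t : ℝ) (z : E × ℝ) :
    0 ≤ belowRate ν t z :=
  indicator_nonneg (fun _ hz => hν.crossRate_nonneg (le_of_lt hz)) z

lemma IsJumpDensity.measurable_belowRate (hν : IsJumpDensity ν) (t : ℝ) :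
    Measurable (belowRate ν t) :=
  (hν.measurable_crossRate t).indicator (measurableSet_lt measurable_snd measurable_const)

/-- The part of the smoothed crossing rate that comes from states strictly below the level. -/
def belowStep (ν : ℝ → ℝ → E → ℝ) (t : ℝ) (m : ℕ) : E × ℝ → ℝ :=
  {z | z.2 < t}.indicator fun z => jumpOp ν z.1 (step m t) z.2

lemma IsJumpDensity.measurable_belowStep (hν : IsJumpDensity ν) (t : ℝ) (m : ℕ) :
    Measurable (belowStep ν t m) :=
  (hν.measurable_jumpOp (continuous_step m t).measurable).indicator
    (measurableSet_lt measurable_snd measurable_const)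

lemma IsJumpDensity.belowStep_nonneg (hν : IsJumpDensity ν) (t : ℝ) (m : ℕ) (z : E × ℝ) :
    0 ≤ belowStep ν t m z :=
  indicator_nonneg (fun _ _ => hν.jumpOp_step_nonneg _ _ m.cast_nonneg t) z

lemma IsJumpDensity.belowStep_le (hν : IsJumpDensity ν) (t : ℝ) (m : ℕ) (z : E × ℝ) :
    belowStep ν t m z ≤ belowRate ν t z := by
  by_cases hz : z ∈ {z : E × ℝ | z.2 < t}
  · rw [belowStep, belowRate, indicator_of_mem hz, indicator_of_mem hz]
    exact hν.jumpOp_step_le_crossRate z.1 m.cast_nonneg hz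
  · rw [belowStep, belowRate, indicator_of_notMem hz, indicator_of_notMem hz]

lemma IsJumpDensity.tendsto_belowStep (hν : IsJumpDensity ν) (t : ℝ) (z : E × ℝ) :
    Tendsto (fun m => belowStep ν t m z) atTop (𝓝 (belowRate ν t z)) := by
  by_cases hz : z ∈ {z : E × ℝ | z.2 < t}
  · simp only [belowStep, belowRate, indicator_of_mem hz]
    exact hν.tendsto_jumpOp_step z.1 hz
  · simp only [belowStep, belowRate, indicator_of_notMem hz]
    exact tendsto_const_nhds

/-- The indicator of the states at most `t`. -/
def atMost (E : Type*) (t : ℝ) : E × ℝ → ℝ := {z | z.2 ≤ t}.indicator 1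

lemma measurable_atMost (t : ℝ) : Measurable (atMost E t) :=
  measurable_one.indicator (measurableSet_le measurable_snd measurable_const)

lemma tendsto_one_sub_step {E : Type*} (t : ℝ) (z : E × ℝ) :
    Tendsto (fun m : ℕ => 1 - step m t z.2) atTop (𝓝 (atMost E t z)) := by
  refine tendsto_const_nhds.congr' ?_
  by_cases hz : z ∈ {z : E × ℝ | z.2 ≤ t}
  · refine Eventually.of_forall fun m => ?_
    simp [atMost, indicator_of_mem hz, step_eq_zero (m.cast_nonneg (α := ℝ)) hz]
  · filter_upwards [tendsto_step_nat (not_le.1 hz)] with m hm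
    rw [atMost, indicator_of_notMem hz, hm, sub_self]

lemma abs_atMost_le {E : Type*} (t : ℝ) (z : E × ℝ) : |atMost E t z| ≤ 1 := by
  by_cases hz : z ∈ {z : E × ℝ | z.2 ≤ t}
  · rw [atMost, indicator_of_mem hz]; simp
  · rw [atMost, indicator_of_notMem hz]; simp

lemma abs_one_sub_step_le (l t x : ℝ) : |1 - step l t x| ≤ 1 :=
  abs_le.2 ⟨by linarith [step_le_one l t x], by linarith [step_nonneg l t x]⟩

end

variable {E : Type*} [NormedAddCommGroup E] [MeasureSpace E]
  {ν : ℝ → ℝ → E → ℝ} {P : ℝ≥0 → Kernel (E × ℝ) (E × ℝ)} {Q : ℝ≥0 → Kernel E E}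
  {G : ℝ → E → ℝ → E → ℝ → ℝ} {Ω : Type*} [MeasurableSpace Ω] {μ : Measure Ω}
  {z₀ : E × ℝ} {X : ℝ≥0 → Ω → E × ℝ}

/-- This discards the states exactly at `t`, which are counted neither as below nor as above. -/
lemma IsRegularProcess.ae_ne (hP : IsTransitionFunction P) (hG : IsContinuousTransitionDensity P G)
    [SFinite (volume : Measure E)] (hX : IsRegularProcess P z₀ X μ) (t : ℝ) {s : ℝ} (hs : 0 < s) :
    ∀ᵐ ω ∂μ, (X s.toNNReal ω).2 ≠ t := by
  have h : ∀ᵐ z ∂P s.toNNReal z₀, z.2 ≠ t := by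
    rw [hG.apply hs]
    refine (withDensity_absolutelyContinuous _ _).ae_le ?_
    rw [Measure.volume_eq_prod]
    exact Measure.quasiMeasurePreserving_snd.ae (Measure.ae_ne volume t)
  rw [← hX.map_eq hP] at h
  exact ae_of_ae_map (hX.measurable _).aemeasurable h

variable [BorelSpace E] [IsProbabilityMeasure μ]

lemma IsRegularProcess.ae_timeProd_ne (hP : IsTransitionFunction P)
    (hG : IsContinuousTransitionDensity P G) [SFinite (volume : Measure E)]
    (hX : IsRegularProcess P z₀ X μ) (t : ℝ) {a b : ℝ} (ha : 0 < a) :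
    ∀ᵐ p ∂timeProd μ a b, (X p.1.toNNReal p.2).2 ≠ t := by
  refine (Measure.ae_prod_iff_ae_ae ?_).2 ?_
  · exact (measurableSet_eq_fun (hX.measurable_uncurry.snd) measurable_const).compl
  · filter_upwards [ae_restrict_mem measurableSet_Ioc] with s hs
    exact hX.ae_ne hP hG t (ha.trans hs.1)

/-- Kolmogorov's equation for the process. -/
lemma IsRegularProcess.balance_step (hP : IsTransitionFunction P) (hν : IsJumpDensity ν)
    (hgen : HasGeneratorSum P Q ν) (hM : Measurable fun x : ℝ × (E × ℝ) => P x.1.toNNReal x.2)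
    (hX : IsRegularProcess P z₀ X μ) {h k : E → ℝ} (hhk : (h, k) ∈ generator Q) (t : ℝ) {a b : ℝ}
    (ha : 0 ≤ a) (hab : a ≤ b) {m : ℕ} (hm : 1 ≤ m) :
    (∫ ω, h (X b.toNNReal ω).1 * (1 - step m t (X b.toNNReal ω).2) ∂μ) -
      ∫ ω, h (X a.toNNReal ω).1 * (1 - step m t (X a.toNNReal ω).2) ∂μ =
    (∫ p, k (X p.1.toNNReal p.2).1 * (1 - step m t (X p.1.toNNReal p.2).2) ∂timeProd μ a b) -
      ∫ p, h (X p.1.toNNReal p.2).1 *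
        jumpOp ν (X p.1.toNNReal p.2).1 (step m t) (X p.1.toNNReal p.2).2 ∂timeProd μ a b := by
  have := hP.markov
  obtain ⟨⟨hhm, Ch, hCh⟩, ⟨hkm, Ck, hCk⟩, -⟩ := id hhk
  have hm1 : (1 : ℝ) ≤ m := by exact_mod_cast hm
  obtain ⟨M, hM0, hM1⟩ := hν.exists_jumpOp_step_le
  have hst := (continuous_step m t).measurable
  set Φ : E × ℝ → ℝ := fun x => h x.1 * (1 - step m t x.2) with hΦ
  set K : E × ℝ → ℝ := fun x => k x.1 * (1 - step m t x.2) with hK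
  set J : E × ℝ → ℝ := fun x => h x.1 * jumpOp ν x.1 (step m t) x.2 with hJ
  have hΦm : Measurable Φ := by fun_prop
  have hKm : Measurable K := by fun_prop
  have hJm : Measurable J := (hhm.comp measurable_fst).mul (hν.measurable_jumpOp hst)
  have hKb : ∀ x, |K x| ≤ Ck := fun x =>
    abs_mul_le_of_abs_le_one (hCk _) (abs_one_sub_step_le _ _ _)
  have hJb : ∀ x, |J x| ≤ Ch * (M * m) := fun x => by
    rw [hJ, abs_mul, abs_of_nonneg (hν.jumpOp_step_nonneg _ _ m.cast_nonneg _)]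
    exact mul_le_mul (hCh _) (hM1 _ _ _ _ hm1) (hν.jumpOp_step_nonneg _ _ m.cast_nonneg _)
      ((abs_nonneg _).trans (hCh x.1))
  have hlaw : ∀ s, ∀ f : E × ℝ → ℝ, Measurable f → ∫ x, f x ∂P s z₀ = ∫ ω, f (X s ω) ∂μ :=
    fun s f hf => by
      rw [← hX.map_eq hP, integral_map (hX.measurable s).aemeasurable hf.aestronglyMeasurable]
  have hb := hgen.integral_one_sub_step hP hν hM hhk (t := t) hm1 b.toNNReal z₀
  have ha' := hgen.integral_one_sub_step hP hν hM hhk (t := t) hm1 a.toNNReal z₀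
  rw [Real.coe_toNNReal _ ha] at ha'
  rw [Real.coe_toNNReal _ (ha.trans hab)] at hb
  set Ψ : ℝ → ℝ := fun r => ∫ x, (K x - J x) ∂P r.toNNReal z₀ with hΨ
  have hKJb : ∀ x, |K x - J x| ≤ Ck + Ch * (M * m) := fun x =>
    (abs_sub _ _).trans (add_le_add (hKb x) (hJb x))
  have hΨm : Measurable Ψ := (measurable_integral_transition hM (hKm.sub hJm)).comp
      (measurable_id.prodMk measurable_const)
  have hΨi : ∀ c d, IntervalIntegrable Ψ volume c d := intervalIntegrable_of_abs_le hΨm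
    fun r => abs_integral_le_of_abs_le hKJb
  have hdiff : (∫ x, Φ x ∂P b.toNNReal z₀) - ∫ x, Φ x ∂P a.toNNReal z₀ = ∫ r in a..b, Ψ r := by
    rw [← intervalIntegral.integral_interval_sub_left (hΨi 0 b) (hΨi 0 a)]
    linarith
  have hKi : Integrable (fun p : ℝ × Ω => K (X p.1.toNNReal p.2)) (timeProd μ a b) :=
    integrable_of_abs_le (hKm.comp hX.measurable_uncurry) fun p => hKb _
  have hJi : Integrable (fun p : ℝ × Ω => J (X p.1.toNNReal p.2)) (timeProd μ a b) :=
    integrable_of_abs_le (hJm.comp hX.measurable_uncurry) fun p => hJb _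
  change (∫ ω, Φ (X b.toNNReal ω) ∂μ) - ∫ ω, Φ (X a.toNNReal ω) ∂μ =
    (∫ p, K (X p.1.toNNReal p.2) ∂timeProd μ a b) - ∫ p, J (X p.1.toNNReal p.2) ∂timeProd μ a b
  rw [← hlaw _ _ hΦm, ← hlaw _ _ hΦm, hdiff, ← integral_sub hKi hJi,
    integral_prod (fun p : ℝ × Ω => K (X p.1.toNNReal p.2) - J (X p.1.toNNReal p.2))
      (hKi.sub hJi),
    intervalIntegral.integral_of_le hab]
  exact integral_congr_ae (Eventually.of_forall fun s => hlaw _ _ (hKm.sub hJm))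

/-- The total rate of crossings from below has mean at most one. -/
lemma IsRegularProcess.lintegral_belowRate_le (hP : IsTransitionFunction P)
    (hν : IsJumpDensity ν) (hgen : HasGeneratorSum P Q ν)
    (hM : Measurable fun x : ℝ × (E × ℝ) => P x.1.toNNReal x.2) (hX : IsRegularProcess P z₀ X μ)
    (t : ℝ) {a b : ℝ} (ha : 0 ≤ a) (hab : a ≤ b) :
    ∫⁻ p, ENNReal.ofReal (belowRate ν t (X p.1.toNNReal p.2)) ∂timeProd μ a b ≤ 1 := by
  -- The crossing rate may be unbounded near `t`. Its integrability comes from Fatou's lemma and the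
  -- bound for the smoothed rates.
  have hlim : ∀ p : ℝ × Ω, ENNReal.ofReal (belowRate ν t (X p.1.toNNReal p.2)) =
      liminf (fun m => ENNReal.ofReal (belowStep ν t m (X p.1.toNNReal p.2))) atTop := fun p =>
    ((ENNReal.continuous_ofReal.tendsto _).comp (hν.tendsto_belowStep t _)).liminf_eq.symm
  simp_rw [hlim]
  refine (lintegral_liminf_le fun m =>
    ((hν.measurable_belowStep t m).comp hX.measurable_uncurry).ennreal_ofReal).trans ?_
  refine (liminf_le_liminf (v := fun _ => 1) ?_).trans (liminf_const 1).le
  filter_upwards [eventually_ge_atTop 1] with m hm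
  have hm1 : (1 : ℝ) ≤ m := by exact_mod_cast hm
  have hj : Measurable fun z : E × ℝ => ENNReal.ofReal (jumpOp ν z.1 (step m t) z.2) :=
    (hν.measurable_jumpOp (continuous_step m t).measurable).ennreal_ofReal
  calc _ ≤ ∫⁻ p, ENNReal.ofReal (jumpOp ν (X p.1.toNNReal p.2).1 (step m t)
        (X p.1.toNNReal p.2).2) ∂timeProd μ a b := by
        refine lintegral_mono fun p => ENNReal.ofReal_le_ofReal ?_
        exact indicator_le_self' (fun z _ => hν.jumpOp_step_nonneg _ _ m.cast_nonneg t) _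
    _ = ∫⁻ s in Ioc a b, ∫⁻ x, ENNReal.ofReal (jumpOp ν x.1 (step m t) x.2)
          ∂P s.toNNReal z₀ := by
        rw [lintegral_prod (fun p : ℝ × Ω => ENNReal.ofReal (jumpOp ν (X p.1.toNNReal p.2).1
          (step m t) (X p.1.toNNReal p.2).2)) (hj.comp hX.measurable_uncurry).aemeasurable]
        refine lintegral_congr fun s => ?_
        rw [← hX.map_eq hP, lintegral_map hj (hX.measurable _)]
    _ ≤ ∫⁻ s in Ioc 0 b, ∫⁻ x, ENNReal.ofReal (jumpOp ν x.1 (step m t) x.2)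
          ∂P s.toNNReal z₀ := lintegral_mono_set (Ioc_subset_Ioc_left ha)
    _ ≤ 1 := hgen.lintegral_jumpOp_step_le hP hν hM hm1 (ha.trans hab) z₀

lemma IsRegularProcess.integrable_belowRate (hP : IsTransitionFunction P)
    (hν : IsJumpDensity ν) (hgen : HasGeneratorSum P Q ν)
    (hM : Measurable fun x : ℝ × (E × ℝ) => P x.1.toNNReal x.2) (hX : IsRegularProcess P z₀ X μ)
    (t : ℝ) {a b : ℝ} (ha : 0 ≤ a) (hab : a ≤ b) :
    Integrable (fun p : ℝ × Ω => belowRate ν t (X p.1.toNNReal p.2)) (timeProd μ a b) := by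
  refine ⟨((hν.measurable_belowRate t).comp hX.measurable_uncurry).aestronglyMeasurable, ?_⟩
  rw [hasFiniteIntegral_iff_ofReal (Eventually.of_forall fun p => hν.belowRate_nonneg t _)]
  exact (hX.lintegral_belowRate_le hP hν hgen hM t ha hab).trans_lt ENNReal.one_lt_top

variable [ProperSpace E] [IsFiniteMeasureOnCompacts (volume : Measure E)]
  [SFinite (volume : Measure E)]

/-- States below the level converge under the integrable bound `C * belowRate`; states above it
disappear by `tendsto_aboveRate`. -/
lemma IsRegularProcess.tendsto_integral_jumpOp_step (hP : IsTransitionFunction P)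
    (hν : IsJumpDensity ν) (hgen : HasGeneratorSum P Q ν)
    (hG : IsContinuousTransitionDensity P G) (hX : IsRegularProcess P z₀ X μ) {h : E → ℝ}
    (hh : Measurable h) {C : ℝ} (hC : ∀ y, |h y| ≤ C) (t : ℝ) {a b : ℝ} (ha : 0 < a)
    (hab : a ≤ b) :
    Tendsto (fun m : ℕ => ∫ p, h (X p.1.toNNReal p.2).1 *
        jumpOp ν (X p.1.toNNReal p.2).1 (step m t) (X p.1.toNNReal p.2).2 ∂timeProd μ a b) atTop
      (𝓝 (∫ p, h (X p.1.toNNReal p.2).1 * belowRate ν t (X p.1.toNNReal p.2)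
        ∂timeProd μ a b)) := by
  have hM := hG.measurable_apply hP
  have hC0 : 0 ≤ C := (abs_nonneg _).trans (hC 0)
  have hXm := hX.measurable_uncurry
  have hhX : Measurable fun p : ℝ × Ω => h (X p.1.toNNReal p.2).1 := hh.comp hXm.fst
  obtain ⟨M, hM0, hM1⟩ := hν.exists_jumpOp_step_le
  have hlow : Tendsto (fun m : ℕ => ∫ p, h (X p.1.toNNReal p.2).1 *
      belowStep ν t m (X p.1.toNNReal p.2) ∂timeProd μ a b) atTop
      (𝓝 (∫ p, h (X p.1.toNNReal p.2).1 * belowRate ν t (X p.1.toNNReal p.2)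
        ∂timeProd μ a b)) := by
    refine tendsto_integral_of_dominated_convergence
      (fun p => C * belowRate ν t (X p.1.toNNReal p.2))
      (fun m => (hhX.mul ((hν.measurable_belowStep t m).comp hXm)).aestronglyMeasurable)
      ((hX.integrable_belowRate hP hν hgen hM t ha.le hab).const_mul C)
      (fun m => Eventually.of_forall fun p => ?_)
      (Eventually.of_forall fun p => (hν.tendsto_belowStep t _).const_mul _)
    rw [norm_mul, Real.norm_eq_abs, Real.norm_of_nonneg (hν.belowStep_nonneg t m _)]
    exact mul_le_mul (hC _) (hν.belowStep_le t m _) (hν.belowStep_nonneg t m _) hC0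
  set R : ℕ → E × ℝ → ℝ := fun m z => (aboveRate ν t m z).toReal with hR
  have hRm : ∀ m, Measurable (R m) := fun m => (hν.measurable_aboveRate t m).ennreal_toReal
  have hRtop : ∀ m z, aboveRate ν t m z ≠ ∞ := fun m z =>
    ne_top_of_le_ne_top ENNReal.ofReal_ne_top (aboveRate_le ν t m z)
  have hRint : ∀ m, ∫ p, R m (X p.1.toNNReal p.2) ∂timeProd μ a b =
      (∫⁻ s in Ioc a b, ∫⁻ ω, aboveRate ν t m (X s.toNNReal ω) ∂μ).toReal := fun m => by
    have h1 : Measurable fun p : ℝ × Ω => aboveRate ν t m (X p.1.toNNReal p.2) :=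
      (hν.measurable_aboveRate t m).comp hXm
    rw [integral_toReal h1.aemeasurable (Eventually.of_forall fun p => (hRtop m _).lt_top),
      lintegral_prod _ h1.aemeasurable]
  have hup : Tendsto (fun m : ℕ => ∫ p, h (X p.1.toNNReal p.2).1 *
      R m (X p.1.toNNReal p.2) ∂timeProd μ a b) atTop (𝓝 0) := by
    have h1 := (ENNReal.tendsto_toReal ENNReal.zero_ne_top).comp
      (hX.tendsto_aboveRate hP hν hgen hG t ha hab)
    have h2 : Tendsto (fun m : ℕ => C * ∫ p, R m (X p.1.toNNReal p.2) ∂timeProd μ a b) atTop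
        (𝓝 0) := by
      simp_rw [hRint]
      simpa using h1.const_mul C
    refine squeeze_zero_norm' ?_ h2
    filter_upwards [eventually_ge_atTop 1] with m hm
    have hm1 : (1 : ℝ) ≤ m := by exact_mod_cast hm
    rw [← integral_const_mul]
    refine norm_integral_le_of_norm_le ?_ (Eventually.of_forall fun p => ?_)
    · refine (integrable_of_abs_le (C := M * m) ((hRm m).comp hXm) fun p => ?_).const_mul C
      rw [Function.comp, abs_of_nonneg ENNReal.toReal_nonneg]
      refine ENNReal.toReal_le_of_le_ofReal (by positivity) ((aboveRate_le ν t m _).trans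
        (ENNReal.ofReal_le_ofReal (hM1 _ _ _ _ hm1)))
    · rw [norm_mul, Real.norm_eq_abs, Real.norm_of_nonneg ENNReal.toReal_nonneg]
      exact mul_le_mul_of_nonneg_right (hC _) ENNReal.toReal_nonneg
  have hsum := hlow.add hup
  rw [add_zero] at hsum
  refine hsum.congr' ?_
  filter_upwards [eventually_ge_atTop 1] with m hm
  have hm1 : (1 : ℝ) ≤ m := by exact_mod_cast hm
  have hi : ∀ f : E × ℝ → ℝ, Measurable f → (∀ z, |f z| ≤ M * m) →
      Integrable (fun p : ℝ × Ω => h (X p.1.toNNReal p.2).1 * f (X p.1.toNNReal p.2))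
        (timeProd μ a b) := fun f hf hfb => by
    refine integrable_of_abs_le (C := C * (M * m)) (hhX.mul (hf.comp hXm)) fun p => ?_
    rw [abs_mul]
    exact mul_le_mul (hC _) (hfb _) (abs_nonneg _) hC0
  have hJ0 : ∀ z : E × ℝ, 0 ≤ jumpOp ν z.1 (step m t) z.2 := fun z =>
    hν.jumpOp_step_nonneg _ _ m.cast_nonneg t
  rw [← integral_add]
  · refine integral_congr_ae ?_
    filter_upwards [hX.ae_timeProd_ne hP hG t (b := b) ha] with p hp
    rw [← mul_add]
    congr 1
    simp only [hR, aboveRate, belowStep]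
    rcases lt_or_gt_of_ne hp with hlt | hgt
    · rw [indicator_of_mem (show X p.1.toNNReal p.2 ∈ {z : E × ℝ | z.2 < t} from hlt),
        indicator_of_notMem (show X p.1.toNNReal p.2 ∉ {z : E × ℝ | t < z.2} from not_lt.2 hlt.le),
        ENNReal.toReal_zero, add_zero]
    · rw [indicator_of_notMem (show X p.1.toNNReal p.2 ∉ {z : E × ℝ | z.2 < t} from
          not_lt.2 (le_of_lt hgt)),
        indicator_of_mem (show X p.1.toNNReal p.2 ∈ {z : E × ℝ | t < z.2} from hgt),
        ENNReal.toReal_ofReal (hJ0 _), zero_add]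
  · refine hi _ (hν.measurable_belowStep t m) fun z => ?_
    rw [abs_of_nonneg (hν.belowStep_nonneg t m z)]
    exact (indicator_le_self' (fun z _ => hJ0 z) _).trans (hM1 _ _ _ _ hm1)
  · refine hi _ (hRm m) fun z => ?_
    rw [abs_of_nonneg ENNReal.toReal_nonneg]
    exact ENNReal.toReal_le_of_le_ofReal (by positivity) ((aboveRate_le ν t m _).trans
        (ENNReal.ofReal_le_ofReal (hM1 _ _ _ _ hm1)))

/-- The balance of the mass of `h` below the level `t` between the times `a` and `b`. -/
lemma IsRegularProcess.balance (hP : IsTransitionFunction P) (hν : IsJumpDensity ν)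
    (hgen : HasGeneratorSum P Q ν) (hG : IsContinuousTransitionDensity P G)
    (hX : IsRegularProcess P z₀ X μ) {h k : E → ℝ} (hhk : (h, k) ∈ generator Q) (t : ℝ) {a b : ℝ}
    (ha : 0 < a) (hab : a ≤ b) :
    (∫ ω, h (X b.toNNReal ω).1 * atMost E t (X b.toNNReal ω) ∂μ) -
      ∫ ω, h (X a.toNNReal ω).1 * atMost E t (X a.toNNReal ω) ∂μ =
    (∫ p, k (X p.1.toNNReal p.2).1 * atMost E t (X p.1.toNNReal p.2) ∂timeProd μ a b) -
      ∫ p, h (X p.1.toNNReal p.2).1 * belowRate ν t (X p.1.toNNReal p.2) ∂timeProd μ a b := by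
  obtain ⟨⟨hhm, Ch, hCh⟩, ⟨hkm, Ck, hCk⟩, -⟩ := id hhk
  have hlim : ∀ {α : Type _} [MeasurableSpace α] (κ : Measure α) [IsFiniteMeasure κ]
      {x : α → E × ℝ}, Measurable x → ∀ (f : E → ℝ) (C : ℝ), Measurable f → (∀ y, |f y| ≤ C) →
      Tendsto (fun m : ℕ => ∫ p, f (x p).1 * (1 - step m t (x p).2) ∂κ) atTop
        (𝓝 (∫ p, f (x p).1 * atMost E t (x p) ∂κ)) := by
    intro α _ κ _ x hx f C hf hC
    refine tendsto_integral_of_dominated_convergence (fun _ => C) (fun m => ?_)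
      (integrable_const _) (fun m => Eventually.of_forall fun p => ?_)
      (Eventually.of_forall fun p => (tendsto_one_sub_step t _).const_mul _)
    · have := (continuous_step m t).measurable
      exact Measurable.aestronglyMeasurable (by fun_prop)
    · exact abs_mul_le_of_abs_le_one (hC _) (abs_one_sub_step_le _ _ _)
  have h1 := (hlim μ (hX.measurable b.toNNReal) h Ch hhm hCh).sub
    (hlim μ (hX.measurable a.toNNReal) h Ch hhm hCh)
  have h2 := (hlim (timeProd μ a b) hX.measurable_uncurry k Ck hkm hCk).sub
    (hX.tendsto_integral_jumpOp_step hP hν hgen hG hhm hCh t ha hab)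
  refine tendsto_nhds_unique (h1.congr' ?_) h2
  filter_upwards [eventually_ge_atTop 1] with m hm
  exact hX.balance_step hP hν hgen (hG.measurable_apply hP) hhk t ha.le hab hm

end Balance

/-! ### The passage formula. -/

section Passage

lemma tendsto_average_right {f : ℝ → ℝ} (hf : Measurable f) {C : ℝ} (hC : ∀ x, |f x| ≤ C) {z : ℝ}
    (hz : ContinuousWithinAt f (Ici z) z) :
    Tendsto (fun n : ℕ => (1 / ((n : ℝ) + 1))⁻¹ * ∫ r in (0 : ℝ)..(1 / ((n : ℝ) + 1)), f (z + r))
      atTop (𝓝 (f z)) := by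
  have h1 : ∀ n : ℕ, (1 / ((n : ℝ) + 1))⁻¹ * ∫ r in (0 : ℝ)..(1 / ((n : ℝ) + 1)), f (z + r) =
      ∫ u in (0 : ℝ)..1, f (z + 1 / ((n : ℝ) + 1) * u) := fun n => by
    have h := intervalIntegral.integral_comp_mul_left (a := 0) (b := 1) (fun r => f (z + r))
      (c := 1 / ((n : ℝ) + 1)) (by positivity)
    rw [h, mul_zero, mul_one, smul_eq_mul]
  have h2 : f z = ∫ _ in (0 : ℝ)..1, f z := by simp
  simp_rw [h1]
  rw [h2]
  refine intervalIntegral.tendsto_integral_filter_of_dominated_convergence (fun _ => C)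
    (Eventually.of_forall fun n => Measurable.aestronglyMeasurable (by fun_prop))
    (Eventually.of_forall fun n => Eventually.of_forall fun u _ => hC _) (by simp)
    (Eventually.of_forall fun u hu => ?_)
  rw [uIoc_of_le zero_le_one] at hu
  refine hz.tendsto.comp (tendsto_nhdsWithin_iff.2 ⟨?_, Eventually.of_forall fun n => ?_⟩)
  · have h3 := ((tendsto_one_div_add_atTop_nhds_zero_nat (𝕜 := ℝ)).mul_const u).const_add z
    simpa using h3
  · have : 0 ≤ 1 / ((n : ℝ) + 1) * u := mul_nonneg (by positivity) hu.1.le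
    exact mem_Ici.2 (by linarith)

lemma integral_mul_intervalIntegral {Ω : Type*} [MeasurableSpace Ω] {μ : Measure Ω} [SFinite μ]
    {g : Ω → ℝ} (hg : Integrable g μ) {φ : Ω × ℝ → ℝ} (hφ : Measurable φ) {C : ℝ}
    (hC : ∀ p, |φ p| ≤ C) (δ : ℝ) :
    ∫ ω, g ω * (∫ r in (0 : ℝ)..δ, φ (ω, r)) ∂μ =
      ∫ r in (0 : ℝ)..δ, ∫ ω, g ω * φ (ω, r) ∂μ := by
  have : IsFiniteMeasure (volume.restrict (uIoc 0 δ)) := by rw [uIoc]; infer_instance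
  rw [intervalIntegral_integral_swap]
  · simp only [intervalIntegral.integral_const_mul]
  · have h : Integrable (fun p : Ω × ℝ => g p.1 * φ p) (μ.prod (volume.restrict (uIoc 0 δ))) :=
      (hg.comp_fst _).mul_bdd hφ.aestronglyMeasurable (Eventually.of_forall hC)
    exact h.swap

section InverseTime

variable {Ω : Type*} {V : ℝ≥0 → Ω → ℝ} {t : ℝ} {ω : Ω}

lemma inverseTime_le {u : ℝ≥0} (h : t < V u ω) : inverseTime V t ω ≤ u := iInf₂_le u h

lemma lt_of_inverseTime_lt (hV : Monotone fun s => V s ω) {u : ℝ≥0} (h : inverseTime V t ω < u) :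
    t < V u ω := by
  simp only [inverseTime, iInf_lt_iff] at h
  obtain ⟨u', hu', hlt⟩ := h
  exact hu'.trans_le (hV (ENNReal.coe_lt_coe.1 hlt).le)

lemma le_inverseTime (hV : Monotone fun s => V s ω) {u : ℝ≥0} (h : V u ω ≤ t) :
    (u : ℝ≥0∞) ≤ inverseTime V t ω :=
  not_lt.1 fun h' => absurd (lt_of_inverseTime_lt hV h') (not_lt.2 h)

end InverseTime

/-- The balance along a path, expressed by the passage time. -/
lemma path_balance {Ω : Type*} {V : ℝ≥0 → Ω → ℝ} {t : ℝ} {ω : Ω} (hV : Monotone fun s => V s ω)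
    {f : ℝ → ℝ} (hf : ∀ a b, IntervalIntegrable f volume a b) {a b : ℝ} (ha : 0 ≤ a) (hab : a ≤ b)
    (δ : ℝ) {e : ℝ → ℝ} (he : ∀ s, e s = if V s.toNNReal ω ≤ t then 1 else 0) :
    (e a * ∫ r in (0 : ℝ)..δ, f (a + r)) - (e b * ∫ r in (0 : ℝ)..δ, f (b + r)) +
        ∫ s in Ioc a b, e s * (f (s + δ) - f s) =
      if V a.toNNReal ω ≤ t ∧ t < V b.toNNReal ω then
        ∫ r in (0 : ℝ)..δ, f ((inverseTime V t ω).toReal + r) else 0 := by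
  have hV' : ∀ {s u : ℝ}, s ≤ u → V s.toNNReal ω ≤ V u.toNNReal ω := fun h =>
    hV (Real.toNNReal_le_toNNReal h)
  -- Let `I(s)` be the integral of `f` over `[s, s + δ]`. As `e` is `1` before the passage and `0`
  -- after it, a passage between `a` and `b` gives the time integral `I(Z) - I(a)`, and `I(Z)`
  -- remains. If the level is not yet crossed at `b` the time integral is `I(b) - I(a)` and
  -- everything cancels; if it is already crossed at `a` all terms vanish.
  have hshift := intervalIntegral_shift_sub hf
  rcases lt_or_ge t (V b.toNNReal ω) with hb | hb
  · rcases lt_or_ge t (V a.toNNReal ω) with h | h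
    · rw [if_neg (fun h' => absurd h'.1 (not_le.2 h)), he a, he b, if_neg (not_le.2 h),
        if_neg (not_le.2 hb), zero_mul, zero_mul, sub_zero, zero_add]
      refine setIntegral_eq_zero_of_forall_eq_zero fun s hs => ?_
      rw [he, if_neg (not_le.2 (h.trans_le (hV' hs.1.le))), zero_mul]
    · rw [if_pos ⟨h, hb⟩, he a, he b, if_pos h, if_neg (not_le.2 hb), one_mul, zero_mul, sub_zero]
      have hTb := inverseTime_le hb
      have hTa := le_inverseTime hV h
      have hT : inverseTime V t ω ≠ ∞ := ne_top_of_le_ne_top ENNReal.coe_ne_top hTb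
      set Z := (inverseTime V t ω).toReal with hZ
      have haZ : a ≤ Z := by
        have := (ENNReal.toReal_le_toReal ENNReal.coe_ne_top hT).2 hTa
        rwa [ENNReal.coe_toReal, Real.coe_toNNReal _ ha] at this
      have hZb : Z ≤ b := by
        have := (ENNReal.toReal_le_toReal hT ENNReal.coe_ne_top).2 hTb
        rwa [ENNReal.coe_toReal, Real.coe_toNNReal _ (ha.trans hab)] at this
      have h1 : ∀ s, 0 ≤ s → s < Z → e s = 1 := fun s hs hsZ => by
        rw [he, if_pos]
        by_contra hlt
        have h2 := (ENNReal.toReal_le_toReal hT ENNReal.coe_ne_top).2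
          (inverseTime_le (not_le.1 hlt))
        rw [ENNReal.coe_toReal, Real.coe_toNNReal _ hs] at h2
        linarith
      have h0 : ∀ s, 0 ≤ s → Z < s → e s = 0 := fun s hs hsZ => by
        rw [he, if_neg (not_le.2 (lt_of_inverseTime_lt hV ?_))]
        rw [← ENNReal.toReal_lt_toReal hT ENNReal.coe_ne_top, ENNReal.coe_toReal,
          Real.coe_toNNReal _ hs]
        exact hsZ
      have h2 : ∫ s in Ioc a b, e s * (f (s + δ) - f s) =
          ∫ s in Ioc a Z, (f (s + δ) - f s) := by
        rw [← integral_indicator measurableSet_Ioc, ← integral_indicator measurableSet_Ioc]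
        refine integral_congr_ae ?_
        filter_upwards [Measure.ae_ne volume Z] with s hs
        by_cases hsa : a < s
        · rcases lt_or_gt_of_ne hs with hlt | hgt
          · rw [indicator_of_mem (show s ∈ Ioc a Z from ⟨hsa, hlt.le⟩),
              indicator_of_mem (show s ∈ Ioc a b from ⟨hsa, hlt.le.trans hZb⟩),
              h1 s (ha.trans hsa.le) hlt, one_mul]
          · rw [indicator_of_notMem (fun h' : s ∈ Ioc a Z => absurd h'.2 (not_le.2 hgt))]
            by_cases hsb : s ∈ Ioc a b
            · rw [indicator_of_mem hsb, h0 s (ha.trans hsa.le) hgt, zero_mul]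
            · rw [indicator_of_notMem hsb]
        · rw [indicator_of_notMem fun h' : s ∈ Ioc a Z => hsa h'.1,
            indicator_of_notMem fun h' : s ∈ Ioc a b => hsa h'.1]
      rw [h2, ← intervalIntegral.integral_of_le haZ, ← hshift]
      ring
  · have ha' := (hV' hab).trans hb
    rw [if_neg (fun h' => absurd h'.2 (not_lt.2 hb)), he a, he b, if_pos hb, if_pos ha', one_mul,
      one_mul,
      setIntegral_congr_fun (g := fun s => f (s + δ) - f s) measurableSet_Ioc fun s hs => ?_,
      ← intervalIntegral.integral_of_le hab, ← hshift]
    · ring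
    · dsimp only
      rw [he, if_pos ((hV' hs.2).trans hb), one_mul]

variable {E : Type*} [NormedAddCommGroup E] [MeasureSpace E]
  {ν : ℝ → ℝ → E → ℝ} {P : ℝ≥0 → Kernel (E × ℝ) (E × ℝ)} {Q : ℝ≥0 → Kernel E E}
  {G : ℝ → E → ℝ → E → ℝ → ℝ} {Ω : Type*} [MeasurableSpace Ω] {μ : Measure Ω}
  {z₀ : E × ℝ} {X : ℝ≥0 → Ω → E × ℝ}

/-- The average of `F` over `[s, s + δ]` along a path. -/
def pathAverage (X : ℝ≥0 → Ω → E × ℝ) (F : E → ℝ) (δ s : ℝ) (ω : Ω) : ℝ :=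
  δ⁻¹ * ∫ r in (0 : ℝ)..δ, F (X (s + r).toNNReal ω).1

lemma abs_pathAverage_le {Ω : Type*} {E : Type*} (X : ℝ≥0 → Ω → E × ℝ) {F : E → ℝ} {C : ℝ}
    (hC : ∀ y, |F y| ≤ C) {δ : ℝ} (hδ : 0 < δ) (s : ℝ) (ω : Ω) : |pathAverage X F δ s ω| ≤ C := by
  have h := intervalIntegral.norm_integral_le_of_norm_le_const (a := 0) (b := δ)
    (f := fun r => F (X (s + r).toNNReal ω).1) (C := C) fun r _ => hC _
  rw [sub_zero, abs_of_pos hδ, Real.norm_eq_abs] at h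
  rw [pathAverage, abs_mul, abs_of_pos (inv_pos.2 hδ), inv_mul_le_iff₀ hδ]
  linarith

lemma IsRegularProcess.integral_evolve (hP : IsTransitionFunction P)
    (hgen : HasGeneratorSum P Q ν) (hX : IsRegularProcess P z₀ X μ)
    {F : E → ℝ} (hF : Measurable F) {C : ℝ} (hC : ∀ y, |F y| ≤ C) {g : E × ℝ → ℝ}
    (hg : Measurable g) {s r : ℝ} (hs : 0 ≤ s) (hr : 0 ≤ r)
    (hgi : Integrable (fun ω => g (X s.toNNReal ω)) μ) :
    ∫ ω, g (X s.toNNReal ω) * evolve Q F r (X s.toNNReal ω).1 ∂μ =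
      ∫ ω, g (X s.toNNReal ω) * F (X (s + r).toNNReal ω).1 ∂μ := by
  rw [Real.toNNReal_add hs hr, hX.integral_pair hP s.toNNReal r.toNNReal hg hgi
    (g := fun z : E × ℝ => F z.1) (hF.comp measurable_fst) (fun z => hC z.1)]
  congr 1
  ext ω
  exact congrArg _ (hgen.integral_marginal _ _ hF).symm

variable [BorelSpace E]

lemma IsRegularProcess.measurable_pathAverage (hX : IsRegularProcess P z₀ X μ) {F : E → ℝ}
    (hF : Measurable F) {δ : ℝ} (hδ : 0 < δ) :
    Measurable fun p : ℝ × Ω => pathAverage X F δ p.1 p.2 := by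
  have h : Measurable fun q : (ℝ × Ω) × ℝ => F (X (q.1.1 + q.2).toNNReal q.1.2).1 :=
    hF.comp (hX.measurable_uncurry.comp (f := fun q : (ℝ × Ω) × ℝ => (q.1.1 + q.2, q.1.2))
      (by fun_prop)).fst
  refine Measurable.const_mul ?_ _
  simpa only [intervalIntegral.integral_of_le hδ.le] using
    (h.stronglyMeasurable.integral_prod_right' (ν := volume.restrict (Ioc 0 δ))).measurable

lemma IsRegularProcess.tendsto_pathAverage (hX : IsRegularProcess P z₀ X μ) {F : E → ℝ}
    (hF : Continuous F) {C : ℝ} (hC : ∀ y, |F y| ≤ C) (s : ℝ) (ω : Ω) :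
    Tendsto (fun n : ℕ => pathAverage X F (1 / ((n : ℝ) + 1)) s ω) atTop
      (𝓝 (F (X s.toNNReal ω).1)) := by
  have hm : Measurable fun r : ℝ => F (X r.toNNReal ω).1 :=
    hF.measurable.comp (hX.measurable_uncurry.comp (measurable_id.prodMk measurable_const)).fst
  refine tendsto_average_right hm (fun r => hC _) ?_
  have h1 : ContinuousWithinAt (fun u => F (X u ω).1) (Ici s.toNNReal) s.toNNReal :=
    (hF.continuousAt).comp_continuousWithinAt (hX.right ω _).fst
  exact h1.comp (f := Real.toNNReal) continuous_real_toNNReal.continuousWithinAt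
    fun u hu => Real.toNNReal_le_toNNReal hu

variable [IsProbabilityMeasure μ]

lemma IsRegularProcess.integral_evolveAverage (hP : IsTransitionFunction P)
    (hgen : HasGeneratorSum P Q ν) (hM : Measurable fun x : ℝ × (E × ℝ) => P x.1.toNNReal x.2)
    (hX : IsRegularProcess P z₀ X μ) {F : E → ℝ} (hF : Measurable F) {C : ℝ}
    (hC : ∀ y, |F y| ≤ C) {g : E × ℝ → ℝ} (hg : Measurable g) {s δ : ℝ} (hs : 0 ≤ s) (hδ : 0 < δ)
    (hgi : Integrable (fun ω => g (X s.toNNReal ω)) μ) :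
    ∫ ω, g (X s.toNNReal ω) * evolveAverage Q F δ (X s.toNNReal ω).1 ∂μ =
      ∫ ω, g (X s.toNNReal ω) * pathAverage X F δ s ω ∂μ := by
  have hQ : Measurable fun p : Ω × ℝ => evolve Q F p.2 (X s.toNNReal p.1).1 :=
    (hgen.measurable_evolve hM hF).comp (f := fun p : Ω × ℝ => (p.2, (X s.toNNReal p.1).1))
      (measurable_snd.prodMk ((hX.measurable _).comp measurable_fst).fst)
  have hY : Measurable fun p : Ω × ℝ => F (X (s + p.2).toNNReal p.1).1 :=
    hF.comp (hX.measurable_uncurry.comp (f := fun q : Ω × ℝ => (s + q.2, q.1)) (by fun_prop)).fst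
  simp only [evolveAverage, pathAverage, mul_left_comm _ δ⁻¹]
  rw [integral_const_mul, integral_const_mul,
    integral_mul_intervalIntegral hgi hQ (fun p => hgen.abs_evolve_le hP hC _ _),
    integral_mul_intervalIntegral hgi hY (fun p => hC _)]
  congr 1
  refine intervalIntegral.integral_congr fun r hr => ?_
  rw [uIcc_of_le hδ.le] at hr
  exact hX.integral_evolve hP hgen hF hC hg hs hr.1 hgi

variable [ProperSpace E] [IsFiniteMeasureOnCompacts (volume : Measure E)]
  [SFinite (volume : Measure E)]

/-- The event that the level `t` is crossed between the times `a` and `b`, as a function. -/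
def crossed (X : ℝ≥0 → Ω → E × ℝ) (t a b : ℝ) (ω : Ω) (x : ℝ) : ℝ :=
  if (X a.toNNReal ω).2 ≤ t ∧ t < (X b.toNNReal ω).2 then x else 0

/-- The passage formula for averaged functions. -/
lemma IsRegularProcess.passage_average (hP : IsTransitionFunction P) (hν : IsJumpDensity ν)
    (hgen : HasGeneratorSum P Q ν) (hG : IsContinuousTransitionDensity P G)
    (hX : IsRegularProcess P z₀ X μ) (t : ℝ) {a b : ℝ} (ha : 0 < a) (hab : a ≤ b) {F : E → ℝ}
    (hF : Measurable F) {C : ℝ} (hC : ∀ y, |F y| ≤ C) {δ : ℝ} (hδ : 0 < δ) :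
    AEStronglyMeasurable (fun ω => crossed X t a b ω
      (pathAverage X F δ (inverseTime (fun s ω => (X s ω).2) t ω).toReal ω)) μ ∧
    ∫ ω, crossed X t a b ω
        (pathAverage X F δ (inverseTime (fun s ω => (X s ω).2) t ω).toReal ω) ∂μ =
      ∫ p, belowRate ν t (X p.1.toNNReal p.2) * pathAverage X F δ p.1 p.2 ∂timeProd μ a b := by
  have hM := hG.measurable_apply hP
  have hXm := hX.measurable_uncurry
  have hFX : Measurable fun p : ℝ × Ω => F (X p.1.toNNReal p.2).1 := hF.comp hXm.fst
  have hA := hX.measurable_pathAverage hF hδ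
  have hb0 : 0 ≤ b := ha.le.trans hab
  -- The averaged evolution of `F` replaces `F`, which need not be in the domain. The Markov
  -- property then turns each term of the balance into a mean of values or averages of `F` along the
  -- path.
  have hmem := hgen.evolveAverage_mem_generator hP hM hF hC hδ
  have hbal := hX.balance hP hν hgen hG hmem t ha hab
  have hatm := measurable_atMost (E := E) t
  have heb : ∀ s, Integrable (fun ω => atMost E t (X s ω)) μ := fun s =>
    integrable_of_abs_le (hatm.comp (hX.measurable s)) fun ω => abs_atMost_le t _
  have hends : ∀ s, 0 ≤ s →
      ∫ ω, evolveAverage Q F δ (X s.toNNReal ω).1 * atMost E t (X s.toNNReal ω) ∂μ =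
        ∫ ω, atMost E t (X s.toNNReal ω) * pathAverage X F δ s ω ∂μ := fun s hs => by
    simp_rw [mul_comm (evolveAverage Q F δ _)]
    exact hX.integral_evolveAverage hP hgen hM hF hC hatm hs hδ (heb _)
  set D : ℝ × Ω → ℝ := fun p => atMost E t (X p.1.toNNReal p.2) *
    (F (X (p.1 + δ).toNNReal p.2).1 - F (X p.1.toNNReal p.2).1) with hD
  have hFδ : Measurable fun p : ℝ × Ω => F (X (p.1 + δ).toNNReal p.2).1 :=
    hFX.comp (f := fun p : ℝ × Ω => (p.1 + δ, p.2)) (by fun_prop)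
  have hDm : Measurable D := (hatm.comp hXm).mul (hFδ.sub hFX)
  have hDb : ∀ p, |D p| ≤ 2 * C := fun p => by
    change |atMost E t _ * (_ - _)| ≤ _
    rw [mul_comm (atMost E t _)]
    refine abs_mul_le_of_abs_le_one ((abs_sub _ _).trans ?_) (abs_atMost_le t _)
    linarith [hC (X (p.1 + δ).toNNReal p.2).1, hC (X p.1.toNNReal p.2).1]
  have hDi : Integrable D (timeProd μ a b) := integrable_of_abs_le hDm hDb
  have hEm : Measurable fun z : E × ℝ => evolve Q F δ z.1 :=
    (hgen.measurable_evolve hM hF).comp (measurable_const.prodMk measurable_fst)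
  have hmid : ∫ p, evolveQuotient Q F δ (X p.1.toNNReal p.2).1 * atMost E t (X p.1.toNNReal p.2)
      ∂timeProd μ a b = δ⁻¹ * ∫ p, D p ∂timeProd μ a b := by
    rw [integral_prod _ hDi, integral_prod, ← integral_const_mul]
    · refine setIntegral_congr_fun measurableSet_Ioc fun s hs => ?_
      have hs0 : 0 ≤ s := ha.le.trans hs.1.le
      have h1 : Integrable (fun ω => atMost E t (X s.toNNReal ω) *
          F (X (s + δ).toNNReal ω).1) μ :=
        (heb _).mul_bdd (hF.comp (hX.measurable _).fst).aestronglyMeasurable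
          (Eventually.of_forall fun ω => hC _)
      have h2 : Integrable (fun ω => atMost E t (X s.toNNReal ω) * F (X s.toNNReal ω).1) μ :=
        (heb _).mul_bdd (hF.comp (hX.measurable _).fst).aestronglyMeasurable
          (Eventually.of_forall fun ω => hC _)
      have h3 : Integrable (fun ω => atMost E t (X s.toNNReal ω) *
          evolve Q F δ (X s.toNNReal ω).1) μ :=
        (heb _).mul_bdd (hEm.comp (hX.measurable _)).aestronglyMeasurable
          (Eventually.of_forall fun ω => hgen.abs_evolve_le hP hC _ _)
      simp only [hD, mul_sub, evolveQuotient]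
      rw [integral_sub h1 h2, ← hX.integral_evolve hP hgen hF hC hatm hs0 hδ.le (heb _),
        ← integral_sub h3 h2, ← integral_const_mul]
      congr 1
      ext ω
      ring
    · refine integrable_of_abs_le (C := δ⁻¹ * (C + C)) ?_ fun p => ?_
      · exact (((hEm.comp hXm).sub hFX).const_mul _).mul (hatm.comp hXm)
      · refine abs_mul_le_of_abs_le_one ?_ (abs_atMost_le t _)
        rw [evolveQuotient, abs_mul, abs_of_pos (inv_pos.2 hδ)]
        gcongr
        exact (abs_sub _ _).trans (add_le_add (hgen.abs_evolve_le hP hC _ _) (hC _))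
  have hN := hX.integrable_belowRate hP hν hgen hM t ha.le hab
  have hEA : Measurable (evolveAverage Q F δ) := hgen.measurable_evolveAverage hM hF hδ
  obtain ⟨⟨-, C', hC'⟩, -⟩ := id hmem
  have hjump : ∫ p, evolveAverage Q F δ (X p.1.toNNReal p.2).1 *
      belowRate ν t (X p.1.toNNReal p.2) ∂timeProd μ a b =
      ∫ p, belowRate ν t (X p.1.toNNReal p.2) * pathAverage X F δ p.1 p.2 ∂timeProd μ a b := by
    simp_rw [mul_comm (evolveAverage Q F δ _)]
    rw [integral_prod, integral_prod]
    · refine integral_congr_ae ?_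
      filter_upwards [hN.prod_right_ae, ae_restrict_mem measurableSet_Ioc] with s hs hsab
      exact hX.integral_evolveAverage hP hgen hM hF hC (hν.measurable_belowRate t)
        (ha.le.trans hsab.1.le) hδ hs
    · exact hN.mul_bdd hA.aestronglyMeasurable
        (Eventually.of_forall fun p => abs_pathAverage_le X hC hδ _ _)
    · exact hN.mul_bdd (hEA.comp hXm.fst).aestronglyMeasurable
        (Eventually.of_forall fun p => hC' _)
  rw [hends a ha.le, hends b hb0, hmid, hjump] at hbal
  have hAb : ∀ s, Integrable (fun ω => atMost E t (X s.toNNReal ω) * pathAverage X F δ s ω) μ :=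
    fun s => (heb _).mul_bdd (hA.comp (measurable_const.prodMk measurable_id)).aestronglyMeasurable
      (Eventually.of_forall fun ω => abs_pathAverage_le X hC hδ _ _)
  have hDω : Integrable (fun ω => ∫ s in Ioc a b, D (s, ω)) μ := hDi.integral_prod_right
  -- Besides the value, this identity supplies the measurability at the random time `Z`, as its
  -- right-hand side is integrable.
  have hpath : ∀ ω, crossed X t a b ω
      (pathAverage X F δ (inverseTime (fun s ω => (X s ω).2) t ω).toReal ω) =
      atMost E t (X a.toNNReal ω) * pathAverage X F δ a ω -
        atMost E t (X b.toNNReal ω) * pathAverage X F δ b ω +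
          δ⁻¹ * ∫ s in Ioc a b, D (s, ω) := fun ω => by
    have hf : ∀ c d, IntervalIntegrable (fun r : ℝ => F (X r.toNNReal ω).1) volume c d :=
      intervalIntegrable_of_abs_le (hFX.comp (measurable_id.prodMk measurable_const))
        fun r => hC _
    have h := path_balance (t := t) (V := fun s ω => (X s ω).2) (ω := ω) (hX.mono ω) hf ha.le hab δ
      (e := fun s => atMost E t (X s.toNNReal ω)) fun s => by
        by_cases hs : X s.toNNReal ω ∈ {z : E × ℝ | z.2 ≤ t}
        · rw [atMost, indicator_of_mem hs, if_pos (show (X s.toNNReal ω).2 ≤ t from hs)]; rfl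
        · rw [atMost, indicator_of_notMem hs, if_neg (show ¬ (X s.toNNReal ω).2 ≤ t from hs)]
    have h' : crossed X t a b ω
        (pathAverage X F δ (inverseTime (fun s ω => (X s ω).2) t ω).toReal ω) =
        δ⁻¹ * crossed X t a b ω (∫ r in (0 : ℝ)..δ,
          F (X ((inverseTime (fun s ω => (X s ω).2) t ω).toReal + r).toNNReal ω).1) := by
      simp only [crossed, pathAverage, mul_ite, mul_zero]
    rw [h', crossed, ← h]
    simp only [pathAverage, hD]
    ring
  simp_rw [hpath]
  have hsub : Integrable (fun ω => atMost E t (X a.toNNReal ω) * pathAverage X F δ a ω -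
      atMost E t (X b.toNNReal ω) * pathAverage X F δ b ω) μ := (hAb a).sub (hAb b)
  refine ⟨(hsub.add (hDω.const_mul _)).aestronglyMeasurable, ?_⟩
  rw [integral_add hsub (hDω.const_mul _), integral_sub (hAb a) (hAb b),
    integral_const_mul, ← integral_prod_symm D hDi]
  linarith

/-- The passage formula. -/
lemma IsRegularProcess.passage (hP : IsTransitionFunction P) (hν : IsJumpDensity ν)
    (hgen : HasGeneratorSum P Q ν) (hG : IsContinuousTransitionDensity P G)
    (hX : IsRegularProcess P z₀ X μ) (t : ℝ) {a b : ℝ} (ha : 0 < a) (hab : a ≤ b) {F : E → ℝ}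
    (hF : Continuous F) {C : ℝ} (hC : ∀ y, |F y| ≤ C) :
    ∫ ω, crossed X t a b ω
        (F (X (inverseTime (fun s ω => (X s ω).2) t ω).toNNReal ω).1) ∂μ =
      ∫ p, belowRate ν t (X p.1.toNNReal p.2) * F (X p.1.toNNReal p.2).1 ∂timeProd μ a b := by
  have hN := hX.integrable_belowRate hP hν hgen (hG.measurable_apply hP) t ha.le hab
  have hδ : ∀ n : ℕ, 0 < 1 / ((n : ℝ) + 1) := fun n => by positivity
  have hC0 : 0 ≤ C := (abs_nonneg _).trans (hC 0)
  have h1 : Tendsto (fun n : ℕ => ∫ ω, crossed X t a b ω (pathAverage X F (1 / ((n : ℝ) + 1))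
      (inverseTime (fun s ω => (X s ω).2) t ω).toReal ω) ∂μ) atTop
      (𝓝 (∫ ω, crossed X t a b ω
        (F (X (inverseTime (fun s ω => (X s ω).2) t ω).toNNReal ω).1) ∂μ)) := by
    refine tendsto_integral_of_dominated_convergence (fun _ => C)
      (fun n => (hX.passage_average hP hν hgen hG t ha hab hF.measurable hC (hδ n)).1)
      (integrable_const _) (fun n => Eventually.of_forall fun ω => ?_)
      (Eventually.of_forall fun ω => ?_)
    · rw [crossed]
      split_ifs
      · exact abs_pathAverage_le X hC (hδ n) _ _
      · simpa using hC0
    · simp only [crossed]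
      split_ifs
      · have h := hX.tendsto_pathAverage hF hC (inverseTime (fun s ω => (X s ω).2) t ω).toReal ω
        rwa [ENNReal.toReal, Real.toNNReal_coe] at h
      · exact tendsto_const_nhds
  have h2 : Tendsto (fun n : ℕ => ∫ p, belowRate ν t (X p.1.toNNReal p.2) *
      pathAverage X F (1 / ((n : ℝ) + 1)) p.1 p.2 ∂timeProd μ a b) atTop
      (𝓝 (∫ p, belowRate ν t (X p.1.toNNReal p.2) * F (X p.1.toNNReal p.2).1 ∂timeProd μ a b)) := by
    refine tendsto_integral_of_dominated_convergence
      (fun p => belowRate ν t (X p.1.toNNReal p.2) * C) (fun n => ?_) (hN.mul_const C)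
      (fun n => Eventually.of_forall fun p => ?_) ?_
    · exact hN.aestronglyMeasurable.mul
        (hX.measurable_pathAverage hF.measurable (hδ n)).aestronglyMeasurable
    · rw [norm_mul, Real.norm_of_nonneg (hν.belowRate_nonneg t _)]
      exact mul_le_mul_of_nonneg_left (abs_pathAverage_le X hC (hδ n) _ _)
        (hν.belowRate_nonneg t _)
    · exact Eventually.of_forall fun p => (hX.tendsto_pathAverage hF hC p.1 p.2).const_mul _
  refine tendsto_nhds_unique h1 (h2.congr fun n => ?_)
  exact (hX.passage_average hP hν hgen hG t ha hab hF.measurable hC (hδ n)).2.symm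

end Passage

/-! ### The mass of the adjoint image above the level. -/

section Adjoint

variable {E : Type*} [MeasurableSpace E] {ν : ℝ → ℝ → E → ℝ}

lemma IsJumpDensity.integrable_jumpOp_step_mul (hν : IsJumpDensity ν) (p : E) {g : ℝ → ℝ}
    (hgi : Integrable g) {l : ℝ} (hl : 1 ≤ l) (c : ℝ) :
    Integrable fun v => jumpOp ν p (step l c) v * g v := by
  obtain ⟨M, hM0, hM1⟩ := hν.exists_jumpOp_step_le
  have hJm : Measurable fun v => jumpOp ν p (step l c) v :=
    (hν.measurable_jumpOp (continuous_step l c).measurable).comp (f := fun v : ℝ => (p, v))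
      (by fun_prop)
  have hJ0 : ∀ v, 0 ≤ jumpOp ν p (step l c) v := fun v =>
    hν.jumpOp_step_nonneg _ _ (zero_le_one.trans hl) _
  refine (hgi.norm.const_mul (M * l)).mono' (hJm.aestronglyMeasurable.mul hgi.aestronglyMeasurable)
    (Eventually.of_forall fun v => ?_)
  rw [norm_mul, Real.norm_of_nonneg (hJ0 v)]
  exact mul_le_mul_of_nonneg_right (hM1 _ _ _ _ hl) (norm_nonneg _)

/-- The absence of creeping for a single section of the density: a rate at most `η m` on a strip of
width `1/m`, where `g` is bounded. -/
lemma IsJumpDensity.tendsto_integral_above_mul (hν : IsJumpDensity ν) (p : E) (t : ℝ) {g : ℝ → ℝ}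
    (hgc : Continuous g) :
    Tendsto (fun m : ℕ => ∫ v, (Ici t).indicator (fun v => jumpOp ν p (step m t) v * g v) v) atTop
      (𝓝 0) := by
  have hJ0 : ∀ (m : ℕ) (c v : ℝ), 0 ≤ jumpOp ν p (step m c) v := fun m c v =>
    hν.jumpOp_step_nonneg _ _ m.cast_nonneg _
  obtain ⟨B, hB⟩ := (isCompact_Icc (a := t) (b := t + 1)).exists_bound_of_continuousOn
    hgc.continuousOn
  have hB0 : 0 ≤ B := (norm_nonneg _).trans (hB t (by simp))
  refine NormedAddGroup.tendsto_nhds_zero.2 fun ε hε => ?_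
  have hη : 0 < ε / (B + 1) := by positivity
  filter_upwards [hν.eventually_jumpOp_step_le p t hη, eventually_ge_atTop 1] with m hm hm1
  have hm1' : (1 : ℝ) ≤ m := by exact_mod_cast hm1
  have hm0 : (0 : ℝ) < m := by linarith
  have hle : ‖∫ v, (Ici t).indicator (fun v => jumpOp ν p (step m t) v * g v) v‖ ≤
      ∫ v, (Icc t (t + 1 / m)).indicator
      (fun _ => ε / (B + 1) * m * B) v := by
    refine norm_integral_le_of_norm_le ?_ (Eventually.of_forall fun v => ?_)
    · exact (integrableOn_const (by simp)).integrable_indicator measurableSet_Icc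
    · by_cases hv : v ∈ Icc t (t + 1 / m)
      · rw [indicator_of_mem hv]
        rw [indicator_of_mem (show v ∈ Ici t from hv.1), norm_mul, Real.norm_of_nonneg (hJ0 _ _ _)]
        refine mul_le_mul (hm v hv) (hB v ⟨hv.1, hv.2.trans ?_⟩) (norm_nonneg _) (by positivity)
        have := (div_le_one hm0).2 hm1'
        linarith
      · rw [indicator_of_notMem hv]
        by_cases hvt : v ∈ Ici t
        · have hv2 : t + 1 / m ≤ v := by
            by_contra hc
            exact hv ⟨hvt, (not_le.1 hc).le⟩
          have hv3 : 1 ≤ (m : ℝ) * (v - t) := by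
            have h1 : 1 / (m : ℝ) ≤ v - t := by linarith
            rwa [div_le_iff₀' hm0] at h1
          rw [indicator_of_mem hvt, jumpOp_step_eq_zero ν p hm0.le hv3, zero_mul, norm_zero]
        · rw [indicator_of_notMem hvt, norm_zero]
  refine hle.trans_lt ?_
  rw [integral_indicator measurableSet_Icc, setIntegral_const, measureReal_def, Real.volume_Icc,
    add_sub_cancel_left, ENNReal.toReal_ofReal (by positivity), smul_eq_mul]
  have h1 : 1 / (m : ℝ) * (ε / (B + 1) * m * B) = ε * (B / (B + 1)) := by
    field_simp
  rw [h1]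
  exact mul_lt_of_lt_one_right hε ((div_lt_one (by positivity)).2 (by linarith))

lemma IsJumpDensity.tendsto_integral_jumpOp_step_mul (hν : IsJumpDensity ν) (p : E) {t : ℝ}
    {g : ℝ → ℝ} (hg0 : ∀ v, 0 ≤ g v) (hgc : Continuous g) (hgi : Integrable g)
    (hr : Integrable fun v => belowRate ν t (p, v) * g v) :
    Tendsto (fun m : ℕ => ∫ v, jumpOp ν p (step m t) v * g v) atTop
      (𝓝 (∫ v, belowRate ν t (p, v) * g v)) := by
  have hbelow : Tendsto (fun m : ℕ => ∫ v, belowStep ν t m (p, v) * g v) atTop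
      (𝓝 (∫ v, belowRate ν t (p, v) * g v)) := by
    refine tendsto_integral_of_dominated_convergence (fun v => belowRate ν t (p, v) * g v)
      (fun m => ?_) hr (fun m => Eventually.of_forall fun v => ?_)
      (Eventually.of_forall fun v => (hν.tendsto_belowStep t _).mul_const _)
    · exact ((hν.measurable_belowStep t m).comp
        (measurable_const.prodMk measurable_id)).aestronglyMeasurable.mul hgc.aestronglyMeasurable
    · rw [Real.norm_of_nonneg (mul_nonneg (hν.belowStep_nonneg t m _) (hg0 v))]
      exact mul_le_mul_of_nonneg_right (hν.belowStep_le t m _) (hg0 v)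
  have hsum := hbelow.add (hν.tendsto_integral_above_mul p t hgc)
  rw [add_zero] at hsum
  refine hsum.congr' ?_
  filter_upwards [eventually_ge_atTop 1] with m hm
  have hJi := hν.integrable_jumpOp_step_mul p hgi (l := m) (by exact_mod_cast hm) t
  have hbi : Integrable fun v => belowStep ν t m (p, v) * g v := by
    refine hJi.mono' ?_ (Eventually.of_forall fun v => ?_)
    · exact ((hν.measurable_belowStep t m).comp
        (measurable_const.prodMk measurable_id)).aestronglyMeasurable.mul hgc.aestronglyMeasurable
    · rw [Real.norm_of_nonneg (mul_nonneg (hν.belowStep_nonneg t m _) (hg0 v))]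
      exact mul_le_mul_of_nonneg_right
        (indicator_le_self' (fun _ _ => hν.jumpOp_step_nonneg _ _ m.cast_nonneg t) _) (hg0 v)
  rw [← integral_add hbi (hJi.indicator measurableSet_Ici)]
  congr 1
  ext v
  simp only [belowStep]
  rcases lt_or_ge v t with hv | hv
  · rw [indicator_of_mem (show (p, v) ∈ {z : E × ℝ | z.2 < t} from hv),
      indicator_of_notMem (show v ∉ Ici t from not_le.2 hv), add_zero]
  · rw [indicator_of_notMem (show (p, v) ∉ {z : E × ℝ | z.2 < t} from not_lt.2 hv),
      indicator_of_mem (show v ∈ Ici t from hv), zero_mul, zero_add]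

/-- The mass that the adjoint puts above the level `t` is the rate of crossings of `t`. -/
lemma IsAdjointImage.integral_Ioi (hν : IsJumpDensity ν) {p : E} {g h : ℝ → ℝ}
    (hh : IsAdjointImage ν p g h) {t : ℝ} (hht : IntegrableOn h (Ioi t)) (hg0 : ∀ v, 0 ≤ g v)
    (hgc : Continuous g) (hgi : Integrable g)
    (hr : Integrable fun v => belowRate ν t (p, v) * g v) :
    ∫ v in Ioi t, h v = ∫ v, belowRate ν t (p, v) * g v := by
  obtain ⟨M, hM0, hM1⟩ := hν.exists_jumpOp_step_le
  -- The first step tends to the indicator of `(t, ∞)`. The second makes the support compact; its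
  -- threshold moves to infinity, so that its image under the jump operator tends boundedly to zero.
  set φ : ℕ → ℝ → ℝ := fun m v => step m t v - step 1 m v with hφ
  have hleft : Tendsto (fun m => ∫ v, φ m v * h v) atTop (𝓝 (∫ v in Ioi t, h v)) := by
    have h1 : Tendsto (fun m => ∫ v in Ioi t, φ m v * h v) atTop (𝓝 (∫ v in Ioi t, h v)) := by
      refine tendsto_integral_of_dominated_convergence (fun v => ‖h v‖) (fun m => ?_) hht.norm
        (fun m => Eventually.of_forall fun v => ?_) ?_
      · exact ((continuous_step _ _).sub (continuous_step _ _)).aestronglyMeasurable.mul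
          hht.aestronglyMeasurable
      · rw [norm_mul]
        refine mul_le_of_le_one_left (norm_nonneg _) (abs_le.2 ⟨?_, ?_⟩)
        · linarith [step_nonneg m t v, step_le_one 1 m v]
        · linarith [step_le_one m t v, step_nonneg 1 m v]
      · filter_upwards [ae_restrict_mem measurableSet_Ioi] with v hv
        obtain ⟨n, hn⟩ := exists_nat_ge v
        refine tendsto_const_nhds.congr' ?_
        filter_upwards [tendsto_step_nat hv, eventually_ge_atTop n] with m hm hnm
        have : (n : ℝ) ≤ m := by exact_mod_cast hnm
        simp only [hφ]
        rw [hm, step_eq_zero zero_le_one (hn.trans this), sub_zero, one_mul]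
    obtain ⟨n, hn⟩ := exists_nat_ge t
    refine h1.congr' ?_
    filter_upwards [eventually_ge_atTop n] with m hm
    have hnm : (n : ℝ) ≤ m := by exact_mod_cast hm
    refine setIntegral_eq_integral_of_forall_compl_eq_zero fun v hv => ?_
    have hvt : v ≤ t := not_lt.1 hv
    simp only [hφ]
    rw [step_eq_zero m.cast_nonneg hvt, step_eq_zero zero_le_one (hvt.trans (hn.trans hnm)),
      sub_zero, zero_mul]
  have hfar : Tendsto (fun m : ℕ => ∫ v, jumpOp ν p (step 1 m) v * g v) atTop (𝓝 0) := by
    rw [← integral_zero ℝ ℝ (μ := volume)]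
    refine tendsto_integral_of_dominated_convergence (fun v => M * g v)
      (fun m => (hν.integrable_jumpOp_step_mul p hgi le_rfl m).aestronglyMeasurable)
      (hgi.const_mul M)
      (fun m => Eventually.of_forall fun v => ?_) (Eventually.of_forall fun v => ?_)
    · rw [Real.norm_of_nonneg (mul_nonneg (hν.jumpOp_step_nonneg _ _ zero_le_one _) (hg0 v))]
      have := hM1 1 m v p le_rfl
      rw [mul_one] at this
      exact mul_le_mul_of_nonneg_right this (hg0 v)
    · simpa using (hν.tendsto_jumpOp_step_threshold p v).mul_const (g v)
  have hright := (hν.tendsto_integral_jumpOp_step_mul p hg0 hgc hgi hr).sub hfar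
  rw [sub_zero] at hright
  refine tendsto_nhds_unique (hleft.congr' ?_) hright
  filter_upwards [eventually_ge_atTop 1] with m hm
  have hm1 : (1 : ℝ) ≤ m := by exact_mod_cast hm
  rw [hh.pairing _ (isTestFunction_step_sub (by linarith) one_pos),
    ← integral_sub (hν.integrable_jumpOp_step_mul p hgi hm1 t)
      (hν.integrable_jumpOp_step_mul p hgi le_rfl m)]
  congr 1
  ext v
  rw [hν.jumpOp_step_sub p hm1 le_rfl, sub_mul]

end Adjoint

/-! ### The event that the passage time lies in a given interval. -/

section Crossing

variable {E : Type*} [NormedAddCommGroup E] [MeasureSpace E] [BorelSpace E]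
  {P : ℝ≥0 → Kernel (E × ℝ) (E × ℝ)} {ν : ℝ → ℝ → E → ℝ} {Q : ℝ≥0 → Kernel E E}
  {G : ℝ → E → ℝ → E → ℝ → ℝ} {Ω : Type*} [MeasurableSpace Ω] {μ : Measure Ω}
  {z₀ : E × ℝ} {X : ℝ≥0 → Ω → E × ℝ}

/-- A level that is exceeded at a given time has almost surely been exceeded before. -/
lemma IsRegularProcess.ae_exists_lt (hP : IsTransitionFunction P)
    (hG : IsContinuousTransitionDensity P G) (hX : IsRegularProcess P z₀ X μ) (t : ℝ) {a : ℝ}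
    (ha : 0 < a) :
    ∀ᵐ ω ∂μ, t < (X a.toNNReal ω).2 → ∃ r : ℝ, r < a ∧ t < (X r.toNNReal ω).2 := by
  have hB : MeasurableSet {z : E × ℝ | z.2 ≤ t} := measurableSet_le measurable_snd measurable_const
  set N : Set Ω := {ω | ¬ (t < (X a.toNNReal ω).2 → ∃ r : ℝ, r < a ∧ t < (X r.toNNReal ω).2)}
    with hN
  have hlaw : ∀ s, P s z₀ {z : E × ℝ | z.2 ≤ t} = μ {ω | (X s ω).2 ≤ t} := fun s => by
    rw [← hX.map_eq hP, Measure.map_apply (hX.measurable s) hB]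
    rfl
  -- For `r < a` the disjoint sets `N` and `{V_a ≤ t}` both lie in `{V_r ≤ t}`, whose mass tends to
  -- that of `{V_a ≤ t}` as `r ↑ a`. Measurability is needed only for `{V_a ≤ t}`, not for `N`.
  have hle : ∀ r, r < a → μ N + P a.toNNReal z₀ {z : E × ℝ | z.2 ≤ t} ≤
      P r.toNNReal z₀ {z : E × ℝ | z.2 ≤ t} := fun r hr => by
    rw [hlaw, hlaw, ← measure_union _
      (show MeasurableSet {ω | (X a.toNNReal ω).2 ≤ t} from hX.measurable _ hB)]
    · refine measure_mono fun ω hω => ?_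
      rcases hω with hω | hω
      · simp only [hN, mem_ofPred_eq, Classical.not_imp, not_exists, not_and, not_lt] at hω
        exact hω.2 r hr
      · exact (hX.mono ω (Real.toNNReal_le_toNNReal hr.le)).trans hω
    · refine disjoint_left.2 fun ω hω hω' => ?_
      simp only [hN, mem_ofPred_eq, Classical.not_imp] at hω
      exact absurd hω' (not_le.2 hω.1)
  have hlim : Tendsto (fun r : ℝ => P r.toNNReal z₀ {z : E × ℝ | z.2 ≤ t}) (𝓝[<] a)
      (𝓝 (P a.toNNReal z₀ {z : E × ℝ | z.2 ≤ t})) :=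
    ((hG.continuousOn_apply hP z₀ hB).continuousAt (Ioi_mem_nhds ha)).tendsto.mono_left
      nhdsWithin_le_nhds
  have h := ge_of_tendsto hlim (eventually_nhdsWithin_of_forall hle)
  have := hP.markov
  change μ N = 0
  by_contra h0
  exact absurd h (not_le.2 (by
    rw [add_comm]
    exact ENNReal.lt_add_right (measure_ne_top _ _) h0))

variable [SFinite (volume : Measure E)]

/-- The passage time lies in `[a, b]` exactly if the level is crossed between `a` and `b`. -/
lemma IsRegularProcess.ae_inverseTime_mem_iff (hP : IsTransitionFunction P)
    (hG : IsContinuousTransitionDensity P G) (hX : IsRegularProcess P z₀ X μ) (t : ℝ) {a b : ℝ}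
    (ha : 0 < a) (hab : a ≤ b) :
    ∀ᵐ ω ∂μ, inverseTime (fun s ω => (X s ω).2) t ω ∈ Icc (ENNReal.ofReal a) (ENNReal.ofReal b) ↔
      (X a.toNNReal ω).2 ≤ t ∧ t < (X b.toNNReal ω).2 := by
  filter_upwards [hX.ae_exists_lt hP hG t ha, hX.ae_ne hP hG t (ha.trans_le hab)] with ω h1 h2
  -- Only the endpoints matter. `Z = a` with `V_a > t` is excluded since the level would have been
  -- exceeded earlier; `Z = b` with `V_b ≤ t` is excluded since then `V_b < t`, and right-continuity
  -- gives `Z > b`.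
  refine ⟨fun h => ⟨?_, ?_⟩, fun h => ⟨le_inverseTime (hX.mono ω) h.1, inverseTime_le h.2⟩⟩
  · by_contra hlt
    obtain ⟨r, hra, hr⟩ := h1 (not_le.1 hlt)
    have h3 : a.toNNReal ≤ r.toNNReal :=
      ENNReal.coe_le_coe.1 (h.1.trans (inverseTime_le (V := fun s ω => (X s ω).2) hr))
    exact absurd h3 (not_le.2 ((Real.toNNReal_lt_toNNReal_iff ha).2 hra))
  · by_contra hle
    have hlt : (X b.toNNReal ω).2 < t := lt_of_le_of_ne (not_lt.1 hle) h2
    have h3 : ∀ᶠ u in 𝓝[>] b.toNNReal, (X u ω).2 < t :=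
      ((hX.right ω b.toNNReal).snd.mono Ioi_subset_Ici_self).eventually_lt_const hlt
    obtain ⟨u, hu, hbu⟩ := (h3.and self_mem_nhdsWithin).exists
    have h4 : u ≤ b.toNNReal :=
      ENNReal.coe_le_coe.1
        ((le_inverseTime (V := fun s ω => (X s ω).2) (hX.mono ω) hu.le).trans h.2)
    exact absurd h4 (not_le.2 hbu)

variable [ProperSpace E] [IsFiniteMeasureOnCompacts (volume : Measure E)] [IsProbabilityMeasure μ]

lemma IsRegularProcess.subordinatedExpectation_eq (hP : IsTransitionFunction P)
    (hν : IsJumpDensity ν) (hgen : HasGeneratorSum P Q ν)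
    (hG : IsContinuousTransitionDensity P G) (hX : IsRegularProcess P z₀ X μ)
    {Y : ℝ≥0 → Ω → E} {V : ℝ≥0 → Ω → ℝ} (hYV : ∀ᵐ ω ∂μ, ∀ s, X s ω = (Y s ω, V s ω)) (t : ℝ)
    {K : ℝ} (hK : 1 ≤ K) {F : E → ℝ} (hF : Continuous F) {C : ℝ} (hC : ∀ y, |F y| ≤ C) :
    subordinatedExpectation μ Y V t K F =
      ∫ p, belowRate ν t (X p.1.toNNReal p.2) * F (X p.1.toNNReal p.2).1
        ∂timeProd μ (1 / K) K := by
  have hK0 : 0 < K := by linarith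
  have ha : 0 < 1 / K := by positivity
  have hab : 1 / K ≤ K := ((div_le_one hK0).2 hK).trans hK
  rw [← hX.passage hP hν hgen hG t ha hab hF hC, subordinatedExpectation]
  refine integral_congr_ae ?_
  filter_upwards [hYV, hX.ae_inverseTime_mem_iff hP hG t ha hab] with ω h1 h2
  have hV : inverseTime V t ω = inverseTime (fun s ω => (X s ω).2) t ω := by
    simp only [inverseTime, h1]
  by_cases h : inverseTime V t ω ∈ Icc (ENNReal.ofReal (1 / K)) (ENNReal.ofReal K)
  · rw [indicator_of_mem (by exact h), crossed, if_pos (h2.1 (hV ▸ h)), hV, h1]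
  · rw [indicator_of_notMem (by exact h), crossed, if_neg (fun h' => h (hV ▸ h2.2 h'))]

end Crossing

/-! ### The formulas in terms of the transition density. -/

section SpaceTime

variable {E : Type*} [NormedAddCommGroup E] [MeasureSpace E]
  {P : ℝ≥0 → Kernel (E × ℝ) (E × ℝ)} {ν : ℝ → ℝ → E → ℝ} {Q : ℝ≥0 → Kernel E E}
  {G : ℝ → E → ℝ → E → ℝ → ℝ} {Ω : Type*} [MeasurableSpace Ω] {μ : Measure Ω}
  {z₀ : E × ℝ} {X : ℝ≥0 → Ω → E × ℝ} {a b : ℝ}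

/-- The transition density as a function of `(y, s, v)`, set to zero for `s ≤ 0`. -/
def spaceTimeDensity (G : ℝ → E → ℝ → E → ℝ → ℝ) (z₀ : E × ℝ) : E × ℝ × ℝ → ℝ :=
  {q | 0 < q.2.1}.indicator fun q => G q.2.1 z₀.1 z₀.2 q.1 q.2.2

lemma spaceTimeDensity_of_pos {E : Type*} (G : ℝ → E → ℝ → E → ℝ → ℝ) (z₀ : E × ℝ) {s : ℝ}
    (hs : 0 < s) (y : E) (v : ℝ) : spaceTimeDensity G z₀ (y, s, v) = G s z₀.1 z₀.2 y v :=
  indicator_of_mem (show (y, s, v) ∈ {q : E × ℝ × ℝ | 0 < q.2.1} from hs) _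

lemma IsContinuousTransitionDensity.spaceTimeDensity_nonneg
    (hG : IsContinuousTransitionDensity P G) (z₀ : E × ℝ) (q : E × ℝ × ℝ) :
    0 ≤ spaceTimeDensity G z₀ q :=
  indicator_nonneg (fun _ hq => hG.nonneg _ _ _ _ _ hq) q

/-- Lebesgue measure on the `(y, s, v)` with `a < s ≤ b`. -/
abbrev spaceTime (E : Type*) [MeasureSpace E] (a b : ℝ) : Measure (E × ℝ × ℝ) :=
  volume.prod ((volume.restrict (Ioc a b)).prod volume)

lemma ae_spaceTime_pos {E : Type*} [MeasureSpace E] (ha : 0 ≤ a) :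
    ∀ᵐ q ∂spaceTime E a b, 0 < q.2.1 := by
  refine Measure.quasiMeasurePreserving_snd.ae (p := fun z : ℝ × ℝ => 0 < z.1)
    (Measure.quasiMeasurePreserving_fst.ae (p := fun s : ℝ => 0 < s) ?_)
  filter_upwards [ae_restrict_mem measurableSet_Ioc] with s hs using ha.trans_lt hs.1

lemma IsContinuousTransitionDensity.measurable_spaceTimeDensity
    (hG : IsContinuousTransitionDensity P G) [BorelSpace E] [ProperSpace E] (z₀ : E × ℝ) :
    Measurable (spaceTimeDensity G z₀) := by
  rw [spaceTimeDensity, ← piecewise_eq_indicator]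
  refine ContinuousOn.measurable_piecewise ?_ continuousOn_const
    (measurableSet_lt measurable_const measurable_snd.fst)
  exact (hG.continuous z₀.1 z₀.2).comp (f := fun q : E × ℝ × ℝ => (q.2.1, q.1, q.2.2))
    (by fun_prop) fun q hq => ⟨hq, mem_univ _⟩

variable [BorelSpace E]

lemma IsRegularProcess.measurable_spaceTime (hX : IsRegularProcess P z₀ X μ) :
    Measurable fun p : ℝ × Ω => ((X p.1.toNNReal p.2).1, p.1, (X p.1.toNNReal p.2).2) :=
  hX.measurable_uncurry.fst.prodMk (measurable_fst.prodMk hX.measurable_uncurry.snd)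

variable [ProperSpace E] [SFinite (volume : Measure E)] [IsProbabilityMeasure μ]

lemma IsRegularProcess.lintegral_spaceTime (hP : IsTransitionFunction P)
    (hG : IsContinuousTransitionDensity P G) (hX : IsRegularProcess P z₀ X μ) (ha : 0 ≤ a)
    {H : E × ℝ × ℝ → ℝ≥0∞} (hH : Measurable H) :
    ∫⁻ p, H ((X p.1.toNNReal p.2).1, p.1, (X p.1.toNNReal p.2).2) ∂timeProd μ a b =
      ∫⁻ q, ENNReal.ofReal (spaceTimeDensity G z₀ q) * H q ∂spaceTime E a b := by
  have hD := (hG.measurable_spaceTimeDensity z₀).ennreal_ofReal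
  have hDH : Measurable fun q => ENNReal.ofReal (spaceTimeDensity G z₀ q) * H q := hD.mul hH
  have hDH' : Measurable fun x : (ℝ × E) × ℝ =>
      ENNReal.ofReal (spaceTimeDensity G z₀ (x.1.2, x.1.1, x.2)) * H (x.1.2, x.1.1, x.2) :=
    hDH.comp (f := fun x : (ℝ × E) × ℝ => (x.1.2, x.1.1, x.2)) (by fun_prop)
  calc _ = ∫⁻ s in Ioc a b, ∫⁻ y, ∫⁻ v,
        ENNReal.ofReal (spaceTimeDensity G z₀ (y, s, v)) * H (y, s, v) := by
        refine (lintegral_prod _ (hH.comp hX.measurable_spaceTime).aemeasurable).trans ?_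
        refine setLIntegral_congr_fun measurableSet_Ioc fun s hs => ?_
        have hs0 : 0 < s := ha.trans_lt hs.1
        have h1 : Measurable fun x : E × ℝ => H (x.1, s, x.2) := by fun_prop
        have h2 : Measurable fun x : E × ℝ => ENNReal.ofReal (G s z₀.1 z₀.2 x.1 x.2) :=
          (hG.measurable z₀.1 z₀.2 hs0).ennreal_ofReal
        simp only [Function.comp_apply, spaceTimeDensity_of_pos G z₀ hs0]
        rw [← lintegral_map (μ := μ) h1 (hX.measurable s.toNNReal), hX.map_eq hP, hG.apply hs0,
          lintegral_withDensity_eq_lintegral_mul _ h2 h1, Measure.volume_eq_prod,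
          lintegral_prod _ (h2.mul h1).aemeasurable]
        rfl
    _ = ∫⁻ y, ∫⁻ s in Ioc a b, ∫⁻ v,
        ENNReal.ofReal (spaceTimeDensity G z₀ (y, s, v)) * H (y, s, v) :=
        lintegral_lintegral_swap hDH'.lintegral_prod_right'.aemeasurable
    _ = _ := by
        rw [lintegral_prod _ hDH.aemeasurable]
        refine lintegral_congr fun y => ?_
        exact (lintegral_prod _ (hDH.comp measurable_prodMk_left).aemeasurable).symm

/-- The law of the process at a time chosen in `(a, b]`. -/
lemma IsRegularProcess.map_spaceTime (hP : IsTransitionFunction P)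
    (hG : IsContinuousTransitionDensity P G) (hX : IsRegularProcess P z₀ X μ) (ha : 0 ≤ a) :
    (timeProd μ a b).map (fun p => ((X p.1.toNNReal p.2).1, p.1, (X p.1.toNNReal p.2).2)) =
      (spaceTime E a b).withDensity fun q => ENNReal.ofReal (spaceTimeDensity G z₀ q) := by
  have hD := (hG.measurable_spaceTimeDensity z₀).ennreal_ofReal
  refine Measure.ext_of_lintegral _ fun H hH => ?_
  rw [lintegral_map hH hX.measurable_spaceTime, hX.lintegral_spaceTime hP hG ha hH,
    lintegral_withDensity_eq_lintegral_mul _ hD hH]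
  rfl

lemma IsRegularProcess.integrable_spaceTime_iff (hP : IsTransitionFunction P)
    (hG : IsContinuousTransitionDensity P G) (hX : IsRegularProcess P z₀ X μ) (ha : 0 ≤ a)
    {f : E × ℝ × ℝ → ℝ} (hf : Measurable f) :
    Integrable (fun p => f ((X p.1.toNNReal p.2).1, p.1, (X p.1.toNNReal p.2).2))
        (timeProd μ a b) ↔
      Integrable (fun q => spaceTimeDensity G z₀ q * f q) (spaceTime E a b) := by
  have hD := (hG.measurable_spaceTimeDensity z₀).ennreal_ofReal
  have h := integrable_map_measure (μ := timeProd μ a b) hf.aestronglyMeasurable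
    (f := fun p : ℝ × Ω => ((X p.1.toNNReal p.2).1, p.1, (X p.1.toNNReal p.2).2))
    hX.measurable_spaceTime.aemeasurable
  rw [hX.map_spaceTime hP hG ha, integrable_withDensity_iff_integrable_smul' hD
    (Eventually.of_forall fun q => ENNReal.ofReal_lt_top)] at h
  simp only [ENNReal.toReal_ofReal (hG.spaceTimeDensity_nonneg z₀ _), smul_eq_mul] at h
  exact h.symm

lemma IsRegularProcess.integral_spaceTime (hP : IsTransitionFunction P)
    (hG : IsContinuousTransitionDensity P G) (hX : IsRegularProcess P z₀ X μ) (ha : 0 ≤ a)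
    {f : E × ℝ × ℝ → ℝ} (hf : Measurable f) :
    ∫ p, f ((X p.1.toNNReal p.2).1, p.1, (X p.1.toNNReal p.2).2) ∂timeProd μ a b =
      ∫ q, spaceTimeDensity G z₀ q * f q ∂spaceTime E a b := by
  have hD := (hG.measurable_spaceTimeDensity z₀).ennreal_ofReal
  rw [← integral_map (φ := fun p : ℝ × Ω => ((X p.1.toNNReal p.2).1, p.1, (X p.1.toNNReal p.2).2))
    hX.measurable_spaceTime.aemeasurable hf.aestronglyMeasurable, hX.map_spaceTime hP hG ha,
    integral_withDensity_eq_integral_toReal_smul hD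
      (Eventually.of_forall fun q => ENNReal.ofReal_lt_top)]
  simp only [ENNReal.toReal_ofReal (hG.spaceTimeDensity_nonneg z₀ _), smul_eq_mul]

/-- No mass lies below the starting level. -/
lemma IsRegularProcess.ae_spaceTimeDensity_eq_zero (hP : IsTransitionFunction P)
    (hG : IsContinuousTransitionDensity P G) (hX : IsRegularProcess P z₀ X μ) (ha : 0 < a) :
    ∀ᵐ q ∂spaceTime E a b, q.2.2 ≤ z₀.2 → spaceTimeDensity G z₀ q = 0 := by
  have hS : MeasurableSet {q : E × ℝ × ℝ | q.2.2 ≤ z₀.2} :=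
    measurableSet_le measurable_snd.snd measurable_const
  have hH : Measurable ({q : E × ℝ × ℝ | q.2.2 ≤ z₀.2}.indicator (1 : E × ℝ × ℝ → ℝ≥0∞)) :=
    measurable_one.indicator hS
  have h := hX.lintegral_spaceTime hP hG (b := b) ha.le hH
  have h0 : ∫⁻ p, {q : E × ℝ × ℝ | q.2.2 ≤ z₀.2}.indicator (1 : E × ℝ × ℝ → ℝ≥0∞)
      ((X p.1.toNNReal p.2).1, p.1, (X p.1.toNNReal p.2).2) ∂timeProd μ a b = 0 := by
    rw [← lintegral_zero (μ := timeProd μ a b)]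
    refine lintegral_congr_ae ?_
    filter_upwards [hX.ae_timeProd_ne hP hG z₀.2 (b := b) ha] with p hp
    have hle : z₀.2 ≤ (X p.1.toNNReal p.2).2 := by
      have := hX.mono p.2 (zero_le (a := p.1.toNNReal))
      simpa only [hX.initial] using this
    rw [indicator_of_notMem (show ((X p.1.toNNReal p.2).1, p.1, (X p.1.toNNReal p.2).2) ∉
      {q : E × ℝ × ℝ | q.2.2 ≤ z₀.2} from not_le.2 (lt_of_le_of_ne hle hp.symm))]
  rw [h0] at h
  filter_upwards [(lintegral_eq_zero_iff
    ((hG.measurable_spaceTimeDensity z₀).ennreal_ofReal.mul hH)).1 h.symm] with q hq hle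
  rw [Pi.mul_apply, Pi.zero_apply,
    indicator_of_mem (show q ∈ {q : E × ℝ × ℝ | q.2.2 ≤ z₀.2} from hle),
    Pi.one_apply, mul_one, ENNReal.ofReal_eq_zero] at hq
  exact le_antisymm hq (hG.spaceTimeDensity_nonneg z₀ q)

/-- The density of crossings of `t` at `(y, s)` from the state `v`. -/
def crossingDensity (ν : ℝ → ℝ → E → ℝ) (G : ℝ → E → ℝ → E → ℝ → ℝ) (t : ℝ) (z₀ : E × ℝ)
    (q : E × ℝ × ℝ) : ℝ :=
  belowRate ν t (q.1, q.2.2) * spaceTimeDensity G z₀ q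

variable {t : ℝ}

lemma IsRegularProcess.integrable_crossingDensity (hP : IsTransitionFunction P)
    (hν : IsJumpDensity ν) (hgen : HasGeneratorSum P Q ν) (hG : IsContinuousTransitionDensity P G)
    (hX : IsRegularProcess P z₀ X μ) (ha : 0 ≤ a) (hab : a ≤ b) :
    Integrable (crossingDensity ν G t z₀) (spaceTime E a b) := by
  have h := (hX.integrable_spaceTime_iff hP hG ha (f := fun q => belowRate ν t (q.1, q.2.2))
    ((hν.measurable_belowRate t).comp (by fun_prop))).1
    (hX.integrable_belowRate hP hν hgen (hG.measurable_apply hP) t ha hab)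
  exact h.congr (Eventually.of_forall fun q => mul_comm _ _)

lemma IsRegularProcess.integral_belowRate_mul (hP : IsTransitionFunction P)
    (hν : IsJumpDensity ν) (hG : IsContinuousTransitionDensity P G)
    (hX : IsRegularProcess P z₀ X μ) (ha : 0 ≤ a) {F : E → ℝ} (hF : Measurable F) :
    ∫ p, belowRate ν t (X p.1.toNNReal p.2) * F (X p.1.toNNReal p.2).1 ∂timeProd μ a b =
      ∫ q, crossingDensity ν G t z₀ q * F q.1 ∂spaceTime E a b := by
  have hf : Measurable fun q : E × ℝ × ℝ => belowRate ν t (q.1, q.2.2) * F q.1 :=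
    ((hν.measurable_belowRate t).comp (by fun_prop)).mul (hF.comp measurable_fst)
  refine (hX.integral_spaceTime hP hG ha hf).trans (integral_congr_ae ?_)
  refine Eventually.of_forall fun q => ?_
  simp only [crossingDensity]
  ring

/-- Almost all sections of the transition density are integrable. -/
lemma IsRegularProcess.ae_integrable_density (hP : IsTransitionFunction P)
    (hG : IsContinuousTransitionDensity P G) (hX : IsRegularProcess P z₀ X μ) (ha : 0 ≤ a) :
    ∀ᵐ z ∂(volume : Measure E).prod (volume.restrict (Ioc a b)),
      Integrable fun v => spaceTimeDensity G z₀ (z.1, z.2, v) := by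
  have h := (hX.integrable_spaceTime_iff hP hG (b := b) ha (f := fun _ => 1) measurable_const).1
    (integrable_const _)
  simp only [mul_one] at h
  exact ((measurePreserving_prodAssoc _ _ _).integrable_comp_of_integrable h).prod_right_ae

/-- The formula with the adjoint operator. -/
lemma IsRegularProcess.integral_adjoint (hP : IsTransitionFunction P)
    (hν : IsJumpDensity ν) (hgen : HasGeneratorSum P Q ν) (hG : IsContinuousTransitionDensity P G)
    (hX : IsRegularProcess P z₀ X μ) (ha : 0 ≤ a) (hab : a ≤ b) {F : E → ℝ} (hF : Measurable F)
    {C : ℝ} (hC : ∀ y, |F y| ≤ C) {AG : ℝ → E → ℝ → ℝ}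
    (hAG : ∀ᵐ z ∂(volume : Measure E).prod (volume.restrict (Ioc a b)),
      IsAdjointImage ν z.1 (G z.2 z₀.1 z₀.2 z.1) (AG z.2 z.1) ∧
        IntegrableOn (AG z.2 z.1) (Ioi t)) :
    Integrable (fun z : E × ℝ => ∫ v in Ioi t, AG z.2 z.1 v * F z.1)
      ((volume : Measure E).prod (volume.restrict (Ioc a b))) ∧
    ∫ q, crossingDensity ν G t z₀ q * F q.1 ∂spaceTime E a b =
      ∫ y, ∫ s in Ioc a b, ∫ v in Ioi t, AG s y v * F y := by
  have hassoc := measurePreserving_prodAssoc (volume : Measure E) (volume.restrict (Ioc a b))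
    (volume : Measure ℝ)
  have hi := hX.integrable_crossingDensity (t := t) hP hν hgen hG ha hab
  have hiF : Integrable (fun q => crossingDensity ν G t z₀ q * F q.1) (spaceTime E a b) :=
    hi.mul_bdd (hF.comp measurable_fst).aestronglyMeasurable (Eventually.of_forall fun q => hC _)
  have hi' := hassoc.integrable_comp_of_integrable hi
  have hiF' := hassoc.integrable_comp_of_integrable hiF
  have hpos : ∀ᵐ z ∂(volume : Measure E).prod (volume.restrict (Ioc a b)), 0 < z.2 := by
    refine Measure.quasiMeasurePreserving_snd.ae (p := fun s : ℝ => 0 < s) ?_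
    filter_upwards [ae_restrict_mem measurableSet_Ioc] with s hs using ha.trans_lt hs.1
  -- Almost every section satisfies the hypotheses of `integral_Ioi`. By Fubini, the integrability
  -- of the adjoint side in `(y, s)` is then inherited from the crossing density.
  have hae : (fun z : E × ℝ => ∫ v, crossingDensity ν G t z₀ (z.1, z.2, v) * F z.1)
      =ᵐ[(volume : Measure E).prod (volume.restrict (Ioc a b))]
        fun z => ∫ v in Ioi t, AG z.2 z.1 v * F z.1 := by
    filter_upwards [hpos, hAG, hX.ae_integrable_density hP hG ha, hi'.prod_right_ae]
      with z hz hA hd hc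
    rw [integral_mul_const, integral_mul_const]
    congr 1
    simp only [spaceTimeDensity_of_pos G z₀ hz] at hd
    have hc' : Integrable fun v => belowRate ν t (z.1, v) * G z.2 z₀.1 z₀.2 z.1 v := by
      refine hc.congr (Eventually.of_forall fun v => ?_)
      exact congrArg _ (spaceTimeDensity_of_pos G z₀ hz z.1 v)
    have hcont : Continuous fun v => G z.2 z₀.1 z₀.2 z.1 v :=
      (hG.continuous z₀.1 z₀.2).comp_continuous (f := fun v : ℝ => (z.2, z.1, v)) (by fun_prop)
        fun v => ⟨hz, mem_univ _⟩
    rw [hA.1.integral_Ioi hν hA.2 (fun v => hG.nonneg _ _ _ _ _ hz) hcont hd hc']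
    refine integral_congr_ae (Eventually.of_forall fun v => ?_)
    exact congrArg _ (spaceTimeDensity_of_pos G z₀ hz z.1 v)
  have hint : Integrable (fun z : E × ℝ => ∫ v in Ioi t, AG z.2 z.1 v * F z.1)
      ((volume : Measure E).prod (volume.restrict (Ioc a b))) := hiF'.integral_prod_left.congr hae
  refine ⟨hint, ?_⟩
  rw [← integral_prod _ hint, ← integral_congr_ae hae, ← hassoc.integral_comp']
  exact integral_prod _ hiF'

/-- The formula without the adjoint operator. -/
lemma IsRegularProcess.integral_crossRate (hP : IsTransitionFunction P)
    (hν : IsJumpDensity ν) (hgen : HasGeneratorSum P Q ν) (hG : IsContinuousTransitionDensity P G)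
    (hX : IsRegularProcess P z₀ X μ) (ha : 0 < a) (hab : a ≤ b) {F : E → ℝ} (hF : Measurable F)
    {C : ℝ} (hC : ∀ y, |F y| ≤ C) :
    Integrable (fun q : E × ℝ × ℝ =>
        crossRate ν t (q.1, q.2.2) * G q.2.1 z₀.1 z₀.2 q.1 q.2.2 * F q.1)
      ((volume : Measure E).prod ((volume.restrict (Ioc a b)).prod
        (volume.restrict (Ioc z₀.2 t)))) ∧
    ∫ q, crossingDensity ν G t z₀ q * F q.1 ∂spaceTime E a b =
      ∫ y, ∫ s in Ioc a b, ∫ v in Ioc z₀.2 t,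
        crossRate ν t (y, v) * G s z₀.1 z₀.2 y v * F y := by
  -- The restriction to `v₀ < v ≤ t` loses nothing: the density vanishes almost everywhere for `v ≤
  -- v₀`, and `belowRate` vanishes for `v ≥ t`. On the strip `belowRate` and `crossRate` can differ
  -- only at `v = t`, a null set.
  set S : Set (E × ℝ × ℝ) := univ ×ˢ (univ ×ˢ Ioc z₀.2 t) with hS
  have hSm : MeasurableSet S := by measurability
  have hmeas : (volume : Measure E).prod ((volume.restrict (Ioc a b)).prod
      (volume.restrict (Ioc z₀.2 t))) = (spaceTime E a b).restrict S := by
    rw [hS, spaceTime, ← Measure.prod_restrict, ← Measure.prod_restrict, Measure.restrict_univ,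
      Measure.restrict_univ]
  have hiF : Integrable (fun q => crossingDensity ν G t z₀ q * F q.1) (spaceTime E a b) :=
    (hX.integrable_crossingDensity hP hν hgen hG ha.le hab).mul_bdd
      (hF.comp measurable_fst).aestronglyMeasurable (Eventually.of_forall fun q => hC _)
  have hne : ∀ᵐ q ∂spaceTime E a b, q.2.2 ≠ t :=
    Measure.quasiMeasurePreserving_snd.ae (p := fun z : ℝ × ℝ => z.2 ≠ t)
      (Measure.quasiMeasurePreserving_snd.ae (p := fun v : ℝ => v ≠ t) (Measure.ae_ne volume t))
  have hae : (fun q => crossingDensity ν G t z₀ q * F q.1) =ᵐ[(spaceTime E a b).restrict S]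
      fun q => crossRate ν t (q.1, q.2.2) * G q.2.1 z₀.1 z₀.2 q.1 q.2.2 * F q.1 := by
    filter_upwards [ae_restrict_mem hSm, ae_restrict_of_ae hne,
      ae_restrict_of_ae (ae_spaceTime_pos (E := E) (b := b) ha.le)] with q hq hq1 hq2
    have hlt : q.2.2 < t := lt_of_le_of_ne hq.2.2.2 hq1
    rw [crossingDensity, belowRate,
      indicator_of_mem (show (q.1, q.2.2) ∈ {z : E × ℝ | z.2 < t} from hlt)]
    exact congrArg (fun x => _ * x * _) (spaceTimeDensity_of_pos G z₀ hq2 q.1 q.2.2)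
  have hint := hiF.restrict (s := S) |>.congr hae
  have hall : ∫ q, crossingDensity ν G t z₀ q * F q.1 ∂spaceTime E a b =
      ∫ q in S, crossRate ν t (q.1, q.2.2) * G q.2.1 z₀.1 z₀.2 q.1 q.2.2 * F q.1
        ∂spaceTime E a b := by
    rw [← integral_congr_ae hae]
    refine (setIntegral_eq_integral_of_ae_compl_eq_zero ?_).symm
    filter_upwards [hX.ae_spaceTimeDensity_eq_zero hP hG ha, hne] with q h0 hq hqS
    rw [crossingDensity]
    rcases le_or_gt q.2.2 z₀.2 with hle | hlt
    · rw [h0 hle, mul_zero, zero_mul]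
    · have htle : ¬ q.2.2 < t := fun h => hqS ⟨mem_univ _, mem_univ _, hlt, h.le⟩
      rw [belowRate, indicator_of_notMem (show (q.1, q.2.2) ∉ {z : E × ℝ | z.2 < t} from htle),
        zero_mul, zero_mul]
  rw [hall, ← hmeas]
  rw [← hmeas] at hint
  refine ⟨hint, ?_⟩
  rw [integral_prod _ hint]
  refine integral_congr_ae ?_
  filter_upwards [hint.prod_right_ae] with y hy
  exact integral_prod _ hy

/-- The crossing rate as the value of the jump operator at an indicator. -/
lemma integral_jumpOp_indicator_mul {E : Type*} (ν : ℝ → ℝ → E → ℝ) (y : E) (c t : ℝ)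
    (g : ℝ → ℝ) :
    ∫ v in Ioc c t, jumpOp ν y ((Ici t).indicator 1) v * g v =
      ∫ v in Ioc c t, crossRate ν t (y, v) * g v := by
  -- At `v = t` the integrands may differ, as the indicator is already `1` there.
  rw [integral_Ioc_eq_integral_Ioo, integral_Ioc_eq_integral_Ioo]
  refine setIntegral_congr_fun measurableSet_Ioo fun v hv => ?_
  simp only [jumpOp_indicator_Ici ν y hv.2]

end SpaceTime

end MonotoneSubordination

end

/-! ### Assembly of the theorem. -/

theorem mainTheorem4 (d : ℕ)
    (P : ℝ≥0 → Kernel (EuclideanSpace ℝ (Fin d) × ℝ) (EuclideanSpace ℝ (Fin d) × ℝ))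
    (Q : ℝ≥0 → Kernel (EuclideanSpace ℝ (Fin d)) (EuclideanSpace ℝ (Fin d)))
    (ν : ℝ → ℝ → EuclideanSpace ℝ (Fin d) → ℝ)
    (G : ℝ → EuclideanSpace ℝ (Fin d) → ℝ → EuclideanSpace ℝ (Fin d) → ℝ → ℝ)
    (hP : MonotoneSubordination.IsTransitionFunction P)
    (hν : MonotoneSubordination.IsJumpDensity ν)
    (hgen : MonotoneSubordination.HasGeneratorSum P Q ν)
    (hG : MonotoneSubordination.IsContinuousTransitionDensity P G)
    {Ω : Type*} [MeasurableSpace Ω] (μ : Measure Ω) [IsProbabilityMeasure μ]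
    (Y : ℝ≥0 → Ω → EuclideanSpace ℝ (Fin d)) (V : ℝ≥0 → Ω → ℝ)
    (y₀ : EuclideanSpace ℝ (Fin d)) (v₀ : ℝ)
    (hYV : MonotoneSubordination.IsMarkovProcess P (y₀, v₀) (fun s ω => (Y s ω, V s ω)) μ)
    (hright : ∀ᵐ ω ∂μ, ∀ s : ℝ≥0, ContinuousWithinAt (fun u => (Y u ω, V u ω)) (Ici s) s)
    (t : ℝ) (ht : v₀ < t) (K : ℝ) (hK : 0 < K) :
    -- the formula with the adjoint operator, whenever `A^* G` exists as a function
    (∀ AG : ℝ → EuclideanSpace ℝ (Fin d) → ℝ → ℝ,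
      (∀ᵐ z : EuclideanSpace ℝ (Fin d) × ℝ ∂(volume.prod (volume.restrict (Icc (1 / K) K))),
        MonotoneSubordination.IsAdjointImage ν z.1 (G z.2 y₀ v₀ z.1) (AG z.2 z.1) ∧
          IntegrableOn (AG z.2 z.1) (Ioi t)) →
      ∀ F : EuclideanSpace ℝ (Fin d) →ᵇ ℝ,
        Integrable (fun z : EuclideanSpace ℝ (Fin d) × ℝ => ∫ v in Ioi t, AG z.2 z.1 v * F z.1)
          (volume.prod (volume.restrict (Icc (1 / K) K))) ∧
        MonotoneSubordination.subordinatedExpectation μ Y V t K F =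
          ∫ y, ∫ s in Icc (1 / K) K, ∫ v in Ioi t, AG s y v * F y) ∧
    -- the formulas without the adjoint operator
    (∀ F : EuclideanSpace ℝ (Fin d) →ᵇ ℝ,
      Integrable (fun z : EuclideanSpace ℝ (Fin d) × ℝ × ℝ =>
          (∫ w in Ioi (t - z.2.2), ν z.2.2 w z.1) * G z.2.1 y₀ v₀ z.1 z.2.2 * F z.1)
        (volume.prod ((volume.restrict (Icc (1 / K) K)).prod (volume.restrict (Ioc v₀ t)))) ∧
      MonotoneSubordination.subordinatedExpectation μ Y V t K F =
        ∫ y, ∫ s in Icc (1 / K) K, ∫ v in Ioc v₀ t,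
          MonotoneSubordination.jumpOp ν y ((Ici t).indicator 1) v * G s y₀ v₀ y v * F y ∧
      MonotoneSubordination.subordinatedExpectation μ Y V t K F =
        ∫ y, ∫ s in Icc (1 / K) K, ∫ v in Ioc v₀ t,
          (∫ w in Ioi (t - v), ν v w y) * G s y₀ v₀ y v * F y) := by
  -- For `K < 1` the interval is empty, as is its counterpart for the passage time, and all sides
  -- vanish.
  rcases lt_or_ge K 1 with hK1 | hK1
  · have hlt : K < 1 / K := hK1.trans ((one_lt_div hK).2 hK1)
    have hexp : ∀ F : EuclideanSpace ℝ (Fin d) →ᵇ ℝ,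
        MonotoneSubordination.subordinatedExpectation μ Y V t K F = 0 := fun F => by
      rw [MonotoneSubordination.subordinatedExpectation,
        Icc_eq_empty (not_le.2 ((ENNReal.ofReal_lt_ofReal_iff (by positivity)).2 hlt))]
      simp
    simp only [hexp, Icc_eq_empty (not_le.2 hlt), Measure.restrict_empty, Measure.prod_zero,
      Measure.zero_prod, integral_zero_measure, integral_zero, integrable_zero_measure,
      and_self, implies_true]
  have ha : 0 < 1 / K := by positivity
  have hab : 1 / K ≤ K := ((div_le_one hK).2 hK1).trans hK1
  have hM := hG.measurable_apply hP
  -- The passage formula is applied to a regular version, which has almost surely the same paths and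
  -- so the same passage time.
  obtain ⟨X, hX, hXY⟩ := hYV.exists_regular hP (hgen.ae_le hP hν hM) hright
  simp only [← restrict_Ioc_eq_restrict_Icc]
  have hexp : ∀ F : EuclideanSpace ℝ (Fin d) →ᵇ ℝ,
      MonotoneSubordination.subordinatedExpectation μ Y V t K F =
        ∫ q, MonotoneSubordination.crossingDensity ν G t (y₀, v₀) q * F q.1
          ∂MonotoneSubordination.spaceTime (EuclideanSpace ℝ (Fin d)) (1 / K) K := fun F => by
    rw [hX.subordinatedExpectation_eq hP hν hgen hG hXY t hK1 F.continuous F.norm_coe_le_norm,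
      hX.integral_belowRate_mul hP hν hG ha.le F.continuous.measurable]
  refine ⟨fun AG hAG F => ?_, fun F => ?_⟩
  · rw [hexp]
    exact hX.integral_adjoint hP hν hgen hG ha.le hab F.continuous.measurable F.norm_coe_le_norm hAG
  · obtain ⟨h1, h2⟩ := hX.integral_crossRate (t := t) hP hν hgen hG ha hab
      F.continuous.measurable F.norm_coe_le_norm
    rw [hexp]
    refine ⟨h1, h2.trans ?_, h2⟩
    refine integral_congr_ae (Eventually.of_forall fun y => ?_)
    refine integral_congr_ae (Eventually.of_forall fun s => ?_)
    simpa only [mul_assoc] using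
      (MonotoneSubordination.integral_jumpOp_indicator_mul ν y v₀ t
        fun v => G s y₀ v₀ y v * F y).symm
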